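/- Let $\alpha<0$ and let $v:\mathbb R_+\to\mathbb C$ be measurable with $\int_0^\infty(1+x^2)|v(x)|^2\,dx<\infty$. Put $\tilde v(\lambda)=\int_0^\infty e^{-i\lambda x}v(x)\,dx$, $g(y)=\int_0^\infty\overline{v(x+y)}\,v(x)\,dx$ and $\Phi(\lambda)=\int_0^\infty e^{-i\lambda y}g(y)\,dy$ for $\operatorname{Im}\lambda\le 0$, write $f^*(\lambda)=\overline{f(\overline\lambda)}$, and for $\operatorname{Im}\lambda\ge 0$ let $$r(\lambda)=\Phi^*(\lambda)+\Phi(-\lambda)-\tilde v^*(\lambda)\,\tilde v(-\lambda)-\frac{2i\lambda}{\alpha}.$$ For real $\lambda$ let $W(\lambda)=\tilde v(\lambda)-\tilde v(-\lambda)$ and, where $r(\lambda)\ne0$, let $S(\lambda)=-r(-\lambda)/r(\lambda)$; this is the scattering function of the pair $L_1=L_0+\alpha\langle\cdot,v\rangle v$, $L_0=-d^2/dx^2$ with $y(0)=0$, in $L^2(\mathbb R_+)$. Suppose that $i\varkappa$ ($\varkappa>0$) is a zero of $r$ and that the set of real zeros of $r$ is $\{0,\pm\lambda_1,\dots,\pm\lambda_q\}$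 with distinct $\lambda_k>0$, $q\ge0$. Then there is exactly one odd function $\zeta:\mathbb R\to\mathbb R$ that is continuous on $\mathbb R\setminus\{0\}$, tends to $0$ at infinity, and satisfies $S(\lambda)=e^{-2i\zeta(\lambda)}$ for all real $\lambda$ with $r(\lambda)\neq0$. For every real $\lambda\ne0$ the principal values below exist and $$|W(\lambda)|^2=\frac{4\lambda}{\alpha}\,\psi^{q+1}(\lambda)\,(\lambda^2+\varkappa^2)\prod_{k=1}^q(\lambda^2-\lambda_k^2)\,\sin\zeta(\lambda)\,\exp\Big\{\frac1\pi\,\mathrm{p.v.}\!\!\int_{\mathbb R}\frac{\zeta(t)}{t-\lambda}\,dt\Big\},$$ where $$\psi(\lambda)=\frac1{\lambda^2+1}\exp\Big\{\frac2\pi\,\mathrm{p.v.}\!\!\int_{\mathbb R}\frac{\operatorname{arccot}t}{t-\lambda}\,dt\Big\},\qquad \operatorname{arccot}t=\arctan\frac1t;$$ at $\lambda=0$ the formula holds in the sense that $W(0)=0$ and the right-hand side tends to $0$ as $\lambda\to0$. If moreover $\int_0^\infty|v(x)|^2\,dx=1$, then $$\alpha=\frac2\pi\int_0^\infty\lambda\,\psi^{q+1}(\lambda)\,(\lambda^2+\varkappa^2)\prod_{k=1}^q(\lambda^2-\lambda_k^2)\,\sin\zeta(\lambda)\,\exp\Big\{\frac1\pi\,\mathrm{p.v.}\!\!\int_{\mathbb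 R}\frac{\zeta(t)}{t-\lambda}\,dt\Big\}\,d\lambda,$$ the integral being absolutely convergent. -/

import Mathlib

open Filter Topology MeasureTheory Set

noncomputable section

namespace RankOneScattering

/-- Standing assumption on the potential: `v` is measurable on the half-axis and
`∫₀^∞ (1 + x²) |v(x)|² dx < ∞`. Only the values of `v` on `(0, ∞)` matter. -/
structure Admissible (v : ℝ → ℂ) : Prop where
  aestronglyMeasurable : AEStronglyMeasurable v (volume.restrict (Ioi 0))
  integrable : IntegrableOn (fun x : ℝ => (1 + x ^ 2) * ‖v x‖ ^ 2) (Ioi 0)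

/-- `f*(z) = conj (f (conj z))`. -/
def starFun (f : ℂ → ℂ) (z : ℂ) : ℂ :=
  starRingEnd ℂ (f (starRingEnd ℂ z))

/-- `ṽ(z) = ∫₀^∞ e^{-izx} v(x) dx` (for `Im z ≤ 0`). -/
def fourier (v : ℝ → ℂ) (z : ℂ) : ℂ :=
  ∫ x in Ioi (0 : ℝ), Complex.exp (-(Complex.I * z * x)) * v x

/-- `g(y) = ∫₀^∞ conj (v(x + y)) v(x) dx` (for `y ≥ 0`). -/
def autocorr (v : ℝ → ℂ) (y : ℝ) : ℂ :=
  ∫ x in Ioi (0 : ℝ), starRingEnd ℂ (v (x + y)) * v x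

/-- `Φ(z) = ∫₀^∞ e^{-izy} g(y) dy` (for `Im z ≤ 0`). -/
def Phi (v : ℝ → ℂ) (z : ℂ) : ℂ :=
  ∫ y in Ioi (0 : ℝ), Complex.exp (-(Complex.I * z * y)) * autocorr v y

/-- `r(z) = Φ*(z) + Φ(-z) - ṽ*(z) ṽ(-z) - 2iz/α` (for `Im z ≥ 0`). -/
def r (v : ℝ → ℂ) (α : ℝ) (z : ℂ) : ℂ :=
  starFun (Phi v) z + Phi v (-z) - starFun (fourier v) z * fourier v (-z)
    - 2 * Complex.I * z / (α : ℂ)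

/-- The scattering function `S(x) = -r(-x)/r(x)` for real `x` with `r(x) ≠ 0`. -/
def S (v : ℝ → ℂ) (α : ℝ) (x : ℝ) : ℂ :=
  -r v α (-(x : ℂ)) / r v α (x : ℂ)

/-- `W(x) = ṽ(x) - ṽ(-x)` for real `x`. -/
def W (v : ℝ → ℂ) (x : ℝ) : ℂ :=
  fourier v (x : ℂ) - fourier v (-(x : ℂ))

/-- `ζ` is the phase of the scattering function: the real odd function, continuous off the origin
and vanishing at infinity, such that `S = e^{-2iζ}` wherever `S` is defined. -/
structure IsPhase (v : ℝ → ℂ) (α : ℝ) (ζ : ℝ → ℝ) : Prop where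
  odd : ∀ x, ζ (-x) = -ζ x
  continuousOn : ContinuousOn ζ {0}ᶜ
  tendsto : Tendsto ζ atTop (𝓝 0)
  exp_eq : ∀ x : ℝ, r v α (x : ℂ) ≠ 0 → S v α x = Complex.exp (-2 * Complex.I * (ζ x : ℂ))

/-- The integral of `f` outside the `ε`-neighbourhood of `a`. -/
def truncInt (f : ℝ → ℝ) (a ε : ℝ) : ℝ :=
  ∫ t in {t : ℝ | ε < |t - a|}, f t

/-- The principal value integral of `f` with singularity at `a` exists. -/
def PVExists (f : ℝ → ℝ) (a : ℝ) : Prop :=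
  (∀ ε > 0, IntegrableOn f {t : ℝ | ε < |t - a|}) ∧
    ∃ L : ℝ, Tendsto (truncInt f a) (𝓝[>] 0) (𝓝 L)

/-- The principal value integral of `f` with singularity at `a`
(meaningful under `PVExists f a`). -/
def pv (f : ℝ → ℝ) (a : ℝ) : ℝ :=
  limUnder (𝓝[>] (0 : ℝ)) (truncInt f a)

/-- The odd branch of the inverse cotangent, with values in `(-π/2, π/2)`. -/
def arccot (t : ℝ) : ℝ :=
  Real.arctan (1 / t)

/-- `ψ(x) = (x² + 1)⁻¹ exp{(2/π) p.v.∫ arccot t / (t - x) dt}`. -/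
def psi (x : ℝ) : ℝ :=
  1 / (x ^ 2 + 1) * Real.exp (2 / Real.pi * pv (fun t => arccot t / (t - x)) x)

/-- `ψ^{q+1}(x) (x² + κ²) ∏ₖ (x² - λₖ²) sin ζ(x) exp{(1/π) p.v.∫ ζ(t)/(t - x) dt}`. -/
def scatteringExpr {q : ℕ} (κ : ℝ) (lam : Fin q → ℝ) (ζ : ℝ → ℝ) (x : ℝ) : ℝ :=
  psi x ^ (q + 1) * (x ^ 2 + κ ^ 2) * (∏ k, (x ^ 2 - lam k ^ 2)) * Real.sin (ζ x) *
    Real.exp (1 / Real.pi * pv (fun t => ζ t / (t - x)) x)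

end RankOneScattering

end

/-! Everything rests on one analytic function. For `Im z > 0`, Fubini turns `r` into the quadratic
form of the Dirichlet resolvent kernel `e^{iz|x-y|} - e^{iz(x+y)}` minus `2iz/α`, and Fourier
inversion of `e^{iz|s|}` gives `r(z) = -(2iz/α) D(z)` with `D(z) = 1 + (α/4π) ∫ |W(t)|²/(t² - z²)
dt`. On the real axis `2 Re r = |W|²` and `r(-x) = conj r(x)`; hence `S = -conj r / r` records the
argument of `r`, and the theorem recovers the modulus from the argument.

Since `D(iκ) = 0`, the resolvent identity gives `F(z) := z² D(z)/(z² + κ²) = (α/4π) z² ∫ p(t)/(t² -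
z²) dt` with `p = |W|²/(t² + κ²) ≥ 0`. As `α < 0`, `F` is a positive constant times `-z² ∫ p/(t² -
z²)`, which never meets the closed negative half-axis (`reducedDet_mem_slitPlane`); the same is true
of each `z²/(z² - λₖ²)`. So `L = log F + ∑ log (z²/(z² - λₖ²))`, with principal logarithms, is
holomorphic in the upper half-plane, has imaginary part bounded by `π(q+1)`, and tends to `0` at
infinity.

The delicate point is that `L` extends continuously to the real axis minus the origin, also at `±λₖ`
(`tendsto_reducedDet_mul`). There `W` vanishes, because `2 Re r = |W|²`. The weight `x²` on `|v|²`
makes `W` little-Hölder of exponent 1/2 (`ft_little_holder`) and, through Hardy's inequality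
(`hardy`), makes `|W|²/(t² - λₖ²)²` integrable. Expanding `D` twice in powers of `z² - λₖ²` then
produces a nonzero linear coefficient, and the remainder is negligible by a local estimate of a
Cauchy integral (`tendsto_mul_cauchy`). So `λₖ` is a simple zero, and the `k`-th factor removes it.

The phase is `ζ = Im L` on the axis. Up to a real factor the boundary value of `exp L` is `i r`,
whence `S = e^{-2iζ}`; taking imaginary parts expresses `|W|²` through `e^{Re L} sin ζ`. Cauchy's
theorem on half-annuli gives `p.v. ∫ ζ/(t - x) = π Re L(x)` (`pv_im_eq`), and the same lemma applied
to `-log (z/(z + i))` shows `ψ(x) = x⁻²` (`pv_arccot`). Together these are the stated formula. Two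
phases differ on `(0, ∞)` by a continuous function with values in `πℤ` that vanishes at infinity,
which yields uniqueness. The formula for `α` is Plancherel's identity for the odd extension of `v`,
whose transform is `W`. -/

namespace RankOneScattering

/-! ### Plancherel's theorem for the integral Fourier transform. -/

section Plancherel

open FourierTransform SchwartzMap
open scoped ContDiff

theorem continuous_fourier_of_integrable {f : ℝ → ℂ} (h1 : Integrable f) :
    Continuous (𝓕 f) :=
  VectorFourier.fourierIntegral_continuous Real.continuous_fourierChar
    (by exact continuous_inner) h1

/-- Both sides are locally integrable, so it is enough to test against smooth compactly supported
functions. There the `L²` transform acts by duality as a tempered distribution, and the integral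
transform satisfies the same duality by Fubini. -/
theorem fourier_toLp_ae_eq {f : ℝ → ℂ} (h1 : Integrable f) (h2 : MemLp f 2) :
    ((𝓕 (h2.toLp f) : Lp (α := ℝ) ℂ 2 volume) : ℝ → ℂ) =ᵐ[volume] 𝓕 f := by
  apply ae_eq_of_integral_contDiff_smul_eq
  · exact (Lp.memLp _).locallyIntegrable (by norm_num)
  · exact (continuous_fourier_of_integrable h1).locallyIntegrable
  · intro g g_smooth g_cpt
    have hg₁ : HasCompactSupport (Complex.ofRealCLM ∘ g) := g_cpt.comp_left rfl
    have hg₂ : ContDiff ℝ ∞ (Complex.ofRealCLM ∘ g) :=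
      Complex.ofRealCLM.contDiff.comp g_smooth
    set φ : 𝓢(ℝ, ℂ) := hg₁.toSchwartzMap hg₂ with hφ
    have key := congrArg (fun T : TemperedDistribution ℝ ℂ => T φ)
      (Lp.fourier_toTemperedDistribution_eq (h2.toLp f))
    simp only [TemperedDistribution.fourier_apply, Lp.toTemperedDistribution_apply] at key
    have e1 : ∫ x, g x • ((𝓕 (h2.toLp f) : Lp (α := ℝ) ℂ 2 volume) : ℝ → ℂ) x =
        ∫ x, φ x • ((𝓕 (h2.toLp f) : Lp (α := ℝ) ℂ 2 volume) : ℝ → ℂ) x := by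
      refine integral_congr_ae (Eventually.of_forall fun x => ?_)
      simp [hφ]
    have e2 : ∫ x, (𝓕 φ) x • (h2.toLp f : ℝ → ℂ) x = ∫ x, (𝓕 (φ : ℝ → ℂ)) x • f x := by
      refine integral_congr_ae ?_
      filter_upwards [h2.coeFn_toLp] with x hx
      rw [hx, SchwartzMap.fourier_coe]
    have e3 := VectorFourier.integral_fourierIntegral_smul_eq_flip (μ := volume) (ν := volume)
      (L := innerₗ ℝ) Real.continuous_fourierChar (by exact continuous_inner) h1 φ.integrable
    rw [e1, ← key, e2]
    have e4 : ∫ x, g x • (𝓕 f) x = ∫ x, (𝓕 f) x • φ x := by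
      refine integral_congr_ae (Eventually.of_forall fun x => ?_)
      simp [hφ, mul_comm]
    rw [e4]
    have e5 : ∫ x, (𝓕 (φ : ℝ → ℂ)) x • f x = ∫ x, f x • (𝓕 (φ : ℝ → ℂ)) x := by
      simp [mul_comm]
    rw [e5, flip_innerₗ] at *
    exact e3.symm

theorem norm_sq_Lp_eq_integral (g : Lp (α := ℝ) ℂ 2 volume) :
    ‖g‖ ^ 2 = ∫ x, ‖(g : ℝ → ℂ) x‖ ^ 2 := by
  have h := MeasureTheory.L2.inner_def (𝕜 := ℂ) g g
  rw [inner_self_eq_norm_sq_to_K] at h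
  have h' : ∀ x : ℝ, inner ℂ ((g : ℝ → ℂ) x) ((g : ℝ → ℂ) x) =
      ((‖(g : ℝ → ℂ) x‖ ^ 2 : ℝ) : ℂ) := by
    intro x; rw [inner_self_eq_norm_sq_to_K]; simp
  simp_rw [h'] at h
  have h2 : ((‖g‖ ^ 2 : ℝ) : ℂ) = ((∫ x, ‖(g : ℝ → ℂ) x‖ ^ 2 : ℝ) : ℂ) := by
    rw [← integral_complex_ofReal, ← h]
    push_cast
    rfl
  exact_mod_cast h2

/-- Plancherel's theorem for functions in `L¹ ∩ L²`. -/
theorem plancherel {f : ℝ → ℂ} (h1 : Integrable f) (h2 : MemLp f 2) :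
    MemLp (𝓕 f) 2 ∧ ∫ ξ, ‖𝓕 f ξ‖ ^ 2 = ∫ x, ‖f x‖ ^ 2 := by
  have hae := fourier_toLp_ae_eq h1 h2
  refine ⟨(memLp_congr_ae hae).1 (Lp.memLp _), ?_⟩
  have e1 : ∫ ξ, ‖𝓕 f ξ‖ ^ 2 = ‖(𝓕 (h2.toLp f) : Lp (α := ℝ) ℂ 2 volume)‖ ^ 2 := by
    rw [norm_sq_Lp_eq_integral]
    refine integral_congr_ae ?_
    filter_upwards [hae] with x hx
    rw [hx]
  rw [e1, Lp.norm_fourier_eq, norm_sq_Lp_eq_integral]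
  refine integral_congr_ae ?_
  filter_upwards [h2.coeFn_toLp] with x hx
  rw [hx]

theorem fourier_eq_integral_exp (f : ℝ → ℂ) (ξ : ℝ) :
    𝓕 f ξ = ∫ x : ℝ, Complex.exp (-(Complex.I * ((2 * Real.pi * ξ : ℝ) : ℂ) * x)) * f x := by
  rw [Real.fourier_real_eq_integral_exp_smul]
  refine integral_congr_ae (Eventually.of_forall fun x => ?_)
  simp only [smul_eq_mul]
  congr 2
  push_cast
  ring

/-- Plancherel's theorem in the normalisation `f̂(t) = ∫ e^{-itx} f(x) dx`. -/
theorem plancherel_exp {f : ℝ → ℂ} (h1 : Integrable f) (h2 : MemLp f 2) :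
    Integrable (fun t : ℝ => ‖∫ x : ℝ, Complex.exp (-(Complex.I * t * x)) * f x‖ ^ 2) ∧
    ∫ t : ℝ, ‖∫ x : ℝ, Complex.exp (-(Complex.I * t * x)) * f x‖ ^ 2 =
      2 * Real.pi * ∫ x, ‖f x‖ ^ 2 := by
  obtain ⟨hm, he⟩ := plancherel h1 h2
  set F : ℝ → ℝ := fun t => ‖∫ x : ℝ, Complex.exp (-(Complex.I * t * x)) * f x‖ ^ 2 with hF
  have hFf : ∀ ξ, ‖𝓕 f ξ‖ ^ 2 = F (2 * Real.pi * ξ) := by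
    intro ξ; rw [fourier_eq_integral_exp]
  have hi : Integrable (fun ξ => F (2 * Real.pi * ξ)) := by
    simp_rw [← hFf]
    exact (memLp_two_iff_integrable_sq_norm hm.1).1 hm
  have hpi : (2 * Real.pi) ≠ 0 := by positivity
  refine ⟨(integrable_comp_mul_left_iff F hpi).1 hi, ?_⟩
  simp_rw [hFf] at he
  rw [Measure.integral_comp_mul_left] at he
  rw [← he, abs_of_pos (by positivity), smul_eq_mul, ← mul_assoc, mul_inv_cancel₀ hpi, one_mul]

end Plancherel

/-! ### The kernel `1/(t² - z²)` and its Fourier transform. -/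

section Kernel

/-- Each of `t - z` and `t + z` has squared modulus at least `(1 + t²)/K` with the displayed `K`;
multiply the two bounds and take a square root. -/
theorem one_add_sq_le_mul_norm_sq_sub_sq {z : ℂ} (hz : 0 < z.im) (t : ℝ) :
    1 + t ^ 2 ≤ (2 + (2 * z.re ^ 2 + 1) / z.im ^ 2) * ‖(t : ℂ) ^ 2 - z ^ 2‖ := by
  have hsq : ∀ w : ℂ, w.im ^ 2 = z.im ^ 2 → w.re ^ 2 = (t - z.re) ^ 2 ∨ w.re ^ 2 = (t + z.re) ^ 2 →
      1 + t ^ 2 ≤ (2 + (2 * z.re ^ 2 + 1) / z.im ^ 2) * ‖w‖ ^ 2 := by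
    intro w hw hw'
    rw [← Complex.normSq_eq_norm_sq, Complex.normSq_apply]
    have h1 : (2 * z.re ^ 2 + 1) ≤ (2 * z.re ^ 2 + 1) / z.im ^ 2 * (w.re * w.re + w.im * w.im) := by
      rw [div_mul_eq_mul_div, le_div_iff₀ (by positivity)]
      apply mul_le_mul_of_nonneg_left _ (by positivity)
      nlinarith [mul_self_nonneg w.re]
    have h2 : t ^ 2 ≤ 2 * (w.re * w.re) + 2 * z.re ^ 2 := by
      rcases hw' with h | h
      · nlinarith [sq_nonneg (t - 2 * z.re)]
      · nlinarith [sq_nonneg (t + 2 * z.re)]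
    nlinarith [mul_self_nonneg w.im]
  have ha := hsq ((t : ℂ) - z) (by simp) (by simp)
  have hb := hsq ((t : ℂ) + z) (by simp) (by simp)
  have hK : 0 ≤ (2 + (2 * z.re ^ 2 + 1) / z.im ^ 2) := by positivity
  have hn : ‖(t : ℂ) ^ 2 - z ^ 2‖ = ‖(t : ℂ) - z‖ * ‖(t : ℂ) + z‖ := by
    rw [← norm_mul]; congr 1; ring
  rw [hn]
  refine abs_le_of_sq_le_sq' ?_ (by positivity) |>.2
  calc (1 + t ^ 2) ^ 2 = (1 + t ^ 2) * (1 + t ^ 2) := by ring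
    _ ≤ _ := mul_le_mul ha hb (by positivity) (by positivity)
    _ = _ := by ring

theorem sq_sub_sq_ne_zero {z : ℂ} (hz : 0 < z.im) (t : ℝ) : (t : ℂ) ^ 2 - z ^ 2 ≠ 0 := by
  intro h
  have := one_add_sq_le_mul_norm_sq_sub_sq hz t
  rw [h, norm_zero, mul_zero] at this
  nlinarith [sq_nonneg t]

theorem norm_inv_sq_sub_sq_le {z : ℂ} (hz : 0 < z.im) (t : ℝ) :
    ‖((t : ℂ) ^ 2 - z ^ 2)⁻¹‖ ≤ (2 + (2 * z.re ^ 2 + 1) / z.im ^ 2) * (1 + t ^ 2)⁻¹ := by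
  have h := one_add_sq_le_mul_norm_sq_sub_sq hz t
  have h0 : 0 < ‖(t : ℂ) ^ 2 - z ^ 2‖ := norm_pos_iff.2 (sq_sub_sq_ne_zero hz t)
  have h1 : 0 < 1 + t ^ 2 := by positivity
  rw [norm_inv, inv_eq_one_div, div_le_iff₀ h0, mul_assoc, mul_comm (_⁻¹), ← mul_assoc,
    ← div_eq_mul_inv, le_div_iff₀ h1, one_mul]
  exact h

theorem continuous_inv_sq_sub_sq {z : ℂ} (hz : 0 < z.im) :
    Continuous fun t : ℝ => ((t : ℂ) ^ 2 - z ^ 2)⁻¹ :=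
  Continuous.inv₀ (by fun_prop) (sq_sub_sq_ne_zero hz)

theorem integrable_inv_sq_sub_sq {z : ℂ} (hz : 0 < z.im) :
    Integrable fun t : ℝ => ((t : ℂ) ^ 2 - z ^ 2)⁻¹ :=
  (integrable_inv_one_add_sq.const_mul _).mono'
    (continuous_inv_sq_sub_sq hz).aestronglyMeasurable
    (Eventually.of_forall (norm_inv_sq_sub_sq_le hz))

/-- For `Im z > 0`, the Fourier transform of `e^{iz|s|}`. -/
theorem integral_exp_mul_exp_abs {z : ℂ} (hz : 0 < z.im) (t : ℝ) :
    Integrable (fun s : ℝ => Complex.exp (Complex.I * z * (|s| : ℝ))) ∧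
    ∫ s : ℝ, Complex.exp (-(Complex.I * t * s)) * Complex.exp (Complex.I * z * (|s| : ℝ)) =
      -(2 * Complex.I * z) * ((t : ℂ) ^ 2 - z ^ 2)⁻¹ := by
  -- Stated for every frequency `τ`: `τ = 0` yields the integrability claim and `τ = t` the value.
  have key : ∀ τ : ℝ,
      IntegrableOn (fun s : ℝ => Complex.exp (-(Complex.I * τ * s)) *
        Complex.exp (Complex.I * z * (|s| : ℝ))) (Iic 0) ∧
      IntegrableOn (fun s : ℝ => Complex.exp (-(Complex.I * τ * s)) *
        Complex.exp (Complex.I * z * (|s| : ℝ))) (Ioi 0) ∧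
      ∫ s in Iic (0 : ℝ), Complex.exp (-(Complex.I * τ * s)) *
        Complex.exp (Complex.I * z * (|s| : ℝ)) = 1 / (-(Complex.I * τ) - Complex.I * z) ∧
      ∫ s in Ioi (0 : ℝ), Complex.exp (-(Complex.I * τ * s)) *
        Complex.exp (Complex.I * z * (|s| : ℝ)) = -1 / (-(Complex.I * τ) + Complex.I * z) := by
    intro τ
    have e1 : EqOn (fun s : ℝ => Complex.exp (-(Complex.I * τ * s)) *
        Complex.exp (Complex.I * z * (|s| : ℝ)))
        (fun s : ℝ => Complex.exp ((-(Complex.I * τ) - Complex.I * z) * s)) (Iic 0) := by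
      intro s hs
      simp only
      rw [← Complex.exp_add, abs_of_nonpos hs]
      congr 1; push_cast; ring
    have e2 : EqOn (fun s : ℝ => Complex.exp (-(Complex.I * τ * s)) *
        Complex.exp (Complex.I * z * (|s| : ℝ)))
        (fun s : ℝ => Complex.exp ((-(Complex.I * τ) + Complex.I * z) * s)) (Ioi 0) := by
      intro s hs
      simp only
      rw [← Complex.exp_add, abs_of_pos hs]
      congr 1; ring
    have r1 : 0 < (-(Complex.I * τ) - Complex.I * z).re := by simpa using hz
    have r2 : (-(Complex.I * τ) + Complex.I * z).re < 0 := by simpa using hz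
    refine ⟨(integrableOn_congr_fun e1 measurableSet_Iic).2 (integrableOn_exp_mul_complex_Iic r1 0),
      (integrableOn_congr_fun e2 measurableSet_Ioi).2 (integrableOn_exp_mul_complex_Ioi r2 0), ?_, ?_⟩
    · rw [setIntegral_congr_fun measurableSet_Iic e1, integral_exp_mul_complex_Iic r1]
      simp
    · rw [setIntegral_congr_fun measurableSet_Ioi e2, integral_exp_mul_complex_Ioi r2]
      simp
  have hint : ∀ τ : ℝ, Integrable (fun s : ℝ => Complex.exp (-(Complex.I * τ * s)) *
        Complex.exp (Complex.I * z * (|s| : ℝ))) := by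
    intro τ
    rw [← integrableOn_univ, ← Iic_union_Ioi (a := (0 : ℝ))]
    exact (key τ).1.union (key τ).2.1
  refine ⟨by simpa using hint 0, ?_⟩
  rw [← integral_add_compl measurableSet_Iic (hint t), compl_Iic, (key t).2.2.1, (key t).2.2.2]
  have h0 := sq_sub_sq_ne_zero hz t
  have h1 : (t : ℂ) + z ≠ 0 := by
    intro h; apply h0; linear_combination (t - z) * h
  have h2 : -(t : ℂ) + z ≠ 0 := by
    intro h; apply h0; linear_combination -(t + z) * h
  have e1 : (-(Complex.I * t) - Complex.I * z) = -Complex.I * (t + z) := by ring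
  have e2 : (-(Complex.I * t) + Complex.I * z) = Complex.I * (-t + z) := by ring
  have e3 : (t : ℂ) ^ 2 - z ^ 2 = -((t + z) * (-t + z)) := by ring
  rw [e1, e2, e3]
  have hI := Complex.I_ne_zero
  field_simp
  linear_combination (-2 * z) * Complex.I_sq

open FourierTransform in
/-- Fourier inversion for `e^{iz|s|}`. -/
theorem integral_exp_mul_inv_sq_sub_sq {z : ℂ} (hz : 0 < z.im) (s : ℝ) :
    ∫ t : ℝ, Complex.exp (Complex.I * t * s) * (-(2 * Complex.I * z) * ((t : ℂ) ^ 2 - z ^ 2)⁻¹) =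
      2 * Real.pi * Complex.exp (Complex.I * z * (|s| : ℝ)) := by
  set f : ℝ → ℂ := fun s => Complex.exp (Complex.I * z * (|s| : ℝ)) with hf
  have hfi : Integrable f := (integral_exp_mul_exp_abs hz 0).1
  have hF : 𝓕 f = fun w : ℝ => -(2 * Complex.I * z) *
      (((2 * Real.pi * w : ℝ) : ℂ) ^ 2 - z ^ 2)⁻¹ := by
    ext w
    rw [fourier_eq_integral_exp, (integral_exp_mul_exp_abs hz _).2]
  have hpi : (2 * Real.pi) ≠ 0 := by positivity
  have hFi : Integrable (𝓕 f) := by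
    rw [hF]
    exact ((integrable_inv_sq_sub_sq hz).const_mul _).comp_mul_left' hpi
  have hinv := hfi.fourierInv_fourier_eq hFi (v := s)
    (by apply Continuous.continuousAt; rw [hf]; fun_prop)
  rw [Real.fourierInv_eq_fourier_neg, fourier_eq_integral_exp, hF] at hinv
  set G : ℝ → ℂ := fun t => Complex.exp (Complex.I * t * s) *
    (-(2 * Complex.I * z) * ((t : ℂ) ^ 2 - z ^ 2)⁻¹) with hG
  have e : ∀ w : ℝ, Complex.exp (-(Complex.I * ((2 * Real.pi * -s : ℝ) : ℂ) * w)) *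
      (-(2 * Complex.I * z) * (((2 * Real.pi * w : ℝ) : ℂ) ^ 2 - z ^ 2)⁻¹) =
      G (2 * Real.pi * w) := by
    intro w
    simp only [hG]
    congr 2
    push_cast; ring
  simp_rw [e] at hinv
  rw [Measure.integral_comp_mul_left, abs_of_pos (by positivity)] at hinv
  change _ = 2 * Real.pi * f s
  rw [← hinv, Complex.real_smul]
  push_cast
  have : (Real.pi : ℂ) ≠ 0 := by exact_mod_cast Real.pi_ne_zero
  field_simp

end Kernel

end RankOneScattering

/-! ### The function `r` as a resolvent form, and its spectral representation. -/

noncomputable section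

namespace RankOneScattering

/-- Arithmetic-geometric mean with weight: `2|v| ≤ (1 + x²)⁻¹ + (1 + x²)|v|²`. -/
theorem Admissible.integrableOn {v : ℝ → ℂ} (hv : Admissible v) : IntegrableOn v (Ioi 0) := by
  have h1 : IntegrableOn (fun x : ℝ => (1 + x ^ 2)⁻¹ + (1 + x ^ 2) * ‖v x‖ ^ 2) (Ioi 0) :=
    integrable_inv_one_add_sq.integrableOn.add hv.integrable
  refine Integrable.mono' h1 hv.aestronglyMeasurable (Eventually.of_forall fun x => ?_)
  have hx : 0 < 1 + x ^ 2 := by positivity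
  have h2 : 0 < (1 + x ^ 2)⁻¹ := inv_pos.2 hx
  have h3 : (1 + x ^ 2)⁻¹ * (1 + x ^ 2) = 1 := inv_mul_cancel₀ hx.ne'
  have h4 : 0 ≤ (1 + x ^ 2) * (‖v x‖ - (1 + x ^ 2)⁻¹) ^ 2 := by positivity
  have h5 : (1 + x ^ 2) * (‖v x‖ - (1 + x ^ 2)⁻¹) ^ 2 =
      (1 + x ^ 2) * ‖v x‖ ^ 2 - 2 * ‖v x‖ * ((1 + x ^ 2)⁻¹ * (1 + x ^ 2)) +
      (1 + x ^ 2)⁻¹ * ((1 + x ^ 2)⁻¹ * (1 + x ^ 2)) := by ring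
  rw [h3] at h5
  nlinarith [norm_nonneg (v x)]

/-- The potential extended by zero to the whole line. -/
def ext (v : ℝ → ℂ) : ℝ → ℂ := (Ioi 0).indicator v

theorem ext_of_pos (v : ℝ → ℂ) {x : ℝ} (hx : 0 < x) : ext v x = v x := indicator_of_mem hx v

theorem ext_of_nonpos (v : ℝ → ℂ) {x : ℝ} (hx : x ≤ 0) : ext v x = 0 :=
  indicator_of_notMem (by simpa using hx) v

theorem Admissible.integrable_ext {v : ℝ → ℂ} (hv : Admissible v) : Integrable (ext v) :=
  (integrable_indicator_iff measurableSet_Ioi).2 hv.integrableOn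

theorem setIntegral_eq_integral_ext (v : ℝ → ℂ) (f : ℝ → ℂ) :
    ∫ x in Ioi (0 : ℝ), f x * v x = ∫ x, f x * ext v x := by
  rw [← integral_indicator measurableSet_Ioi]
  congr 1
  ext x
  by_cases hx : x ∈ Ioi (0 : ℝ)
  · rw [indicator_of_mem hx, ext_of_pos v hx]
  · rw [indicator_of_notMem hx, ext_of_nonpos v (by simpa using hx), mul_zero]

theorem fourier_eq_ext (v : ℝ → ℂ) (z : ℂ) :
    fourier v z = ∫ x : ℝ, Complex.exp (-(Complex.I * z * x)) * ext v x :=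
  setIntegral_eq_integral_ext v _

theorem autocorr_eq_ext (v : ℝ → ℂ) {y : ℝ} (hy : 0 ≤ y) :
    autocorr v y = ∫ x : ℝ, starRingEnd ℂ (ext v (x + y)) * ext v x := by
  rw [autocorr, setIntegral_eq_integral_ext]
  congr 1
  ext x
  rcases le_or_gt x 0 with hx | hx
  · simp [ext_of_nonpos v hx]
  · rw [ext_of_pos v (show 0 < x + y by linarith)]

theorem norm_exp_I_mul_le {z : ℂ} (hz : 0 ≤ z.im) {s : ℝ} (hs : 0 ≤ s) :
    ‖Complex.exp (Complex.I * z * s)‖ ≤ 1 := by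
  rw [Complex.norm_exp, Real.exp_le_one_iff]
  simp
  positivity

/-- Fubini for correlation integrals. -/
theorem integral_mul_correlation {a b h : ℝ → ℂ} (ha : Integrable a) (hb : Integrable b)
    (hh : Measurable h) {C : ℝ} (hC : ∀ s, ‖h s‖ ≤ C) :
    Integrable (fun p : ℝ × ℝ => b p.1 * a p.2 * h (p.2 - p.1)) ∧
    ∫ s, h s * ∫ x, a (x + s) * b x = ∫ p : ℝ × ℝ, b p.1 * a p.2 * h (p.2 - p.1) := by
  have hG : Integrable (fun p : ℝ × ℝ => b p.1 * a p.2 * h (p.2 - p.1)) := by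
    refine (hb.mul_prod ha).mul_bdd (c := C) ?_ (Eventually.of_forall fun p => hC _)
    exact (hh.comp (measurable_snd.sub measurable_fst)).aestronglyMeasurable
  refine ⟨hG, ?_⟩
  -- The shear `(x, s) ↦ (x, x + s)` replaces the shift variable by the second point.
  have hmp : MeasurePreserving (fun p : ℝ × ℝ => (p.1, p.1 + p.2)) (volume.prod volume)
      (volume.prod volume) := measurePreserving_prod_add volume volume
  have hemb : MeasurableEmbedding (fun p : ℝ × ℝ => (p.1, p.1 + p.2)) :=
    (MeasurableEquiv.shearAddRight ℝ).measurableEmbedding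
  have h1 := hmp.integral_comp hemb (fun p : ℝ × ℝ => b p.1 * a p.2 * h (p.2 - p.1))
  have h2 : Integrable (fun p : ℝ × ℝ => b p.1 * a (p.1 + p.2) * h (p.1 + p.2 - p.1))
      (volume.prod volume) := hmp.integrable_comp_of_integrable hG
  rw [Measure.volume_eq_prod, ← h1, integral_prod_symm _ h2]
  congr 1
  ext s
  rw [← integral_const_mul]
  congr 1
  ext x
  rw [add_sub_cancel_left]
  ring

/-- The tensor square `v(x) conj v(y)` of the extended potential. -/
def tensor (v : ℝ → ℂ) (p : ℝ × ℝ) : ℂ := ext v p.1 * starRingEnd ℂ (ext v p.2)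

theorem integrable_conj {X : Type*} [MeasurableSpace X] {μ : Measure X} {f : X → ℂ}
    (hf : Integrable f μ) :
    Integrable (fun x => starRingEnd ℂ (f x)) μ :=
  (LinearIsometryEquiv.integrable_comp_iff (Complex.conjLIE)).2 hf

theorem Admissible.integrable_tensor {v : ℝ → ℂ} (hv : Admissible v) : Integrable (tensor v) :=
  hv.integrable_ext.mul_prod (integrable_conj hv.integrable_ext)

theorem tensor_swap (v : ℝ → ℂ) (p : ℝ × ℝ) : tensor v p.swap = starRingEnd ℂ (tensor v p) := by
  simp [tensor, mul_comm]

theorem tensor_eq_zero_or (v : ℝ → ℂ) (p : ℝ × ℝ) : tensor v p = 0 ∨ (0 < p.1 ∧ 0 < p.2) := by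
  rcases le_or_gt p.1 0 with h | h
  · left; simp [tensor, ext_of_nonpos v h]
  rcases le_or_gt p.2 0 with h' | h'
  · left; simp [tensor, ext_of_nonpos v h']
  exact Or.inr ⟨h, h'⟩

/-- `2iz` times the Green function of `-d²/dx² - z²` with the Dirichlet condition. -/
def green (z : ℂ) (p : ℝ × ℝ) : ℂ :=
  Complex.exp (Complex.I * z * (|p.1 - p.2| : ℝ)) - Complex.exp (Complex.I * z * (p.1 + p.2 : ℝ))

theorem continuous_green (z : ℂ) : Continuous (green z) := by unfold green; fun_prop

theorem norm_tensor_mul_green_le (v : ℝ → ℂ) {z : ℂ} (hz : 0 ≤ z.im) (p : ℝ × ℝ) :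
    ‖tensor v p * green z p‖ ≤ 2 * ‖tensor v p‖ := by
  rcases tensor_eq_zero_or v p with h | ⟨h1, h2⟩
  · simp [h]
  · rw [norm_mul, mul_comm]
    gcongr
    refine (norm_sub_le _ _).trans ?_
    have := norm_exp_I_mul_le hz (abs_nonneg (p.1 - p.2))
    have := norm_exp_I_mul_le hz (add_pos h1 h2).le
    linarith

theorem Admissible.integrable_tensor_mul_green {v : ℝ → ℂ} (hv : Admissible v) {z : ℂ}
    (hz : 0 ≤ z.im) : Integrable (fun p => tensor v p * green z p) :=
  (hv.integrable_tensor.norm.const_mul 2).mono'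
    (hv.integrable_tensor.aestronglyMeasurable.mul (continuous_green z).aestronglyMeasurable)
    (Eventually.of_forall fun p => norm_tensor_mul_green_le v hz p)

/-- `⟨2iz R v, v⟩`, where `R` is the resolvent of `L₀` at `z²`. -/
def greenForm (v : ℝ → ℂ) (z : ℂ) : ℂ := ∫ p : ℝ × ℝ, tensor v p * green z p

theorem conj_exp (z : ℂ) : starRingEnd ℂ (Complex.exp z) = Complex.exp (starRingEnd ℂ z) :=
  (Complex.exp_conj z).symm

/-- The half-line is closed here and open in `starFun_Phi_eq`, so that the two indicators cover the
plane exactly once, diagonal included, and add up to `e^{iz|x-y|}` pointwise. -/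
theorem Phi_neg_eq (v : ℝ → ℂ) (hv : Admissible v) {z : ℂ} (hz : 0 ≤ z.im) :
    Integrable (fun p : ℝ × ℝ => tensor v p *
      (Ici (0 : ℝ)).indicator (fun s : ℝ => Complex.exp (Complex.I * z * s)) (p.2 - p.1)) ∧
    Phi v (-z) = ∫ p : ℝ × ℝ, tensor v p *
      (Ici (0 : ℝ)).indicator (fun s : ℝ => Complex.exp (Complex.I * z * s)) (p.2 - p.1) := by
  have hm : Measurable ((Ici (0 : ℝ)).indicator (fun s : ℝ => Complex.exp (Complex.I * z * s))) :=
    Measurable.indicator (by fun_prop) measurableSet_Ici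
  have hb : ∀ s, ‖(Ici (0 : ℝ)).indicator (fun s : ℝ => Complex.exp (Complex.I * z * s)) s‖ ≤ 1 := by
    intro s
    by_cases hs : s ∈ Ici (0 : ℝ)
    · rw [indicator_of_mem hs]; exact norm_exp_I_mul_le hz hs
    · simp [indicator_of_notMem hs]
  obtain ⟨h1, h2⟩ := integral_mul_correlation (integrable_conj hv.integrable_ext)
    hv.integrable_ext hm hb
  refine ⟨h1, Eq.trans ?_ h2⟩
  rw [Phi, ← integral_Ici_eq_integral_Ioi, ← integral_indicator measurableSet_Ici]
  congr 1
  ext s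
  by_cases hs : s ∈ Ici (0 : ℝ)
  · rw [indicator_of_mem hs, indicator_of_mem hs, autocorr_eq_ext v hs]
    congr 2
    ring
  · rw [indicator_of_notMem hs, indicator_of_notMem hs, zero_mul]

theorem starFun_Phi_eq (v : ℝ → ℂ) (hv : Admissible v) {z : ℂ} (hz : 0 ≤ z.im) :
    Integrable (fun p : ℝ × ℝ => tensor v p *
      (Ioi (0 : ℝ)).indicator (fun s : ℝ => Complex.exp (Complex.I * z * s)) (p.1 - p.2)) ∧
    starFun (Phi v) z = ∫ p : ℝ × ℝ, tensor v p *
      (Ioi (0 : ℝ)).indicator (fun s : ℝ => Complex.exp (Complex.I * z * s)) (p.1 - p.2) := by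
  have hm : Measurable ((Ioi (0 : ℝ)).indicator (fun s : ℝ => Complex.exp (Complex.I * z * s))) :=
    Measurable.indicator (by fun_prop) measurableSet_Ioi
  have hb : ∀ s, ‖(Ioi (0 : ℝ)).indicator (fun s : ℝ => Complex.exp (Complex.I * z * s)) s‖ ≤ 1 := by
    intro s
    by_cases hs : s ∈ Ioi (0 : ℝ)
    · rw [indicator_of_mem hs]; exact norm_exp_I_mul_le hz (le_of_lt hs)
    · simp [indicator_of_notMem hs]
  obtain ⟨h1, h2⟩ := integral_mul_correlation hv.integrable_ext
    (integrable_conj hv.integrable_ext) hm hb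
  have e : ∀ p : ℝ × ℝ, tensor v p *
      (Ioi (0 : ℝ)).indicator (fun s : ℝ => Complex.exp (Complex.I * z * s)) (p.1 - p.2) =
      (fun p : ℝ × ℝ => starRingEnd ℂ (ext v p.1) * ext v p.2 *
      (Ioi (0 : ℝ)).indicator (fun s : ℝ => Complex.exp (Complex.I * z * s)) (p.2 - p.1)) p.swap := by
    intro p
    simp only [tensor, Prod.fst_swap, Prod.snd_swap]
    ring
  simp_rw [e]
  refine ⟨h1.swap, ?_⟩
  rw [Measure.volume_eq_prod, integral_prod_swap (μ := volume) (ν := volume)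
    (fun p : ℝ × ℝ => starRingEnd ℂ (ext v p.1) * ext v p.2 *
      (Ioi (0 : ℝ)).indicator (fun s : ℝ => Complex.exp (Complex.I * z * s)) (p.2 - p.1)),
    ← Measure.volume_eq_prod, ← h2, starFun, Phi, ← integral_conj,
    ← integral_indicator measurableSet_Ioi]
  congr 1
  ext s
  by_cases hs : s ∈ Ioi (0 : ℝ)
  · rw [indicator_of_mem hs, indicator_of_mem hs, autocorr_eq_ext v (le_of_lt hs), map_mul,
      conj_exp, ← integral_conj]
    congr 2
    · simp
    · ext x; simp
  · rw [indicator_of_notMem hs, indicator_of_notMem hs, zero_mul]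

theorem Admissible.integrable_exp_mul_ext {v : ℝ → ℂ} (hv : Admissible v) {z : ℂ}
    (hz : 0 ≤ z.im) : Integrable (fun x : ℝ => Complex.exp (Complex.I * z * x) * ext v x) := by
  refine hv.integrable_ext.norm.mono' ((Continuous.aestronglyMeasurable (by fun_prop)).mul
    hv.integrable_ext.aestronglyMeasurable) (Eventually.of_forall fun x => ?_)
  rcases le_or_gt x 0 with hx | hx
  · simp [ext_of_nonpos v hx]
  · rw [norm_mul]
    exact mul_le_of_le_one_left (norm_nonneg _) (norm_exp_I_mul_le hz hx.le)

theorem starFun_fourier_mul_fourier_neg_eq (v : ℝ → ℂ) (hv : Admissible v) {z : ℂ}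
    (hz : 0 ≤ z.im) :
    Integrable (fun p : ℝ × ℝ => tensor v p * Complex.exp (Complex.I * z * (p.1 + p.2 : ℝ))) ∧
    starFun (fourier v) z * fourier v (-z) =
      ∫ p : ℝ × ℝ, tensor v p * Complex.exp (Complex.I * z * (p.1 + p.2 : ℝ)) := by
  have e1 : fourier v (-z) = ∫ x : ℝ, Complex.exp (Complex.I * z * x) * ext v x := by
    rw [fourier_eq_ext]
    congr 1; ext x; congr 2; ring
  have e2 : starFun (fourier v) z =
      ∫ x : ℝ, Complex.exp (Complex.I * z * x) * starRingEnd ℂ (ext v x) := by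
    rw [starFun, fourier_eq_ext, ← integral_conj]
    congr 1; ext x
    rw [map_mul, conj_exp]
    simp
  have h3 : Integrable (fun x : ℝ => Complex.exp (Complex.I * z * x) * starRingEnd ℂ (ext v x)) := by
    refine (hv.integrable_exp_mul_ext hz).norm.mono' ((Continuous.aestronglyMeasurable
      (by fun_prop)).mul (integrable_conj hv.integrable_ext).aestronglyMeasurable)
      (Eventually.of_forall fun x => ?_)
    simp
  have e : ∀ p : ℝ × ℝ, tensor v p * Complex.exp (Complex.I * z * (p.1 + p.2 : ℝ)) =
      (Complex.exp (Complex.I * z * p.1) * ext v p.1) *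
      (Complex.exp (Complex.I * z * p.2) * starRingEnd ℂ (ext v p.2)) := by
    intro p
    push_cast
    rw [mul_add, Complex.exp_add, tensor]
    ring
  simp_rw [e]
  refine ⟨(hv.integrable_exp_mul_ext hz).mul_prod h3, ?_⟩
  rw [Measure.volume_eq_prod, integral_prod_mul
    (fun x : ℝ => Complex.exp (Complex.I * z * x) * ext v x)
    (fun x : ℝ => Complex.exp (Complex.I * z * x) * starRingEnd ℂ (ext v x)), e1, e2, mul_comm]

/-- The two `Φ` terms contribute the regions `y ≥ x` and `y < x` of the kernel `e^{iz|x-y|}`; the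
product of the transforms of `v` is the reflected term `e^{iz(x+y)}` of the Dirichlet condition. -/
theorem r_eq_greenForm {v : ℝ → ℂ} (hv : Admissible v) (α : ℝ) {z : ℂ} (hz : 0 ≤ z.im) :
    r v α z = greenForm v z - 2 * Complex.I * z / (α : ℂ) := by
  obtain ⟨i1, e1⟩ := Phi_neg_eq v hv hz
  obtain ⟨i2, e2⟩ := starFun_Phi_eq v hv hz
  obtain ⟨i3, e3⟩ := starFun_fourier_mul_fourier_neg_eq v hv hz
  have i21 := i2.add i1
  simp only [Pi.add_def] at i21
  rw [r, e1, e2, e3, ← integral_add i2 i1, ← integral_sub i21 i3, greenForm]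
  congr 2
  ext p
  rw [← mul_add, ← mul_sub, green]
  congr 2
  rcases le_or_gt 0 (p.2 - p.1) with h | h
  · rw [indicator_of_notMem (by simp; linarith), indicator_of_mem (by simpa using h), zero_add,
      abs_of_nonpos (by linarith), neg_sub]
  · rw [indicator_of_mem (by simp; linarith), indicator_of_notMem (by simpa using h), add_zero,
      abs_of_pos (by linarith)]

theorem norm_greenForm_le {v : ℝ → ℂ} {z : ℂ} (hv : Admissible v) (hz : 0 ≤ z.im) :
    ‖greenForm v z‖ ≤ 2 * ∫ p, ‖tensor v p‖ := by
  rw [← integral_const_mul]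
  exact norm_integral_le_of_norm_le (hv.integrable_tensor.norm.const_mul 2)
    (Eventually.of_forall fun p => norm_tensor_mul_green_le v hz p)

theorem continuousOn_greenForm {v : ℝ → ℂ} (hv : Admissible v) :
    ContinuousOn (greenForm v) {z | 0 ≤ z.im} := by
  refine continuousOn_of_dominated (bound := fun p => 2 * ‖tensor v p‖) ?_ ?_
    (hv.integrable_tensor.norm.const_mul 2) ?_
  · intro z hz
    exact (hv.integrable_tensor_mul_green hz).aestronglyMeasurable
  · intro z hz
    exact Eventually.of_forall fun p => norm_tensor_mul_green_le v hz p
  · refine Eventually.of_forall fun p => Continuous.continuousOn ?_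
    unfold green
    fun_prop

theorem W_eq (v : ℝ → ℂ) (hv : Admissible v) (t : ℝ) :
    Integrable (fun x : ℝ => (Complex.exp (-(Complex.I * t * x)) - Complex.exp (Complex.I * t * x)) *
      ext v x) ∧
    W v t = ∫ x : ℝ, (Complex.exp (-(Complex.I * t * x)) - Complex.exp (Complex.I * t * x)) *
      ext v x := by
  have h1 := hv.integrable_exp_mul_ext (z := t) (by simp)
  have h2 := hv.integrable_exp_mul_ext (z := -t) (by simp)
  have h2' : Integrable (fun x : ℝ => Complex.exp (-(Complex.I * t * x)) * ext v x) := by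
    convert h2 using 4; ring
  simp_rw [sub_mul]
  refine ⟨h2'.sub h1, ?_⟩
  rw [integral_sub h2' h1, W, fourier_eq_ext, fourier_eq_ext]
  congr 2
  ext x; congr 2; ring

/-- The kernel `(e^{-itx} - e^{itx}) conj (e^{-ity} - e^{ity})`. -/
def sineKernel (t : ℝ) (p : ℝ × ℝ) : ℂ :=
  (Complex.exp (-(Complex.I * t * p.1)) - Complex.exp (Complex.I * t * p.1)) *
    (Complex.exp (Complex.I * t * p.2) - Complex.exp (-(Complex.I * t * p.2)))

theorem sineKernel_eq (t : ℝ) (p : ℝ × ℝ) :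
    sineKernel t p = Complex.exp (Complex.I * t * (p.1 - p.2 : ℝ)) +
      Complex.exp (Complex.I * t * (-(p.1 - p.2) : ℝ)) -
      Complex.exp (Complex.I * t * (p.1 + p.2 : ℝ)) -
      Complex.exp (Complex.I * t * (-(p.1 + p.2) : ℝ)) := by
  rw [sineKernel, mul_sub, sub_mul, sub_mul]
  simp_rw [← Complex.exp_add]
  push_cast
  rw [show -(Complex.I * t * p.1) + Complex.I * t * p.2 = Complex.I * t * -(p.1 - p.2) by ring,
    show Complex.I * t * p.1 + Complex.I * t * p.2 = Complex.I * t * (p.1 + p.2) by ring,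
    show -(Complex.I * t * p.1) + -(Complex.I * t * p.2) = Complex.I * t * -(p.1 + p.2) by ring,
    show Complex.I * t * p.1 + -(Complex.I * t * p.2) = Complex.I * t * (p.1 - p.2) by ring]
  ring

theorem norm_sineKernel_le (t : ℝ) (p : ℝ × ℝ) : ‖sineKernel t p‖ ≤ 4 := by
  have h : ∀ x : ℝ, ‖Complex.exp (Complex.I * t * x)‖ = 1 := by
    intro x; rw [Complex.norm_exp]; simp
  rw [sineKernel_eq]
  refine (norm_sub_le _ _).trans ?_
  refine (add_le_add_left ((norm_sub_le _ _).trans (add_le_add_left (norm_add_le _ _) _)) _).trans ?_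
  rw [h, h, h, h]; norm_num

theorem norm_W_sq_eq {v : ℝ → ℂ} (hv : Admissible v) (t : ℝ) :
    ((‖W v t‖ ^ 2 : ℝ) : ℂ) = ∫ p : ℝ × ℝ, tensor v p * sineKernel t p := by
  have hW := (W_eq v hv t).2
  have hW' : starRingEnd ℂ (W v t) = ∫ x : ℝ, (Complex.exp (Complex.I * t * x) -
      Complex.exp (-(Complex.I * t * x))) * starRingEnd ℂ (ext v x) := by
    rw [hW, ← integral_conj]
    congr 1; ext x
    rw [map_mul, map_sub, conj_exp, conj_exp]
    simp
  have h : ((‖W v t‖ ^ 2 : ℝ) : ℂ) = W v t * starRingEnd ℂ (W v t) := by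
    rw [Complex.mul_conj, Complex.normSq_eq_norm_sq]
  rw [h, hW', hW, ← integral_prod_mul]
  rw [← Measure.volume_eq_prod]
  congr 1
  ext p
  rw [tensor, sineKernel]
  ring

/-- Exchanging the variables conjugates `tensor` and leaves `green` unchanged. -/
theorem integral_tensor_mul_conj_green {v : ℝ → ℂ} (z : ℂ) :
    starRingEnd ℂ (greenForm v z) = ∫ p : ℝ × ℝ, tensor v p * starRingEnd ℂ (green z p) := by
  rw [greenForm, ← integral_conj, Measure.volume_eq_prod, ← integral_prod_swap]
  congr 1; ext p
  rw [map_mul, ← tensor_swap, Prod.swap_swap]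
  congr 2
  rw [green, green]
  simp only [Prod.fst_swap, Prod.snd_swap]
  rw [abs_sub_comm, add_comm p.2 p.1]

/-- For real `x`, `e^{ix|s|} + e^{-ix|s|}` does not see the absolute value, so twice the real part
of the kernel factors as `sineKernel`. -/
theorem greenForm_add_conj {v : ℝ → ℂ} (hv : Admissible v) (x : ℝ) :
    greenForm v x + starRingEnd ℂ (greenForm v x) = ((‖W v x‖ ^ 2 : ℝ) : ℂ) := by
  have h1 := hv.integrable_tensor_mul_green (z := x) (by simp)
  have h2 : Integrable (fun p => tensor v p * starRingEnd ℂ (green x p)) := by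
    refine h1.norm.mono' (hv.integrable_tensor.aestronglyMeasurable.mul
      (Complex.continuous_conj.comp (continuous_green _)).aestronglyMeasurable)
      (Eventually.of_forall fun p => by simp)
  rw [norm_W_sq_eq hv, integral_tensor_mul_conj_green, greenForm, ← integral_add h1 h2]
  congr 1; ext p
  rw [← mul_add, sineKernel_eq, green, map_sub, conj_exp, conj_exp]
  congr 1
  simp only [map_mul, Complex.conj_I, Complex.conj_ofReal]
  have e : Complex.exp (Complex.I * x * (|p.1 - p.2| : ℝ)) +
      Complex.exp (-Complex.I * x * (|p.1 - p.2| : ℝ)) =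
      Complex.exp (Complex.I * x * (p.1 - p.2 : ℝ)) +
      Complex.exp (Complex.I * x * (-(p.1 - p.2) : ℝ)) := by
    rcases abs_choice (p.1 - p.2) with h | h <;> rw [h]
    · congr 2; push_cast; ring
    · rw [add_comm]; congr 2; push_cast; ring
  have e' : -Complex.I * x * (p.1 + p.2 : ℝ) = Complex.I * x * (-(p.1 + p.2) : ℝ) := by
    push_cast; ring
  rw [← e, e']
  ring

/-- The term `2ix/α` is purely imaginary. This identity links the scattering data to `|W|²` and
forces `W` to vanish at every real zero of `r`. -/
theorem two_re_r {v : ℝ → ℂ} (hv : Admissible v) (α : ℝ) (x : ℝ) :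
    2 * (r v α x).re = ‖W v x‖ ^ 2 := by
  have h := congrArg Complex.re (greenForm_add_conj hv x)
  rw [Complex.ofReal_re] at h
  rw [← h, r_eq_greenForm hv α (by simp)]
  have : (2 * Complex.I * (x : ℂ) / (α : ℂ)).re = 0 := by
    rw [show 2 * Complex.I * (x : ℂ) / (α : ℂ) = ((2 * x / α : ℝ) : ℂ) * Complex.I by
      push_cast; ring]
    simp
  simp [this]
  ring

theorem r_neg_ofReal (v : ℝ → ℂ) (α : ℝ) (x : ℝ) :
    r v α (-(x : ℂ)) = starRingEnd ℂ (r v α x) := by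
  simp only [r, starFun, map_sub, map_add, map_mul, map_div₀, Complex.conj_conj,
    Complex.conj_ofReal, Complex.conj_I, map_neg, neg_neg, map_ofNat]
  ring

/-- The spectral representation of `⟨R v, v⟩`. -/
theorem greenForm_eq_integral {v : ℝ → ℂ} (hv : Admissible v) {z : ℂ} (hz : 0 < z.im) :
    greenForm v z = -(Complex.I * z) / (2 * Real.pi) *
      ∫ t : ℝ, ((‖W v t‖ ^ 2 : ℝ) : ℂ) * ((t : ℂ) ^ 2 - z ^ 2)⁻¹ := by
  have hq := (integrable_inv_sq_sub_sq hz)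
  have hexp : ∀ s : ℝ, Integrable (fun t : ℝ => Complex.exp (Complex.I * t * s) *
      (-(2 * Complex.I * z) * ((t : ℂ) ^ 2 - z ^ 2)⁻¹)) := by
    intro s
    refine (hq.const_mul (-(2 * Complex.I * z))).norm.mono' (Continuous.aestronglyMeasurable ?_)
      (Eventually.of_forall fun t => ?_)
    · exact Continuous.mul (by fun_prop) (continuous_const.mul (continuous_inv_sq_sub_sq hz))
    · rw [norm_mul, Complex.norm_exp]; simp
  -- Fourier inversion pointwise in `p`. The four exponentials of `sineKernel` invert in equal
  -- pairs, giving `4π` times the Green kernel; positivity of both coordinates is needed to drop the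
  -- modulus in `|x + y|`.
  have hk : ∀ p : ℝ × ℝ, tensor v p * green z p = -(Complex.I * z) / (2 * Real.pi) *
      ∫ t : ℝ, tensor v p * (sineKernel t p * ((t : ℂ) ^ 2 - z ^ 2)⁻¹) := by
    intro p
    rcases tensor_eq_zero_or v p with h | ⟨h1, h2⟩
    · simp [h]
    have e : ∫ t : ℝ, tensor v p * (sineKernel t p * ((t : ℂ) ^ 2 - z ^ 2)⁻¹) =
        tensor v p * ((-(2 * Complex.I * z))⁻¹ *
          (4 * Real.pi * green z p)) := by
      rw [integral_const_mul]
      congr 1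
      have hz0 : -(2 * Complex.I * z) ≠ 0 := by
        have : z ≠ 0 := by rintro rfl; simp at hz
        simp [this]
      have e1 : ∀ t : ℝ, sineKernel t p * ((t : ℂ) ^ 2 - z ^ 2)⁻¹ = (-(2 * Complex.I * z))⁻¹ *
          (Complex.exp (Complex.I * t * (p.1 - p.2 : ℝ)) *
            (-(2 * Complex.I * z) * ((t : ℂ) ^ 2 - z ^ 2)⁻¹) +
          Complex.exp (Complex.I * t * (-(p.1 - p.2) : ℝ)) *
            (-(2 * Complex.I * z) * ((t : ℂ) ^ 2 - z ^ 2)⁻¹) -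
          Complex.exp (Complex.I * t * (p.1 + p.2 : ℝ)) *
            (-(2 * Complex.I * z) * ((t : ℂ) ^ 2 - z ^ 2)⁻¹) -
          Complex.exp (Complex.I * t * (-(p.1 + p.2) : ℝ)) *
            (-(2 * Complex.I * z) * ((t : ℂ) ^ 2 - z ^ 2)⁻¹)) := by
        intro t
        rw [← add_mul, ← sub_mul, ← sub_mul, ← sineKernel_eq, mul_left_comm,
          inv_mul_cancel_left₀ hz0]
      simp_rw [e1]
      have i2 := (hexp (p.1 - p.2)).add (hexp (-(p.1 - p.2)))
      have i3 := i2.sub (hexp (p.1 + p.2))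
      simp only [Pi.add_def, Pi.sub_def] at i2 i3
      rw [integral_const_mul, integral_sub i3 (hexp _), integral_sub i2 (hexp _), integral_add (hexp _) (hexp _),
        integral_exp_mul_inv_sq_sub_sq hz, integral_exp_mul_inv_sq_sub_sq hz,
        integral_exp_mul_inv_sq_sub_sq hz, integral_exp_mul_inv_sq_sub_sq hz, abs_neg, abs_neg,
        abs_of_pos (add_pos h1 h2), green]
      ring
    rw [e]
    have hz0 : z ≠ 0 := by rintro rfl; simp at hz
    have : (Real.pi : ℂ) ≠ 0 := by exact_mod_cast Real.pi_ne_zero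
    have hI := Complex.I_ne_zero
    field_simp
    ring
  have hint : Integrable (Function.uncurry fun (p : ℝ × ℝ) (t : ℝ) =>
      tensor v p * (sineKernel t p * ((t : ℂ) ^ 2 - z ^ 2)⁻¹)) (volume.prod volume) := by
    have h1 : Integrable (fun x : (ℝ × ℝ) × ℝ => tensor v x.1 * ((x.2 : ℂ) ^ 2 - z ^ 2)⁻¹)
      (volume.prod volume) := hv.integrable_tensor.mul_prod hq
    have h2 : Integrable (fun x : (ℝ × ℝ) × ℝ => sineKernel x.2 x.1 *
        (tensor v x.1 * ((x.2 : ℂ) ^ 2 - z ^ 2)⁻¹)) (volume.prod volume) := by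
      refine h1.bdd_mul (c := 4) (Continuous.aestronglyMeasurable ?_)
        (Eventually.of_forall fun x => norm_sineKernel_le _ _)
      unfold sineKernel
      fun_prop
    refine h2.congr (Eventually.of_forall fun x => ?_)
    simp only [Function.uncurry]
    ring
  rw [greenForm]
  simp_rw [hk]
  rw [integral_const_mul, integral_integral_swap hint]
  congr 2
  ext t
  rw [norm_W_sq_eq hv, ← integral_mul_const]
  congr 1; ext p
  ring

end RankOneScattering

end

noncomputable section

namespace RankOneScattering

/-! ### Principal values of boundary imaginary parts. -/

section PrincipalValue

theorem arc_ne_zero {x ρ : ℝ} (hρ : 0 < ρ) (hx : ρ ≠ |x|) (θ : ℝ) :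
    (x : ℂ) + ρ * Complex.exp (θ * Complex.I) ≠ 0 := by
  intro h
  apply hx
  have h1 : (x : ℂ) = -(ρ * Complex.exp (θ * Complex.I)) := by linear_combination h
  have h2 := congrArg norm h1
  rw [norm_neg, norm_mul, Complex.norm_exp_ofReal_mul_I, Complex.norm_real, Complex.norm_real,
    Real.norm_eq_abs, Real.norm_eq_abs, abs_of_pos hρ] at h2
  linarith

theorem arc_im (x δ ρ θ : ℝ) :
    ((x : ℂ) + δ * Complex.I + ρ * Complex.exp (θ * Complex.I)).im = δ + ρ * Real.sin θ := by
  simp [Complex.exp_ofReal_mul_I_im]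

theorem arc_im' (x ρ θ : ℝ) :
    ((x : ℂ) + ρ * Complex.exp (θ * Complex.I)).im = ρ * Real.sin θ := by
  simp [Complex.exp_ofReal_mul_I_im]

theorem arc_mem {x ρ θ : ℝ} (hρ : 0 < ρ) (hx : ρ ≠ |x|) (hθ : θ ∈ Icc 0 Real.pi) :
    (x : ℂ) + ρ * Complex.exp (θ * Complex.I) ∈ {z : ℂ | 0 ≤ z.im} \ {0} := by
  refine ⟨?_, arc_ne_zero hρ hx θ⟩
  simp only [mem_ofPred_eq, arc_im']
  exact mul_nonneg hρ.le (Real.sin_nonneg_of_mem_Icc hθ)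

theorem continuousOn_arc {f : ℂ → ℂ} (hc : ContinuousOn f ({z : ℂ | 0 ≤ z.im} \ {0}))
    {x ρ : ℝ} (hρ : 0 < ρ) (hx : ρ ≠ |x|) :
    ContinuousOn (fun θ : ℝ => (f (x + ρ * Complex.exp (θ * Complex.I))).re)
      (Icc 0 Real.pi) := by
  refine Complex.continuous_re.comp_continuousOn (hc.comp (Continuous.continuousOn (by fun_prop)) ?_)
  intro θ hθ
  exact arc_mem hρ hx hθ

/-- Cauchy's theorem on a half-annulus, shifted into the open upper half-plane. -/
theorem half_annulus_shifted {f : ℂ → ℂ} (hd : DifferentiableOn ℂ f {z | 0 < z.im})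
    (x : ℝ) {δ ε R : ℝ} (hδ : 0 < δ) (hε : 0 < ε) (hR : 0 < R) :
    ∫ s in Real.log ε..Real.log R, ((f (x + δ * Complex.I + (Real.exp s : ℝ))).im -
      (f (x + δ * Complex.I - (Real.exp s : ℝ))).im) =
    (∫ θ in (0 : ℝ)..Real.pi, (f (x + δ * Complex.I + ε * Complex.exp (θ * Complex.I))).re) -
    ∫ θ in (0 : ℝ)..Real.pi, (f (x + δ * Complex.I + R * Complex.exp (θ * Complex.I))).re := by
  have hcont : ContinuousOn f {z | 0 < z.im} := hd.continuousOn
  -- The exponential maps a rectangle of height `π` onto the half-annulus, and `dz/(z - x - iδ)`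
  -- becomes `dw`; Cauchy's theorem on the rectangle suffices, with no singular factor left.
  set g : ℂ → ℂ := fun w => f (x + δ * Complex.I + Complex.exp w) with hg
  have hmaps : ∀ w : ℂ, w.im ∈ Icc 0 Real.pi →
      (x + δ * Complex.I + Complex.exp w) ∈ {z : ℂ | 0 < z.im} := by
    intro w hw
    have : 0 ≤ Real.exp w.re * Real.sin w.im :=
      mul_nonneg (Real.exp_pos _).le (Real.sin_nonneg_of_mem_Icc hw)
    simp only [mem_ofPred_eq, Complex.add_im, Complex.ofReal_im, Complex.mul_im, Complex.ofReal_re,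
      Complex.I_re, Complex.I_im, Complex.exp_im]
    linarith
  have hgd : DifferentiableOn ℂ g
      (uIcc (Real.log ε : ℂ).re (Real.log R + Real.pi * Complex.I : ℂ).re ×ℂ
      uIcc (Real.log ε : ℂ).im (Real.log R + Real.pi * Complex.I : ℂ).im) := by
    refine hd.comp (Differentiable.differentiableOn (by fun_prop)) ?_
    intro w hw
    apply hmaps
    have := hw.2
    simpa [uIcc_of_le Real.pi_pos.le] using this
  have key := Complex.integral_boundary_rect_eq_zero_of_differentiableOn g _ _ hgd
  simp only [Complex.ofReal_re, Complex.ofReal_im, Complex.add_re, Complex.add_im, Complex.mul_re,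
    Complex.mul_im, Complex.I_re, Complex.I_im, mul_zero, mul_one, zero_mul, sub_zero, zero_add,
    add_zero, smul_eq_mul, Complex.ofReal_zero] at key
  have hgc : ∀ h : ℝ → ℂ, Continuous h → (∀ s, (h s).im ∈ Icc 0 Real.pi) →
      Continuous fun s => g (h s) := by
    intro h hh hs
    exact hcont.comp_continuous (by fun_prop) fun s => hmaps _ (hs s)
  have hgc' : ∀ b : ℝ, ContinuousOn (fun θ : ℝ => g (b + θ * Complex.I)) (Icc 0 Real.pi) := by
    intro b
    refine hcont.comp (Continuous.continuousOn (by fun_prop)) ?_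
    intro θ hθ
    exact hmaps _ (by simpa using hθ)
  have c1 : Continuous fun s : ℝ => g s := hgc (fun s => (s : ℂ)) (by fun_prop)
    (by intro s; simp [Real.pi_pos.le])
  have c2 : Continuous fun s : ℝ => g (s + Real.pi * Complex.I) :=
    hgc (fun s => (s : ℂ) + Real.pi * Complex.I) (by fun_prop)
      (by intro s; simp [Real.pi_pos.le])
  have i3 : ∀ b : ℝ, IntervalIntegrable (fun θ : ℝ => g (b + θ * Complex.I)) volume 0 Real.pi := by
    intro b
    apply ContinuousOn.intervalIntegrable
    rw [uIcc_of_le Real.pi_pos.le]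
    exact hgc' b
  have e1 : ∀ s : ℝ, g s = f (x + δ * Complex.I + (Real.exp s : ℝ)) := by
    intro s; simp only [hg, Complex.ofReal_exp]
  have e2 : ∀ s : ℝ, g (s + Real.pi * Complex.I) = f (x + δ * Complex.I - (Real.exp s : ℝ)) := by
    intro s
    simp only [hg, Complex.exp_add_pi_mul_I, Complex.ofReal_exp]
    congr 1
  have e3 : ∀ b : ℝ, 0 < b → ∀ θ : ℝ, g (Real.log b + θ * Complex.I) =
      f (x + δ * Complex.I + b * Complex.exp (θ * Complex.I)) := by
    intro b hb θ
    simp only [hg, Complex.exp_add, ← Complex.ofReal_exp, Real.exp_log hb]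
  have him := congrArg Complex.im key
  simp only [Complex.add_im, Complex.sub_im, Complex.mul_im, Complex.I_re, Complex.I_im, zero_mul,
    one_mul, zero_add, Complex.zero_im] at him
  have him_int : ∀ {a b : ℝ} {h : ℝ → ℂ}, IntervalIntegrable h volume a b →
      (∫ s in a..b, h s).im = ∫ s in a..b, (h s).im := fun hh =>
    (Complex.imCLM.intervalIntegral_comp_comm hh).symm
  have hre_int : ∀ {a b : ℝ} {h : ℝ → ℂ}, IntervalIntegrable h volume a b →
      (∫ s in a..b, h s).re = ∫ s in a..b, (h s).re := fun hh =>
    (Complex.reCLM.intervalIntegral_comp_comm hh).symm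
  rw [him_int (c1.intervalIntegrable _ _), him_int (c2.intervalIntegrable _ _), hre_int (i3 _),
    hre_int (i3 _)] at him
  simp_rw [e1, e2, e3 ε hε, e3 R hR] at him
  rw [intervalIntegral.integral_sub]
  · linarith
  · refine Continuous.intervalIntegrable ?_ _ _
    simp_rw [← e1]; exact Complex.continuous_im.comp c1
  · refine Continuous.intervalIntegrable ?_ _ _
    simp_rw [← e2]; exact Complex.continuous_im.comp c2

theorem tendsto_shift_nhdsWithin {z : ℂ} (hz : 0 ≤ z.im) :
    Tendsto (fun δ : ℝ => z + δ * Complex.I) (𝓝[>] 0) (𝓝[{z | 0 ≤ z.im} \ {0}] z) := by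
  refine tendsto_nhdsWithin_iff.2 ⟨?_, ?_⟩
  · have : Continuous fun δ : ℝ => z + δ * Complex.I := by fun_prop
    have h := this.tendsto 0
    simp only [Complex.ofReal_zero, zero_mul, add_zero] at h
    exact h.mono_left nhdsWithin_le_nhds
  · filter_upwards [self_mem_nhdsWithin] with δ hδ
    have h : 0 < (z + δ * Complex.I).im := by
      simp only [Complex.add_im, Complex.mul_im, Complex.ofReal_re, Complex.I_im, mul_one,
        Complex.ofReal_im, Complex.I_re, mul_zero, add_zero]
      have : (0 : ℝ) < δ := hδ
      linarith
    refine ⟨h.le, ?_⟩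
    rintro h0
    rw [mem_singleton_iff.1 h0] at h
    simp at h

/-- Cauchy's theorem on a half-annulus centred on the real axis, for the imaginary part. -/
theorem half_annulus {f : ℂ → ℂ} (hd : DifferentiableOn ℂ f {z | 0 < z.im})
    (hc : ContinuousOn f ({z : ℂ | 0 ≤ z.im} \ {0})) {C : ℝ}
    (hb : ∀ z : ℂ, 0 < z.im → |(f z).im| ≤ C)
    {x ε R : ℝ} (hε : 0 < ε) (hεx : ε < |x|) (hR : |x| < R) :
    ∫ s in Real.log ε..Real.log R, ((f ((x + Real.exp s : ℝ))).im -
      (f ((x - Real.exp s : ℝ))).im) =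
    (∫ θ in (0 : ℝ)..Real.pi, (f (x + ε * Complex.exp (θ * Complex.I))).re) -
    ∫ θ in (0 : ℝ)..Real.pi, (f (x + R * Complex.exp (θ * Complex.I))).re := by
  have hR0 : 0 < R := (abs_nonneg x).trans_lt hR
  have hx0 : x ≠ 0 := by rintro rfl; simp at hεx; linarith
  have harc : ∀ ρ : ℝ, 0 < ρ → ρ ≠ |x| → Tendsto (fun δ : ℝ =>
      ∫ θ in (0 : ℝ)..Real.pi, (f (x + δ * Complex.I + ρ * Complex.exp (θ * Complex.I))).re)
      (𝓝[>] 0) (𝓝 (∫ θ in (0 : ℝ)..Real.pi, (f (x + ρ * Complex.exp (θ * Complex.I))).re)) := by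
    intro ρ hρ hρx
    have hmem : ∀ q ∈ Icc (0 : ℝ) 1 ×ˢ Icc (0 : ℝ) Real.pi,
        (x : ℂ) + (q.1 : ℝ) * Complex.I + ρ * Complex.exp ((q.2 : ℝ) * Complex.I) ∈
          {z : ℂ | 0 ≤ z.im} \ {0} := by
      rintro ⟨δ, θ⟩ ⟨hδ, hθ⟩
      have h1 : 0 ≤ ρ * Real.sin θ := mul_nonneg hρ.le (Real.sin_nonneg_of_mem_Icc hθ)
      refine ⟨?_, ?_⟩
      · simp only [mem_ofPred_eq, arc_im]; linarith [hδ.1]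
      · intro h
        rw [mem_singleton_iff] at h
        have h2 := congrArg Complex.im h
        rw [arc_im] at h2
        simp only [Complex.zero_im] at h2
        have : δ = 0 := by linarith [hδ.1]
        simp only [this, Complex.ofReal_zero, zero_mul, add_zero] at h
        exact arc_ne_zero hρ hρx θ h
    have hcomp : ContinuousOn (fun q : ℝ × ℝ =>
        (f ((x : ℂ) + (q.1 : ℝ) * Complex.I + ρ * Complex.exp ((q.2 : ℝ) * Complex.I))).re)
        (Icc (0 : ℝ) 1 ×ˢ Icc (0 : ℝ) Real.pi) :=
      Complex.continuous_re.comp_continuousOn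
        (hc.comp (Continuous.continuousOn (by fun_prop)) hmem)
    obtain ⟨B, hB⟩ := (isCompact_Icc.prod isCompact_Icc).exists_bound_of_continuousOn hcomp
    refine intervalIntegral.tendsto_integral_filter_of_dominated_convergence (fun _ => B) ?_ ?_
      intervalIntegrable_const ?_
    · filter_upwards [Ioc_mem_nhdsGT zero_lt_one] with δ hδ
      rw [uIoc_of_le Real.pi_pos.le]
      refine ContinuousOn.aestronglyMeasurable (ContinuousOn.mono ?_ Ioc_subset_Icc_self)
        measurableSet_Ioc
      exact hcomp.comp (f := fun θ : ℝ => (δ, θ)) (by fun_prop)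
        fun θ hθ => ⟨⟨hδ.1.le, hδ.2⟩, hθ⟩
    · filter_upwards [Ioc_mem_nhdsGT zero_lt_one] with δ hδ
      refine Eventually.of_forall fun θ hθ => ?_
      rw [uIoc_of_le Real.pi_pos.le] at hθ
      exact hB (δ, θ) ⟨⟨hδ.1.le, hδ.2⟩, Ioc_subset_Icc_self hθ⟩
    · refine Eventually.of_forall fun θ hθ => ?_
      rw [uIoc_of_le Real.pi_pos.le] at hθ
      have hm := arc_mem hρ hρx (Ioc_subset_Icc_self hθ)
      have := (hc _ hm).tendsto.comp (tendsto_shift_nhdsWithin hm.1)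
      refine ((Complex.continuous_re.tendsto _).comp this).congr fun δ => ?_
      simp only [Function.comp]
      congr 2; ring
  have hlhs : Tendsto (fun δ : ℝ =>
      ∫ s in Real.log ε..Real.log R, ((f (x + δ * Complex.I + (Real.exp s : ℝ))).im -
      (f (x + δ * Complex.I - (Real.exp s : ℝ))).im)) (𝓝[>] 0)
      (𝓝 (∫ s in Real.log ε..Real.log R, ((f ((x + Real.exp s : ℝ))).im -
      (f ((x - Real.exp s : ℝ))).im))) := by
    have hpos : ∀ δ : ℝ, 0 < δ → ∀ s : ℝ, 0 < ((x : ℂ) + δ * Complex.I + (s : ℝ)).im := by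
      intro δ hδ s; simpa using hδ
    have hpos' : ∀ δ : ℝ, 0 < δ → ∀ s : ℝ, 0 < ((x : ℂ) + δ * Complex.I - (s : ℝ)).im := by
      intro δ hδ s; simpa using hδ
    -- The integration passes through the origin, where `f` has no boundary value; the bound on `Im
    -- f` supplies the majorant as `δ → 0`.
    refine intervalIntegral.tendsto_integral_filter_of_dominated_convergence (fun _ => C + C) ?_ ?_
      intervalIntegrable_const ?_
    · filter_upwards [self_mem_nhdsWithin] with δ hδ
      refine Continuous.aestronglyMeasurable (Continuous.sub ?_ ?_)
      · exact Complex.continuous_im.comp (hd.continuousOn.comp_continuous (by fun_prop)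
          fun s => hpos δ hδ _)
      · exact Complex.continuous_im.comp (hd.continuousOn.comp_continuous (by fun_prop)
          fun s => hpos' δ hδ _)
    · filter_upwards [self_mem_nhdsWithin] with δ hδ
      refine Eventually.of_forall fun s _ => ?_
      exact (abs_sub _ _).trans (add_le_add (hb _ (hpos δ hδ _)) (hb _ (hpos' δ hδ _)))
    -- Only `s = log |x|` can send `x ± e^s` to the origin.
    · have hne : ∀ᵐ s : ℝ, s ≠ Real.log |x| := by simp [ae_iff, measure_singleton]
      filter_upwards [hne] with s hs _
      have hs' : Real.exp s ≠ |x| := by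
        rintro h; apply hs; rw [← h, Real.log_exp]
      have h1 : x + Real.exp s ≠ 0 := by
        intro h; apply hs'
        rw [show x = -Real.exp s by linarith, abs_neg, abs_of_pos (Real.exp_pos s)]
      have h2 : x - Real.exp s ≠ 0 := by
        intro h; apply hs'
        rw [show x = Real.exp s by linarith, abs_of_pos (Real.exp_pos s)]
      have hlim : ∀ t : ℝ, t ≠ 0 → Tendsto (fun δ : ℝ => (f ((t : ℂ) + δ * Complex.I)).im)
          (𝓝[>] 0) (𝓝 (f (t : ℂ)).im) := by
        intro t ht
        have hm : (t : ℂ) ∈ {z : ℂ | 0 ≤ z.im} \ {0} := ⟨by simp, by simpa using ht⟩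
        exact (Complex.continuous_im.tendsto _).comp
          ((hc _ hm).tendsto.comp (tendsto_shift_nhdsWithin hm.1))
      refine Tendsto.sub ((hlim _ h1).congr fun δ => ?_) ((hlim _ h2).congr fun δ => ?_)
      · congr 2; push_cast; ring
      · congr 2; push_cast; ring
  refine tendsto_nhds_unique hlhs (((harc ε hε hεx.ne).sub (harc R hR0 hR.ne')).congr' ?_)
  filter_upwards [self_mem_nhdsWithin] with δ hδ
  exact (half_annulus_shifted hd x hδ hε hR0).symm

/-- Boundedness and decay `O(1/|t|)` give `|ζ| (1 + |t|) ≤ C + C'`, while `1 + |t|` is at most a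
constant times `|t - x|` off the `ε`-neighbourhood; so the quotient is dominated by a multiple of
`1/(1 + t²)`. -/
theorem integrableOn_div_sub {ζ : ℝ → ℝ} (hζ : ContinuousOn ζ {0}ᶜ) {C C' : ℝ}
    (h1 : ∀ t, |ζ t| ≤ C) (h2 : ∀ t, |ζ t| * |t| ≤ C') (x : ℝ) {ε : ℝ} (hε : 0 < ε) :
    IntegrableOn (fun t => ζ t / (t - x)) {t : ℝ | ε < |t - x|} := by
  have hms : MeasurableSet {t : ℝ | ε < |t - x|} :=
    (isOpen_lt continuous_const (by fun_prop)).measurableSet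
  have hζm : AEStronglyMeasurable ζ volume := by
    have h := hζ.aestronglyMeasurable (μ := volume) (measurableSet_singleton (0 : ℝ)).compl
    rwa [restrict_compl_singleton] at h
  have hm : AEStronglyMeasurable (fun t => ζ t / (t - x)) volume :=
    (hζm.aemeasurable.div (by fun_prop)).aestronglyMeasurable
  refine Integrable.mono' ((integrable_inv_one_add_sq.const_mul
    ((C + C') * ((1 + |x|) / ε + 1))).integrableOn) hm.restrict ?_
  refine (ae_restrict_iff' hms).2 (Eventually.of_forall fun t ht => ?_)
  have ht' : ε < |t - x| := ht
  have hpos : 0 < |t - x| := hε.trans ht'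
  have hsq : 0 < 1 + t ^ 2 := by positivity
  rw [Real.norm_eq_abs, abs_div, div_le_iff₀ hpos]
  have hM : 1 + |t| ≤ ((1 + |x|) / ε + 1) * |t - x| := by
    have e1 : (1 + |x|) ≤ (1 + |x|) / ε * |t - x| := by
      rw [div_mul_eq_mul_div, le_div_iff₀ hε]
      exact mul_le_mul_of_nonneg_left ht'.le (by positivity)
    have e2 : |t| ≤ |t - x| + |x| := by
      have := abs_add_le (t - x) x
      rwa [sub_add_cancel] at this
    linarith
  have hCC : |ζ t| * (1 + |t|) ≤ C + C' := by linarith [h1 t, h2 t]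
  have hC0 : 0 ≤ C + C' := le_trans (by positivity) hCC
  have hsq2 : 1 + t ^ 2 ≤ (1 + |t|) * (1 + |t|) := by
    nlinarith [abs_nonneg t, sq_abs t]
  have key : |ζ t| * (1 + t ^ 2) ≤ (C + C') * (((1 + |x|) / ε + 1) * |t - x|) :=
    calc |ζ t| * (1 + t ^ 2) ≤ |ζ t| * ((1 + |t|) * (1 + |t|)) :=
          mul_le_mul_of_nonneg_left hsq2 (abs_nonneg _)
      _ = (|ζ t| * (1 + |t|)) * (1 + |t|) := by ring
      _ ≤ _ := mul_le_mul hCC hM (by positivity) hC0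
  calc |ζ t| = |ζ t| * (1 + t ^ 2) * (1 + t ^ 2)⁻¹ := by field_simp
    _ ≤ (C + C') * (((1 + |x|) / ε + 1) * |t - x|) * (1 + t ^ 2)⁻¹ :=
      mul_le_mul_of_nonneg_right key (inv_pos.2 hsq).le
    _ = _ := by ring

theorem image_exp_comp_Ioi {ε : ℝ} (hε : 0 < ε) (x σ : ℝ) (hσ : σ = 1 ∨ σ = -1) :
    (fun s => x + σ * Real.exp s) '' Ioi (Real.log ε) = {t | ε < σ * (t - x)} := by
  have hσ2 : σ * σ = 1 := by rcases hσ with h | h <;> rw [h] <;> norm_num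
  ext t
  simp only [mem_image, mem_Ioi, mem_ofPred_eq]
  constructor
  · rintro ⟨s, hs, rfl⟩
    rw [add_sub_cancel_left, ← mul_assoc, hσ2, one_mul]
    exact (Real.log_lt_iff_lt_exp hε).1 hs
  · intro h
    have h0 : 0 < σ * (t - x) := hε.trans h
    refine ⟨Real.log (σ * (t - x)), Real.log_lt_log hε h, ?_⟩
    rw [Real.exp_log h0, ← mul_assoc, hσ2]
    ring

/-- Logarithmic change of variables in half of a truncated Cauchy integral. -/
theorem truncated_half {ζ : ℝ → ℝ} {x ε : ℝ} (hε : 0 < ε) {σ : ℝ} (hσ : σ = 1 ∨ σ = -1)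
    (hi : IntegrableOn (fun t => ζ t / (t - x)) {t | ε < σ * (t - x)}) :
    IntegrableOn (fun s => ζ (x + σ * Real.exp s)) (Ioi (Real.log ε)) ∧
    ∫ t in {t | ε < σ * (t - x)}, ζ t / (t - x) =
      σ * ∫ s in Ioi (Real.log ε), ζ (x + σ * Real.exp s) := by
  have hσ2 : σ * σ = 1 := by rcases hσ with h | h <;> rw [h] <;> norm_num
  have hσa : |σ| = 1 := by rcases hσ with h | h <;> rw [h] <;> norm_num
  have hσ0 : σ ≠ 0 := by rintro rfl; simp at hσ2
  have hder : ∀ s ∈ Ioi (Real.log ε), HasDerivWithinAt (fun s => x + σ * Real.exp s)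
      (σ * Real.exp s) (Ioi (Real.log ε)) s := fun s _ =>
    (((Real.hasDerivAt_exp s).const_mul σ).const_add x).hasDerivWithinAt
  have hinj : InjOn (fun s => x + σ * Real.exp s) (Ioi (Real.log ε)) := by
    intro a _ b _ h
    simp only [add_right_inj] at h
    exact Real.exp_injective (mul_left_cancel₀ hσ0 h)
  have e : ∀ s, |σ * Real.exp s| • (ζ (x + σ * Real.exp s) / (x + σ * Real.exp s - x)) =
      σ * ζ (x + σ * Real.exp s) := by
    intro s
    have := Real.exp_pos s
    rw [abs_mul, hσa, one_mul, abs_of_pos this, add_sub_cancel_left, smul_eq_mul]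
    have h3 : σ⁻¹ = σ := inv_eq_of_mul_eq_one_left hσ2
    rw [div_eq_mul_inv, mul_inv, h3]
    field_simp
  rw [← image_exp_comp_Ioi hε x σ hσ] at hi ⊢
  have hi2 := (integrableOn_image_iff_integrableOn_abs_deriv_smul measurableSet_Ioi hder hinj _).1 hi
  rw [integral_image_eq_integral_abs_deriv_smul measurableSet_Ioi hder hinj]
  simp_rw [e] at hi2 ⊢
  refine ⟨?_, integral_const_mul _ _⟩
  have := hi2.const_mul σ
  simp_rw [← mul_assoc, hσ2, one_mul] at this
  exact this

/-- With `t = x ± e^s` the measure `dt/(t - x)` is `ds` up to sign and orientation, which brings the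
truncated integral to the shape of the left side of `half_annulus`. -/
theorem truncInt_eq {ζ : ℝ → ℝ} {x ε : ℝ} (hε : 0 < ε)
    (hi : IntegrableOn (fun t => ζ t / (t - x)) {t | ε < |t - x|}) :
    IntegrableOn (fun s => ζ (x + Real.exp s) - ζ (x - Real.exp s)) (Ioi (Real.log ε)) ∧
    truncInt (fun t => ζ t / (t - x)) x ε =
      ∫ s in Ioi (Real.log ε), (ζ (x + Real.exp s) - ζ (x - Real.exp s)) := by
  have hset : {t : ℝ | ε < |t - x|} = {t | ε < 1 * (t - x)} ∪ {t | ε < -1 * (t - x)} := by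
    ext t
    simp only [mem_ofPred_eq, mem_union, lt_abs, one_mul, neg_mul]
  rw [truncInt, hset] 
  rw [hset] at hi
  have hdisj : Disjoint {t | ε < 1 * (t - x)} {t | ε < -1 * (t - x)} := by
    rw [Set.disjoint_left]
    intro t h1 h2
    simp only [mem_ofPred_eq] at h1 h2
    linarith
  have hms : MeasurableSet {t : ℝ | ε < -1 * (t - x)} :=
    (isOpen_lt continuous_const (by fun_prop)).measurableSet
  obtain ⟨i1, e1⟩ := truncated_half hε (Or.inl rfl) (hi.mono_set subset_union_left)
  obtain ⟨i2, e2⟩ := truncated_half hε (Or.inr rfl) (hi.mono_set subset_union_right)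
  rw [setIntegral_union hdisj hms (hi.mono_set subset_union_left)
    (hi.mono_set subset_union_right), e1, e2]
  simp only [one_mul, neg_mul, ← sub_eq_add_neg] at i1 i2 ⊢
  exact ⟨i1.sub i2, (integral_sub i1 i2).symm⟩

/-- If `f` is holomorphic in the upper half-plane, vanishes at infinity, is continuous up to the real
axis except at `0`, and has bounded imaginary part, then the principal value of the Cauchy
integral of `Im f` is `π Re f`. -/
theorem pv_im_eq {f : ℂ → ℂ} (hd : DifferentiableOn ℂ f {z | 0 < z.im})
    (hc : ContinuousOn f ({z : ℂ | 0 ≤ z.im} \ {0})) {C C' : ℝ}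
    (hb : ∀ z : ℂ, 0 < z.im → |(f z).im| ≤ C)
    (hinf : Tendsto f (Bornology.cobounded ℂ ⊓ 𝓟 {z | 0 ≤ z.im}) (𝓝 0))
    {ζ : ℝ → ℝ} (hζ : ∀ t : ℝ, t ≠ 0 → ζ t = (f t).im)
    (hζ1 : ∀ t, |ζ t| ≤ C) (hζ2 : ∀ t, |ζ t| * |t| ≤ C') {x : ℝ} (hx : x ≠ 0) :
    PVExists (fun t => ζ t / (t - x)) x ∧
      pv (fun t => ζ t / (t - x)) x = Real.pi * (f x).re := by
  have hζc : ContinuousOn ζ {0}ᶜ := by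
    refine ContinuousOn.congr (f := fun t : ℝ => (f t).im) ?_ fun t ht => hζ t ht
    refine Complex.continuous_im.comp_continuousOn (hc.comp
      Complex.continuous_ofReal.continuousOn ?_)
    intro t ht
    exact ⟨by simp, by simpa using ht⟩
  have hint : ∀ ε > 0, IntegrableOn (fun t => ζ t / (t - x)) {t : ℝ | ε < |t - x|} :=
    fun ε hε => integrableOn_div_sub hζc hζ1 hζ2 x hε
  have hxm : (x : ℂ) ∈ {z : ℂ | 0 ≤ z.im} \ {0} := ⟨by simp, by simpa using hx⟩
  have hbig : Tendsto (fun R : ℝ => ∫ θ in (0 : ℝ)..Real.pi,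
      (f (x + R * Complex.exp (θ * Complex.I))).re) atTop (𝓝 0) := by
    have hev : ∀ᶠ z in Bornology.cobounded ℂ ⊓ 𝓟 {z | 0 ≤ z.im}, ‖f z‖ ≤ 1 := by
      filter_upwards [hinf (Metric.closedBall_mem_nhds 0 one_pos)] with z hz
      simpa using hz
    rw [eventually_inf_principal] at hev
    obtain ⟨K, -, hK⟩ := hasBasis_cobounded_norm.eventually_iff.1 hev
    have hfar : ∀ z : ℂ, K < ‖z‖ → 0 ≤ z.im → ‖f z‖ ≤ 1 := fun z hz him => hK hz.le him
    have hnorm : ∀ R θ : ℝ, 0 < R → R - |x| ≤ ‖(x : ℂ) + R * Complex.exp (θ * Complex.I)‖ := by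
      intro R θ hR
      have h := norm_sub_norm_le ((R : ℂ) * Complex.exp (θ * Complex.I)) (-(x : ℂ))
      rw [norm_mul, Complex.norm_exp_ofReal_mul_I, norm_neg, Complex.norm_real, Complex.norm_real,
        Real.norm_eq_abs, Real.norm_eq_abs, abs_of_pos hR, mul_one, sub_neg_eq_add, add_comm] at h
      rw [add_comm]
      simpa [add_comm] using h
    suffices h0 : Tendsto (fun R : ℝ => ∫ θ in (0 : ℝ)..Real.pi,
        (f (x + R * Complex.exp (θ * Complex.I))).re) atTop
        (𝓝 (∫ _ in (0 : ℝ)..Real.pi, (0 : ℝ))) by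
      simpa only [intervalIntegral.integral_zero] using h0
    refine intervalIntegral.tendsto_integral_filter_of_dominated_convergence (fun _ => 1) ?_ ?_
      intervalIntegrable_const ?_
    · filter_upwards [eventually_gt_atTop |x|] with R hR
      rw [uIoc_of_le Real.pi_pos.le]
      exact ((continuousOn_arc hc ((abs_nonneg x).trans_lt hR) hR.ne').mono
        Ioc_subset_Icc_self).aestronglyMeasurable measurableSet_Ioc
    · filter_upwards [eventually_gt_atTop |x|, eventually_gt_atTop (K + |x|)] with R hR hR2
      refine Eventually.of_forall fun θ hθ => ?_
      rw [uIoc_of_le Real.pi_pos.le] at hθ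
      have hR0 := (abs_nonneg x).trans_lt hR
      have hm := arc_mem hR0 hR.ne' (Ioc_subset_Icc_self hθ)
      exact (Complex.abs_re_le_norm _).trans (hfar _ (by linarith [hnorm R θ hR0]) hm.1)
    · refine Eventually.of_forall fun θ hθ => ?_
      rw [uIoc_of_le Real.pi_pos.le] at hθ
      have h1 : Tendsto (fun R : ℝ => (x : ℂ) + R * Complex.exp (θ * Complex.I)) atTop
          (Bornology.cobounded ℂ ⊓ 𝓟 {z | 0 ≤ z.im}) := by
        refine tendsto_inf.2 ⟨?_, tendsto_principal.2 ?_⟩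
        · rw [← tendsto_norm_atTop_iff_cobounded]
          refine tendsto_atTop_mono' _ ?_ (tendsto_atTop_add_const_right _ (-|x|) tendsto_id)
          filter_upwards [eventually_gt_atTop 0] with R hR
          exact hnorm R θ hR
        · filter_upwards [eventually_gt_atTop |x|] with R hR
          exact (arc_mem ((abs_nonneg x).trans_lt hR) hR.ne' (Ioc_subset_Icc_self hθ)).1
      exact (Complex.continuous_re.tendsto 0).comp (hinf.comp h1)
  -- Letting the outer radius go to infinity makes the truncated integral exactly equal to the
  -- integral over the small arc; as `ε → 0` the latter tends to `π Re f(x)` by continuity at `x`.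
  have htrunc : ∀ ε : ℝ, 0 < ε → ε < |x| → truncInt (fun t => ζ t / (t - x)) x ε =
      ∫ θ in (0 : ℝ)..Real.pi, (f (x + ε * Complex.exp (θ * Complex.I))).re := by
    intro ε hε hεx
    obtain ⟨i, e⟩ := truncInt_eq hε (hint ε hε)
    rw [e]
    have hlim := intervalIntegral_tendsto_integral_Ioi (Real.log ε) i Real.tendsto_log_atTop
    refine tendsto_nhds_unique hlim ?_
    have := (tendsto_const_nhds (x := ∫ θ in (0 : ℝ)..Real.pi,
      (f (x + ε * Complex.exp (θ * Complex.I))).re)).sub hbig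
    rw [sub_zero] at this
    refine this.congr' ?_
    filter_upwards [eventually_gt_atTop |x|] with R hR
    rw [← half_annulus hd hc hb hε hεx hR]
    refine intervalIntegral.integral_congr_ae (μ := volume) ?_
    have hne : ∀ᵐ s : ℝ, s ≠ Real.log |x| := by simp [ae_iff, measure_singleton]
    filter_upwards [hne] with s hs _
    have hs' : Real.exp s ≠ |x| := by
      rintro h; apply hs; rw [← h, Real.log_exp]
    rw [hζ, hζ]
    · intro h; apply hs'
      rw [show x = Real.exp s by linarith, abs_of_pos (Real.exp_pos s)]
    · intro h; apply hs'
      rw [show x = -Real.exp s by linarith, abs_neg, abs_of_pos (Real.exp_pos s)]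
  have hsmall : Tendsto (truncInt (fun t => ζ t / (t - x)) x) (𝓝[>] 0)
      (𝓝 (Real.pi * (f x).re)) := by
    have hax : 0 < |x| := abs_pos.2 hx
    have hpath : ∀ θ ∈ Icc 0 Real.pi, Tendsto (fun ε : ℝ =>
        (x : ℂ) + ε * Complex.exp (θ * Complex.I)) (𝓝[>] 0) (𝓝[{z : ℂ | 0 ≤ z.im} \ {0}] x) := by
      intro θ hθ
      refine tendsto_nhdsWithin_iff.2 ⟨?_, ?_⟩
      · have h : Continuous fun ε : ℝ => (x : ℂ) + ε * Complex.exp (θ * Complex.I) := by fun_prop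
        have := h.tendsto 0
        simp only [Complex.ofReal_zero, zero_mul, add_zero] at this
        exact this.mono_left nhdsWithin_le_nhds
      · filter_upwards [Ioo_mem_nhdsGT hax] with ε hε
        exact arc_mem hε.1 hε.2.ne hθ
    have hbd := (hc _ hxm).norm.tendsto.eventually (gt_mem_nhds (lt_add_one ‖f x‖))
    obtain ⟨ρ, hρ, hball⟩ := Metric.mem_nhdsWithin_iff.1 hbd
    have : Real.pi * (f x).re = ∫ θ in (0 : ℝ)..Real.pi, (f x).re := by simp
    rw [this]
    have hlim : Tendsto (fun ε : ℝ =>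
        ∫ θ in (0 : ℝ)..Real.pi, (f (x + ε * Complex.exp (θ * Complex.I))).re) (𝓝[>] 0)
        (𝓝 (∫ θ in (0 : ℝ)..Real.pi, (f x).re)) := by
      refine intervalIntegral.tendsto_integral_filter_of_dominated_convergence
        (fun _ => ‖f x‖ + 1) ?_ ?_ intervalIntegrable_const ?_
      · filter_upwards [Ioo_mem_nhdsGT hax] with ε hε
        rw [uIoc_of_le Real.pi_pos.le]
        exact ((continuousOn_arc hc hε.1 hε.2.ne).mono
          Ioc_subset_Icc_self).aestronglyMeasurable measurableSet_Ioc
      · filter_upwards [Ioo_mem_nhdsGT hax, Ioo_mem_nhdsGT hρ] with ε hε hε2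
        refine Eventually.of_forall fun θ hθ => ?_
        rw [uIoc_of_le Real.pi_pos.le] at hθ
        refine (Complex.abs_re_le_norm _).trans (le_of_lt (hball ⟨?_, arc_mem hε.1 hε.2.ne
          (Ioc_subset_Icc_self hθ)⟩))
        rw [Metric.mem_ball, dist_eq_norm, add_sub_cancel_left, norm_mul,
          Complex.norm_exp_ofReal_mul_I, mul_one, Complex.norm_real, Real.norm_eq_abs,
          abs_of_pos hε.1]
        exact hε2.2
      · refine Eventually.of_forall fun θ hθ => ?_
        rw [uIoc_of_le Real.pi_pos.le] at hθ
        exact (Complex.continuous_re.tendsto _).comp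
          ((hc _ hxm).tendsto.comp (hpath θ (Ioc_subset_Icc_self hθ)))
    refine hlim.congr' ?_
    filter_upwards [Ioo_mem_nhdsGT hax] with ε hε
    exact (htrunc ε hε.1 hε.2).symm
  exact ⟨⟨hint, _, hsmall⟩, hsmall.limUnder_eq⟩

end PrincipalValue

end RankOneScattering

end

noncomputable section

namespace RankOneScattering

/-! ### Evaluation of `ψ`. -/

section Psi

/-- The numerator of the real part is `|z|² + Im z`. Hence the principal logarithm of the quotient
is analytic above the axis and has argument below `π/2`. -/
theorem re_div_add_I_pos {z : ℂ} (hz : 0 ≤ z.im) (h0 : z ≠ 0) : 0 < (z / (z + Complex.I)).re := by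
  have h : z + Complex.I ≠ 0 := by
    intro h
    have := congrArg Complex.im h
    simp at this
    linarith
  have hn : 0 < Complex.normSq (z + Complex.I) := Complex.normSq_pos.2 h
  rw [Complex.div_re, ← add_div]
  apply div_pos _ hn
  simp only [Complex.add_re, Complex.I_re, add_zero, Complex.add_im, Complex.I_im]
  rcases hz.lt_or_eq with h1 | h1
  · nlinarith [mul_self_nonneg z.re]
  · have : z.re ≠ 0 := by
      intro h2; exact h0 (Complex.ext h2 h1.symm)
    have := mul_self_pos.2 this
    nlinarith

theorem tendsto_div_add_I :
    Tendsto (fun z : ℂ => z / (z + Complex.I)) (Bornology.cobounded ℂ) (𝓝 1) := by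
  have h1 : Tendsto (fun z : ℂ => z + Complex.I) (Bornology.cobounded ℂ)
      (Bornology.cobounded ℂ) := by
    rw [← tendsto_norm_atTop_iff_cobounded]
    refine tendsto_atTop_mono (fun z => ?_) (tendsto_atTop_add_const_right _ (-1)
      tendsto_norm_cobounded_atTop)
    have := norm_sub_le (z + Complex.I) Complex.I
    simp only [add_sub_cancel_right, Complex.norm_I] at this
    linarith
  have h2 : Tendsto (fun z : ℂ => 1 - Complex.I * (z + Complex.I)⁻¹) (Bornology.cobounded ℂ)
      (𝓝 (1 - Complex.I * 0)) :=
    tendsto_const_nhds.sub ((tendsto_inv₀_cobounded.comp h1).const_mul _)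
  rw [mul_zero, sub_zero] at h2
  refine h2.congr' ?_
  have h3 : ∀ᶠ z : ℂ in Bornology.cobounded ℂ, 1 < ‖z‖ :=
    tendsto_norm_cobounded_atTop.eventually (eventually_gt_atTop 1)
  filter_upwards [h3] with z hz
  have : z + Complex.I ≠ 0 := by
    intro h
    rw [eq_neg_of_add_eq_zero_left h] at hz
    simp at hz
  field_simp
  ring

theorem arccot_eq_arg {t : ℝ} (ht : t ≠ 0) :
    arccot t = (-Complex.log ((t : ℂ) / (t + Complex.I))).im := by
  have hpos := re_div_add_I_pos (z := t) (by simp) (by simpa using ht)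
  have h1 : Complex.arg ((t : ℂ) / (t + Complex.I)) =
      Real.arctan (Real.tan (Complex.arg ((t : ℂ) / (t + Complex.I)))) := by
    have h := Complex.abs_arg_lt_pi_div_two_iff.2 (Or.inl hpos)
    rw [abs_lt] at h
    exact (Real.arctan_tan h.1 h.2).symm
  rw [Complex.neg_im, Complex.log_im, h1, Complex.tan_arg, ← Real.arctan_neg, arccot]
  congr 1
  have hsq : 0 < t * t := mul_self_pos.2 ht
  simp only [Complex.div_re, Complex.div_im, Complex.normSq_apply, Complex.add_re, Complex.add_im,
    Complex.ofReal_re, Complex.ofReal_im, Complex.I_re, Complex.I_im]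
  have h2 : t * t + 1 ≠ 0 := by positivity
  have h3 : (t + 0) * (t + 0) + (0 + 1) * (0 + 1) ≠ 0 := by
    ring_nf; positivity
  field_simp
  ring_nf

theorem abs_arctan_le_abs (u : ℝ) : |Real.arctan u| ≤ |u| := by
  have h : ∀ u : ℝ, 0 ≤ u → |Real.arctan u| ≤ |u| := by
    intro u hu
    rw [abs_of_nonneg (Real.arctan_nonneg.2 hu), abs_of_nonneg hu]
    have := Real.le_tan (Real.arctan_nonneg.2 hu) (Real.arctan_lt_pi_div_two u)
    rwa [Real.tan_arctan] at this
  rcases le_total 0 u with hu | hu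
  · exact h u hu
  · have := h (-u) (by linarith)
    rwa [Real.arctan_neg, abs_neg, abs_neg] at this

/-- On the axis `-log (z/(z + i))` has imaginary part `arccot` and real part `-½ log (x²/(x² + 1))`;
by `pv_im_eq` the exponential equals `(x² + 1)/x²` and cancels the prefactor of `ψ`. -/
theorem pv_arccot {x : ℝ} (hx : x ≠ 0) :
    PVExists (fun t => arccot t / (t - x)) x ∧ psi x = (x ^ 2)⁻¹ := by
  set f : ℂ → ℂ := fun z => -Complex.log (z / (z + Complex.I)) with hf
  have hne : ∀ z : ℂ, 0 ≤ z.im → z + Complex.I ≠ 0 := by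
    intro z hz h
    have := congrArg Complex.im h
    simp at this
    linarith
  have hsl : ∀ z : ℂ, 0 ≤ z.im → z ≠ 0 → z / (z + Complex.I) ∈ Complex.slitPlane :=
    fun z hz h0 => Or.inl (re_div_add_I_pos hz h0)
  have hd : DifferentiableOn ℂ f {z | 0 < z.im} := by
    intro z hz
    have hz' : (0 : ℝ) < z.im := hz
    have h0 : z ≠ 0 := by rintro rfl; simp at hz'
    refine DifferentiableAt.differentiableWithinAt ?_
    have hq : DifferentiableAt ℂ (fun z => z / (z + Complex.I)) z :=
      DifferentiableAt.div (by fun_prop) (by fun_prop) (hne z hz'.le)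
    exact (hq.clog (hsl z hz'.le h0)).neg
  have hc : ContinuousOn f ({z : ℂ | 0 ≤ z.im} \ {0}) := by
    refine (ContinuousOn.clog ?_ fun z hz => hsl z hz.1 hz.2).neg
    exact continuousOn_id.div (continuousOn_id.add continuousOn_const) fun z hz => hne z hz.1
  have hb : ∀ z : ℂ, 0 < z.im → |(f z).im| ≤ Real.pi / 2 := by
    intro z hz
    have h0 : z ≠ 0 := by rintro rfl; simp at hz
    rw [hf]
    simp only [Complex.neg_im, abs_neg, Complex.log_im]
    exact Complex.abs_arg_le_pi_div_two_iff.2 (re_div_add_I_pos hz.le h0).le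
  have hinf : Tendsto f (Bornology.cobounded ℂ ⊓ 𝓟 {z | 0 ≤ z.im}) (𝓝 0) := by
    have h1 : ContinuousAt Complex.log 1 := continuousAt_clog (by simp)
    have h2 := (h1.tendsto.comp tendsto_div_add_I).neg
    rw [Complex.log_one, neg_zero] at h2
    exact h2.mono_left inf_le_left
  have hζ1 : ∀ t, |arccot t| ≤ Real.pi / 2 := by
    intro t
    exact abs_le.2 ⟨(Real.neg_pi_div_two_lt_arctan _).le, (Real.arctan_lt_pi_div_two _).le⟩
  have hζ2 : ∀ t, |arccot t| * |t| ≤ 1 := by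
    intro t
    rcases eq_or_ne t 0 with rfl | ht
    · simp
    · calc |arccot t| * |t| ≤ |1 / t| * |t| :=
          mul_le_mul_of_nonneg_right (abs_arctan_le_abs _) (abs_nonneg _)
        _ = 1 := by rw [← abs_mul]; field_simp; simp
  obtain ⟨h1, h2⟩ := pv_im_eq hd hc hb hinf (ζ := arccot) (fun t ht => arccot_eq_arg ht)
    hζ1 hζ2 hx
  refine ⟨h1, ?_⟩
  rw [psi, h2, hf]
  have hx2 : 0 < x ^ 2 := by positivity
  have hnorm : ‖(x : ℂ) / (x + Complex.I)‖ ^ 2 = x ^ 2 / (x ^ 2 + 1) := by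
    rw [norm_div, div_pow, ← Complex.normSq_eq_norm_sq, ← Complex.normSq_eq_norm_sq,
      Complex.normSq_apply, Complex.normSq_apply]
    simp
    ring
  have hn0 : 0 < ‖(x : ℂ) / (x + Complex.I)‖ :=
    norm_pos_iff.2 (div_ne_zero (by simpa using hx) (hne x (by simp)))
  simp only [Complex.neg_re, Complex.log_re]
  rw [show 2 / Real.pi * (Real.pi * -Real.log ‖(x : ℂ) / (x + Complex.I)‖) =
    -Real.log (‖(x : ℂ) / (x + Complex.I)‖ ^ 2) by
      rw [Real.log_pow]; field_simp; push_cast; ring, hnorm, Real.exp_neg,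
    Real.exp_log (by positivity)]
  field_simp

end Psi

end RankOneScattering

end

noncomputable section

namespace RankOneScattering

/-! ### Hölder continuity and Hardy's inequality for Fourier transforms. -/

section FourierOnLine

/-- The Fourier transform `∫ e^{-itx} V(x) dx`. -/
def ft (V : ℝ → ℂ) (t : ℝ) : ℂ := ∫ x : ℝ, Complex.exp (-(Complex.I * t * x)) * V x

theorem norm_exp_neg_I (t x : ℝ) : ‖Complex.exp (-(Complex.I * t * x))‖ = 1 := by
  rw [Complex.norm_exp]; simp

theorem continuous_exp_neg_I (t : ℝ) :
    Continuous fun x : ℝ => Complex.exp (-(Complex.I * t * x)) := by fun_prop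

theorem integrable_ft {V : ℝ → ℂ} (hV : Integrable V) (t : ℝ) :
    Integrable fun x : ℝ => Complex.exp (-(Complex.I * t * x)) * V x :=
  hV.bdd_mul (c := 1) (continuous_exp_neg_I t).aestronglyMeasurable
    (Eventually.of_forall fun x => (norm_exp_neg_I t x).le)

theorem norm_ft_le (V : ℝ → ℂ) (t : ℝ) : ‖ft V t‖ ≤ ∫ x, ‖V x‖ := by
  refine (norm_integral_le_integral_norm _).trans_eq ?_
  congr 1; ext x
  rw [norm_mul, norm_exp_neg_I, one_mul]

theorem norm_exp_sub_exp_le (t s x : ℝ) :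
    ‖Complex.exp (-(Complex.I * t * x)) - Complex.exp (-(Complex.I * s * x))‖ ≤ |t - s| * |x| := by
  have e : Complex.exp (-(Complex.I * t * x)) - Complex.exp (-(Complex.I * s * x)) =
      Complex.exp (-(Complex.I * s * x)) *
        (Complex.exp (Complex.I * ((-((t - s) * x) : ℝ) : ℂ)) - 1) := by
    rw [mul_sub, ← Complex.exp_add, mul_one]
    congr 2
    push_cast; ring
  rw [e, norm_mul, norm_exp_neg_I, one_mul]
  refine Real.norm_exp_I_mul_ofReal_sub_one_le.trans_eq ?_
  rw [norm_neg, Real.norm_eq_abs, abs_mul]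

theorem continuous_ft {V : ℝ → ℂ} (hV : Integrable V) : Continuous (ft V) := by
  refine continuous_of_dominated (bound := fun x => ‖V x‖)
    (fun t => (integrable_ft hV t).aestronglyMeasurable) ?_ hV.norm ?_
  · intro t
    refine Eventually.of_forall fun x => ?_
    rw [norm_mul, norm_exp_neg_I, one_mul]
  · refine Eventually.of_forall fun x => ?_
    fun_prop

theorem tendsto_tail {f : ℝ → ℝ} (hf : Integrable f) :
    Tendsto (fun n : ℕ => ∫ x, {x : ℝ | (n : ℝ) < |x|}.indicator f x) atTop (𝓝 0) := by
  have h0 : ∫ x : ℝ, (0 : ℝ) = 0 := by simp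
  rw [← h0]
  refine tendsto_integral_of_dominated_convergence (fun x => ‖f x‖) ?_ hf.norm ?_ ?_
  · intro n
    exact hf.aestronglyMeasurable.indicator
      (isOpen_lt continuous_const continuous_abs).measurableSet
  · intro n
    exact Eventually.of_forall fun x => norm_indicator_le_norm_self _ _
  · refine Eventually.of_forall fun x => tendsto_const_nhds.congr' ?_
    filter_upwards [eventually_ge_atTop ⌈|x|⌉₊] with n hn
    have hx : x ∉ {x : ℝ | (n : ℝ) < |x|} := not_lt.2 (Nat.ceil_le.1 hn)
    rw [indicator_of_notMem hx]

/-- The Fourier transform of `V` with `∫ x²|V|² < ∞` satisfies a little-Hölder condition of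
exponent `1/2`. -/
theorem ft_little_holder {V : ℝ → ℂ} (hV : Integrable V)
    (hV2 : Integrable fun x : ℝ => x ^ 2 * ‖V x‖ ^ 2) {ε : ℝ} (hε : 0 < ε) :
    ∃ δ > 0, ∀ s t : ℝ, |t - s| < δ → ‖ft V t - ft V s‖ ≤ ε * √|t - s| := by
  -- The three parts of the majorant below cost `1 + 8 + 1 = 10` units of `η √|t - s|`.
  set η := ε / 10 with hη
  have hη0 : 0 < η := by positivity
  obtain ⟨n, hn⟩ := ((tendsto_tail hV2).eventually (gt_mem_nhds (show 0 < η ^ 2 by positivity))).exists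
  set X : ℝ := (n : ℝ) with hX
  have hX0 : 0 ≤ X := Nat.cast_nonneg n
  set M := ∫ x, ‖V x‖ with hM
  have hM0 : 0 ≤ M := integral_nonneg fun x => norm_nonneg _
  refine ⟨(η / (X * M + 1)) ^ 2, by positivity, ?_⟩
  intro s t hst
  rcases eq_or_ne t s with rfl | hne
  · simp
  set h := |t - s| with hh
  have hh0 : 0 < h := abs_pos.2 (sub_ne_zero.2 hne)
  set k := √h with hk
  have hk0 : 0 < k := Real.sqrt_pos.2 hh0
  have hk2 : k ^ 2 = h := Real.sq_sqrt hh0.le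
  have hkX : k * (X * M + 1) ≤ η := by
    have : k < η / (X * M + 1) := (Real.sqrt_lt' (by positivity)).2 hst
    exact ((lt_div_iff₀ (by positivity)).1 this).le
  -- For `|x| ≤ X` the Lipschitz bound `h|x|` on the exponentials suffices. For `|x| > X` a weighted
  -- mean inequality separates `m/|x|`, where `m ≤ min(h|x|, 2)` and so `(m/|x|)² ≤ 5h²/(1 +
  -- (hx)²)`, from the small tail of `x²|V|²`.
  set B : ℝ → ℝ := fun x => h * X * ‖V x‖ + (5 * η / 2 * k ^ 3) * (1 + (h * x) ^ 2)⁻¹ +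
    k / (2 * η) * {x : ℝ | X < |x|}.indicator (fun x : ℝ => x ^ 2 * ‖V x‖ ^ 2) x with hB
  have hpt : ∀ x : ℝ, ‖Complex.exp (-(Complex.I * t * x)) * V x -
      Complex.exp (-(Complex.I * s * x)) * V x‖ ≤ B x := by
    intro x
    rw [← sub_mul, norm_mul]
    set m := ‖Complex.exp (-(Complex.I * t * x)) - Complex.exp (-(Complex.I * s * x))‖ with hm
    have hm0 : 0 ≤ m := norm_nonneg _
    have hm1 : m ≤ h * |x| := norm_exp_sub_exp_le t s x
    have hm2 : m ≤ 2 := (norm_sub_le _ _).trans (by rw [norm_exp_neg_I, norm_exp_neg_I]; norm_num)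
    have hV0 := norm_nonneg (V x)
    simp only [hB]
    have hpos1 : 0 ≤ (5 * η / 2 * k ^ 3) * (1 + (h * x) ^ 2)⁻¹ := by positivity
    by_cases hx : X < |x|
    · rw [indicator_of_mem (show x ∈ {x : ℝ | X < |x|} from hx)]
      have hx0 : 0 < |x| := hX0.trans_lt hx
      have hA : (m / |x|) ^ 2 ≤ 5 * h ^ 2 * (1 + (h * x) ^ 2)⁻¹ := by
        rw [div_pow, div_le_iff₀ (by positivity), mul_assoc, mul_comm (_⁻¹), ← mul_assoc,
          ← div_eq_mul_inv, le_div_iff₀ (by positivity)]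
        have e1 : m ^ 2 ≤ h ^ 2 * |x| ^ 2 := by rw [← mul_pow]; gcongr
        have e2 : m ^ 2 ≤ 4 := by nlinarith
        have e3 : (h * x) ^ 2 = h ^ 2 * |x| ^ 2 := by rw [mul_pow, sq_abs x]
        rw [e3]
        have e4 : 0 ≤ h ^ 2 * |x| ^ 2 := by positivity
        nlinarith
      have hAM : m * ‖V x‖ ≤ η / (2 * k) * (m / |x|) ^ 2 + k / (2 * η) * (x ^ 2 * ‖V x‖ ^ 2) := by
        have e0 : m * ‖V x‖ = (m / |x|) * (|x| * ‖V x‖) := by field_simp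
        have e1 : x ^ 2 * ‖V x‖ ^ 2 = (|x| * ‖V x‖) ^ 2 := by rw [mul_pow, sq_abs]
        rw [e0, e1]
        set a := m / |x|
        set b := |x| * ‖V x‖
        have : η / (2 * k) * a ^ 2 + k / (2 * η) * b ^ 2 - a * b =
          (η * a - k * b) ^ 2 / (2 * k * η) := by field_simp; ring
        have : 0 ≤ (η * a - k * b) ^ 2 / (2 * k * η) := by positivity
        linarith
      have h3 : η / (2 * k) * (m / |x|) ^ 2 ≤ (5 * η / 2 * k ^ 3) * (1 + (h * x) ^ 2)⁻¹ := by
        refine (mul_le_mul_of_nonneg_left hA (by positivity)).trans_eq ?_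
        rw [← hk2]
        field_simp
      have : 0 ≤ h * X * ‖V x‖ := by positivity
      linarith
    · rw [indicator_of_notMem (show x ∉ {x : ℝ | X < |x|} from hx), mul_zero, add_zero]
      have h1 : m * ‖V x‖ ≤ h * X * ‖V x‖ := by
        refine mul_le_mul_of_nonneg_right (hm1.trans ?_) hV0
        exact mul_le_mul_of_nonneg_left (not_lt.1 hx) hh0.le
      linarith
  have i1 : Integrable fun x => h * X * ‖V x‖ := hV.norm.const_mul _
  have i2 : Integrable fun x : ℝ => (5 * η / 2 * k ^ 3) * (1 + (h * x) ^ 2)⁻¹ :=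
    (integrable_inv_one_add_sq.comp_mul_left' hh0.ne').const_mul _
  have i3 : Integrable fun x => k / (2 * η) *
      {x : ℝ | X < |x|}.indicator (fun x : ℝ => x ^ 2 * ‖V x‖ ^ 2) x :=
    (hV2.indicator (isOpen_lt continuous_const continuous_abs).measurableSet).const_mul _
  have i12 := i1.add i2
  have iB := i12.add i3
  simp only [Pi.add_def] at i12 iB
  rw [ft, ft, ← integral_sub (integrable_ft hV t) (integrable_ft hV s)]
  refine (norm_integral_le_of_norm_le iB (Eventually.of_forall hpt)).trans ?_
  have hπ : ∫ x : ℝ, (1 + (h * x) ^ 2)⁻¹ = h⁻¹ * Real.pi := by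
    rw [Measure.integral_comp_mul_left (fun x : ℝ => (1 + x ^ 2)⁻¹), integral_univ_inv_one_add_sq,
      abs_of_pos (inv_pos.2 hh0), smul_eq_mul]
  rw [integral_add i12 i3, integral_add i1 i2, integral_const_mul, integral_const_mul,
    integral_const_mul, hπ, ← hM]
  have e2 : 5 * η / 2 * k ^ 3 * (h⁻¹ * Real.pi) ≤ 8 * η * k := by
    rw [← hk2]
    have : 5 * η / 2 * k ^ 3 * ((k ^ 2)⁻¹ * Real.pi) = (5 / 2 * Real.pi) * (η * k) := by field_simp
    rw [this, mul_assoc 8]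
    have := Real.pi_lt_d2
    exact mul_le_mul_of_nonneg_right (by linarith) (by positivity)
  have e3 : k / (2 * η) * ∫ x, {x : ℝ | X < |x|}.indicator (fun x : ℝ => x ^ 2 * ‖V x‖ ^ 2) x ≤
      η * k := by
    refine (mul_le_mul_of_nonneg_left hn.le (by positivity)).trans ?_
    have : k / (2 * η) * η ^ 2 = (η * k) / 2 := by field_simp
    rw [this]
    have : 0 < η * k := by positivity
    linarith
  have e1 : h * X * M ≤ η * k := by
    rw [← hk2]
    nlinarith
  have e4 : ε * k = 10 * (η * k) := by rw [hη]; ring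
  have : 0 < η * k := by positivity
  rw [e4]
  linarith

theorem hasDerivAt_ft {V : ℝ → ℂ} (hV : Integrable V) (hV1 : Integrable fun x : ℝ => x * V x)
    (t : ℝ) : HasDerivAt (ft V) (-Complex.I * ft (fun x : ℝ => x * V x) t) t := by
  have h := hasDerivAt_integral_of_dominated_loc_of_deriv_le (𝕜 := ℝ) (μ := volume)
    (F := fun (t : ℝ) (x : ℝ) => Complex.exp (-(Complex.I * t * x)) * V x)
    (F' := fun (t : ℝ) (x : ℝ) => -Complex.I *
      (Complex.exp (-(Complex.I * t * x)) * (x * V x)))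
    (x₀ := t) (s := univ) (bound := fun x : ℝ => ‖(x : ℂ) * V x‖) univ_mem
    (Eventually.of_forall fun t => (integrable_ft hV t).aestronglyMeasurable)
    (integrable_ft hV t)
    ((integrable_ft hV1 t).const_mul _).aestronglyMeasurable
    (Eventually.of_forall fun (x : ℝ) t _ => by
      rw [norm_mul, norm_mul, norm_exp_neg_I]; simp)
    hV1.norm
    (Eventually.of_forall fun (x : ℝ) t _ => by
      have h1 : HasDerivAt (fun t : ℝ => -(Complex.I * (t : ℂ) * x)) (-(Complex.I * x)) t := by
        have h0 : HasDerivAt (fun t : ℝ => (t : ℂ)) 1 t := Complex.ofRealCLM.hasDerivAt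
        have := ((h0.const_mul Complex.I).mul_const (x : ℂ)).neg
        rwa [mul_one] at this
      have h2 := (h1.cexp.mul_const (V x))
      exact h2.congr_deriv (by ring))
  have h2 := h.2
  rw [integral_const_mul] at h2
  exact h2

/-- With `φ(t) = |V̂(a + t)|²`, integrate the derivative of `-φ/t`. The cross term satisfies `φ'/t ≤
½ φ/t² + 2|U|²`, where `U` is the transform of `xV`: the first half is absorbed on the left, the
rest is bounded by Plancherel. Integrability of `xV` serves to differentiate `V̂`. -/
theorem hardy_bound_of_integrable {V : ℝ → ℂ} (hV : Integrable V)
    (hV1 : Integrable fun x : ℝ => x * V x) (hV2 : Integrable fun x : ℝ => x ^ 2 * ‖V x‖ ^ 2)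
    (a : ℝ) {δ T : ℝ} (hδ : 0 < δ) (hT : δ ≤ T) :
    ∫ t in δ..T, ‖ft V (a + t)‖ ^ 2 / t ^ 2 ≤
      2 * (‖ft V (a + δ)‖ ^ 2 / δ) + 8 * Real.pi * ∫ x : ℝ, x ^ 2 * ‖V x‖ ^ 2 := by
  set U : ℝ → ℂ := ft (fun x : ℝ => x * V x) with hU
  have hU2 : MemLp (fun x : ℝ => (x : ℂ) * V x) 2 := by
    rw [memLp_two_iff_integrable_sq_norm hV1.aestronglyMeasurable]
    refine hV2.congr (Eventually.of_forall fun x => ?_)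
    simp [mul_pow]
  obtain ⟨hUi, hUe⟩ := plancherel_exp hV1 hU2
  have hUe' : ∫ t, ‖U t‖ ^ 2 = 2 * Real.pi * ∫ x : ℝ, x ^ 2 * ‖V x‖ ^ 2 := by
    refine hUe.trans ?_
    congr 2; ext x
    simp [mul_pow]
  have hUi' : Integrable fun t => ‖U t‖ ^ 2 := hUi
  have hcV : Continuous (ft V) := continuous_ft hV
  have hcU : Continuous U := continuous_ft hV1
  set φ : ℝ → ℝ := fun t => ‖ft V (a + t)‖ ^ 2 with hφ
  set φ' : ℝ → ℝ := fun t => 2 * inner ℝ (ft V (a + t)) (-Complex.I * U (a + t)) with hφ'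
  have hder : ∀ t, HasDerivAt φ (φ' t) t := by
    intro t
    have h1 := (hasDerivAt_ft hV hV1 (a + t)).comp_const_add a t
    exact h1.norm_sq
  have hφc : Continuous φ := by rw [hφ]; fun_prop
  have hφ'c : Continuous φ' := by rw [hφ']; fun_prop
  have hmem : ∀ t ∈ uIcc δ T, 0 < t := by
    intro t ht
    rw [uIcc_of_le hT] at ht
    exact hδ.trans_le ht.1
  have hder2 : ∀ t ∈ uIcc δ T, HasDerivAt (fun t => -(φ t / t)) (φ t / t ^ 2 - φ' t / t) t := by
    intro t ht
    have ht0 := (hmem t ht).ne'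
    have := ((hder t).div (hasDerivAt_id t) ht0).neg
    refine this.congr_deriv ?_
    simp only [id]
    field_simp
    ring
  have c1 : ContinuousOn (fun t => φ t / t ^ 2) (uIcc δ T) :=
    hφc.continuousOn.div (by fun_prop) fun t ht => (pow_pos (hmem t ht) 2).ne'
  have c2 : ContinuousOn (fun t => φ' t / t) (uIcc δ T) :=
    hφ'c.continuousOn.div (by fun_prop) fun t ht => (hmem t ht).ne'
  have hF := intervalIntegral.integral_eq_sub_of_hasDerivAt hder2 (c1.sub c2).intervalIntegrable
  rw [intervalIntegral.integral_sub c1.intervalIntegrable c2.intervalIntegrable] at hF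
  have cU : Continuous fun t => ‖U (a + t)‖ ^ 2 := by fun_prop
  have hle : ∫ t in δ..T, φ' t / t ≤ ∫ t in δ..T, (1 / 2 * (φ t / t ^ 2) + 2 * ‖U (a + t)‖ ^ 2) := by
    refine intervalIntegral.integral_mono_on hT c2.intervalIntegrable
      (c1.intervalIntegrable.const_mul _ |>.add (cU.intervalIntegrable _ _ |>.const_mul _)) ?_
    intro t ht
    have ht0 : 0 < t := hδ.trans_le ht.1
    have h1 : φ' t ≤ 2 * (‖ft V (a + t)‖ * ‖U (a + t)‖) := by
      have := real_inner_le_norm (ft V (a + t)) (-Complex.I * U (a + t))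
      rw [norm_mul, norm_neg, Complex.norm_I, one_mul] at this
      simp only [hφ']
      linarith
    refine (div_le_div_of_nonneg_right h1 ht0.le).trans ?_
    simp only [hφ]
    have : 1 / 2 * (‖ft V (a + t)‖ ^ 2 / t ^ 2) + 2 * ‖U (a + t)‖ ^ 2 -
      2 * (‖ft V (a + t)‖ * ‖U (a + t)‖) / t =
      1 / 2 * (‖ft V (a + t)‖ / t - 2 * ‖U (a + t)‖) ^ 2 := by field_simp; ring
    have : 0 ≤ 1 / 2 * (‖ft V (a + t)‖ / t - 2 * ‖U (a + t)‖) ^ 2 := by positivity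
    linarith
  rw [intervalIntegral.integral_add (c1.intervalIntegrable.const_mul _)
    ((cU.intervalIntegrable _ _).const_mul _), intervalIntegral.integral_const_mul,
    intervalIntegral.integral_const_mul] at hle
  have hUle : ∫ t in δ..T, ‖U (a + t)‖ ^ 2 ≤ 2 * Real.pi * ∫ x : ℝ, x ^ 2 * ‖V x‖ ^ 2 := by
    rw [← hUe', ← integral_add_left_eq_self (fun t => ‖U t‖ ^ 2) a,
      intervalIntegral.integral_of_le hT]
    exact setIntegral_le_integral (hUi'.comp_add_left a)
      (Eventually.of_forall fun t => by positivity)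
  have hTpos : 0 ≤ φ T / T := by
    have : 0 < T := hδ.trans_le hT
    simp only [hφ]; positivity
  change ∫ t in δ..T, φ t / t ^ 2 ≤ 2 * (φ δ / δ) + _
  linarith

/-- Hardy's inequality away from the zero. -/
theorem hardy_bound {V : ℝ → ℂ} (hV : Integrable V)
    (hV2 : Integrable fun x : ℝ => x ^ 2 * ‖V x‖ ^ 2)
    (a : ℝ) {δ T : ℝ} (hδ : 0 < δ) (hT : δ ≤ T) :
    ∫ t in δ..T, ‖ft V (a + t)‖ ^ 2 / t ^ 2 ≤
      2 * (‖ft V (a + δ)‖ ^ 2 / δ) + 8 * Real.pi * ∫ x : ℝ, x ^ 2 * ‖V x‖ ^ 2 := by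
  -- Cutting off makes `xV` integrable; both sides of the bound pass to the limit on the fixed
  -- interval `[δ, T]`.
  set Vn : ℕ → ℝ → ℂ := fun n => (Icc (-(n : ℝ)) n).indicator V with hVn
  have hle : ∀ n x, ‖Vn n x‖ ≤ ‖V x‖ := fun n x => norm_indicator_le_norm_self _ _
  have hi : ∀ n, Integrable (Vn n) := fun n => hV.indicator measurableSet_Icc
  have hi1 : ∀ n, Integrable fun x : ℝ => x * Vn n x := by
    intro n
    refine (hV.norm.const_mul (n : ℝ)).mono' (Continuous.aestronglyMeasurable
      (by fun_prop) |>.mul (hi n).aestronglyMeasurable) (Eventually.of_forall fun x => ?_)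
    by_cases hx : x ∈ Icc (-(n : ℝ)) n
    · rw [norm_mul, Complex.norm_real, Real.norm_eq_abs]
      exact mul_le_mul (abs_le.2 hx) (hle n x) (norm_nonneg _) (Nat.cast_nonneg n)
    · simp only [hVn, indicator_of_notMem hx, mul_zero, norm_zero]
      positivity
  have hpt2 : ∀ n (x : ℝ), x ^ 2 * ‖Vn n x‖ ^ 2 ≤ x ^ 2 * ‖V x‖ ^ 2 := by
    intro n x
    have := hle n x
    gcongr
  have hi2 : ∀ n, Integrable fun x : ℝ => x ^ 2 * ‖Vn n x‖ ^ 2 := by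
    intro n
    refine hV2.mono' (Continuous.aestronglyMeasurable
      (by fun_prop) |>.mul ((hi n).aestronglyMeasurable.norm.pow 2)) (Eventually.of_forall fun x => ?_)
    rw [Real.norm_of_nonneg (by positivity)]
    exact hpt2 n x
  have hlim : ∀ t, Tendsto (fun n => ft (Vn n) t) atTop (𝓝 (ft V t)) := by
    intro t
    refine tendsto_integral_of_dominated_convergence (fun x => ‖V x‖)
      (fun n => (integrable_ft (hi n) t).aestronglyMeasurable) hV.norm ?_ ?_
    · intro n
      refine Eventually.of_forall fun x => ?_
      rw [norm_mul, norm_exp_neg_I, one_mul]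
      exact hle n x
    · refine Eventually.of_forall fun x => tendsto_const_nhds.congr' ?_
      filter_upwards [eventually_ge_atTop ⌈|x|⌉₊] with n hn
      have hx : x ∈ Icc (-(n : ℝ)) n := abs_le.1 (Nat.ceil_le.1 hn)
      simp only [hVn, indicator_of_mem hx]
  have hL : Tendsto (fun n => ∫ t in δ..T, ‖ft (Vn n) (a + t)‖ ^ 2 / t ^ 2) atTop
      (𝓝 (∫ t in δ..T, ‖ft V (a + t)‖ ^ 2 / t ^ 2)) := by
    refine intervalIntegral.tendsto_integral_filter_of_dominated_convergence
      (fun _ => (∫ x, ‖V x‖) ^ 2 / δ ^ 2) ?_ ?_ intervalIntegrable_const ?_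
    · refine Eventually.of_forall fun n => Measurable.aestronglyMeasurable ?_
      have := (continuous_ft (hi n)).measurable
      fun_prop
    · refine Eventually.of_forall fun n => Eventually.of_forall fun t ht => ?_
      rw [uIoc_of_le hT] at ht
      have h1 : ‖ft (Vn n) (a + t)‖ ≤ ∫ x, ‖V x‖ := (norm_ft_le _ _).trans
        (integral_mono (hi n).norm hV.norm (hle n))
      rw [Real.norm_of_nonneg (by positivity)]
      have := ht.1.le
      gcongr
    · exact Eventually.of_forall fun t _ => ((hlim _).norm.pow 2).div_const _
  have hR : Tendsto (fun n => 2 * (‖ft (Vn n) (a + δ)‖ ^ 2 / δ) +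
      8 * Real.pi * ∫ x : ℝ, x ^ 2 * ‖V x‖ ^ 2) atTop
      (𝓝 (2 * (‖ft V (a + δ)‖ ^ 2 / δ) + 8 * Real.pi * ∫ x : ℝ, x ^ 2 * ‖V x‖ ^ 2)) :=
    ((((hlim _).norm.pow 2).div_const _).const_mul _).add_const _
  refine le_of_tendsto_of_tendsto' hL hR fun n => ?_
  refine (hardy_bound_of_integrable (hi n) (hi1 n) (hi2 n) a hδ hT).trans ?_
  have := integral_mono (hi2 n) hV2 (hpt2 n)
  have hpi := Real.pi_pos
  gcongr

/-- Exhaust the half-line by `(1/(n+1), n+1]`. Since `V̂(a) = 0`, the Hölder bound keeps the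
boundary term `|V̂(a + δ)|²/δ` at most `1` for small `δ`, so the integrals in `hardy_bound` stay
bounded. -/
theorem hardy_right {V : ℝ → ℂ} (hV : Integrable V)
    (hV2 : Integrable fun x : ℝ => x ^ 2 * ‖V x‖ ^ 2) {a : ℝ} (ha : ft V a = 0) :
    IntegrableOn (fun t => ‖ft V (a + t)‖ ^ 2 / t ^ 2) (Ioi 0) := by
  obtain ⟨ρ, hρ, hH⟩ := ft_little_holder hV hV2 one_pos
  have hcov : AECover (volume.restrict (Ioi (0 : ℝ))) atTop
      fun n : ℕ => Ioc (1 / ((n : ℝ) + 1)) ((n : ℝ) + 1) :=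
    (aecover_Ioi_of_Ioi tendsto_one_div_add_atTop_nhds_zero_nat).inter
      (aecover_Iic (tendsto_atTop_add_const_right _ _ tendsto_natCast_atTop_atTop))
  have hpos : ∀ n : ℕ, 0 < 1 / ((n : ℝ) + 1) := fun n => by positivity
  have hle : ∀ n : ℕ, 1 / ((n : ℝ) + 1) ≤ (n : ℝ) + 1 := by
    intro n
    rw [div_le_iff₀ (by positivity)]
    have : (0 : ℝ) ≤ n := Nat.cast_nonneg n
    nlinarith
  have hc := continuous_ft hV
  refine hcov.integrable_of_integral_norm_bounded
    (2 * 1 + 8 * Real.pi * ∫ x : ℝ, x ^ 2 * ‖V x‖ ^ 2) ?_ ?_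
  · intro n
    have hsub : Icc (1 / ((n : ℝ) + 1)) ((n : ℝ) + 1) ⊆ Ioi 0 := fun t ht => (hpos n).trans_le ht.1
    have hcont : ContinuousOn (fun t => ‖ft V (a + t)‖ ^ 2 / t ^ 2)
        (Icc (1 / ((n : ℝ) + 1)) ((n : ℝ) + 1)) :=
      ContinuousOn.div (by fun_prop) (by fun_prop) fun t ht => (pow_pos (hsub ht) 2).ne'
    exact ((hcont.integrableOn_Icc).mono_set Ioc_subset_Icc_self).mono_measure
      Measure.restrict_le_self
  · have hev : ∀ᶠ n : ℕ in atTop, 1 / ((n : ℝ) + 1) < ρ :=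
      tendsto_one_div_add_atTop_nhds_zero_nat.eventually (gt_mem_nhds hρ)
    filter_upwards [hev] with n hn
    rw [Measure.restrict_restrict measurableSet_Ioc, inter_eq_left.2
      (show Ioc (1 / ((n : ℝ) + 1)) ((n : ℝ) + 1) ⊆ Ioi 0 from
        fun t ht => (hpos n).trans ht.1), ← intervalIntegral.integral_of_le (hle n)]
    have e : ∀ t, ‖‖ft V (a + t)‖ ^ 2 / t ^ 2‖ = ‖ft V (a + t)‖ ^ 2 / t ^ 2 :=
      fun t => Real.norm_of_nonneg (by positivity)
    simp_rw [e]
    refine (hardy_bound hV hV2 a (hpos n) (hle n)).trans ?_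
    have h1 := hH a (a + 1 / ((n : ℝ) + 1)) (by rwa [add_sub_cancel_left, abs_of_pos (hpos n)])
    rw [add_sub_cancel_left, abs_of_pos (hpos n), ha, sub_zero, one_mul] at h1
    have h2 : ‖ft V (a + 1 / ((n : ℝ) + 1))‖ ^ 2 / (1 / ((n : ℝ) + 1)) ≤ 1 := by
      rw [div_le_one (hpos n)]
      calc _ ≤ (√(1 / ((n : ℝ) + 1))) ^ 2 := by gcongr
        _ = _ := Real.sq_sqrt (hpos n).le
    gcongr

theorem ft_comp_neg (V : ℝ → ℂ) (t : ℝ) : ft (fun x => V (-x)) t = ft V (-t) := by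
  rw [ft, ft, ← integral_neg_eq_self]
  congr 1; ext x
  push_cast
  simp

/-- Hardy's inequality: if `V̂(a) = 0` then `V̂(t)/(t-a)` is square integrable. -/
theorem hardy {V : ℝ → ℂ} (hV : Integrable V)
    (hV2 : Integrable fun x : ℝ => x ^ 2 * ‖V x‖ ^ 2) {a : ℝ} (ha : ft V a = 0) :
    Integrable (fun t => ‖ft V t‖ ^ 2 / (t - a) ^ 2) := by
  have h1 := hardy_right hV hV2 ha
  have hVn2 : Integrable fun x : ℝ => x ^ 2 * ‖V (-x)‖ ^ 2 := by
    have := hV2.comp_neg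
    simpa using this
  have h2 := hardy_right hV.comp_neg hVn2 (a := -a) (by rw [ft_comp_neg, neg_neg, ha])
  simp_rw [ft_comp_neg] at h2
  have h3 : IntegrableOn (fun t => ‖ft V (a + t)‖ ^ 2 / t ^ 2) (Iio 0) := by
    have h2' : IntegrableOn (fun t => ‖ft V (-(-a + t))‖ ^ 2 / t ^ 2) (Ioi (-(0 : ℝ))) := by
      rwa [neg_zero]
    have := h2'.comp_neg_Iio
    refine this.congr_fun (fun t _ => ?_) measurableSet_Iio
    simp only [neg_add, neg_neg, even_two, Even.neg_pow]
  have h4 : Integrable (fun t => ‖ft V (a + t)‖ ^ 2 / t ^ 2) := by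
    rw [← integrableOn_univ, ← Iic_union_Ioi (a := (0 : ℝ))]
    exact ((integrableOn_Iic_iff_integrableOn_Iio).2 h3).union h1
  have := h4.comp_sub_right a
  simpa using this

end FourierOnLine

/-! ### `W` as the Fourier transform of the odd extension. -/

section OddExtension

/-- The odd extension of the potential. -/
def oddExt (v : ℝ → ℂ) (x : ℝ) : ℂ := ext v x - ext v (-x)

theorem norm_oddExt_sq (v : ℝ → ℂ) (x : ℝ) :
    ‖oddExt v x‖ ^ 2 = ‖ext v x‖ ^ 2 + ‖ext v (-x)‖ ^ 2 := by
  rcases le_total x 0 with hx | hx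
  · simp [oddExt, ext_of_nonpos v hx]
  · simp [oddExt, ext_of_nonpos v (neg_nonpos.2 hx)]

theorem Admissible.integrable_oddExt {v : ℝ → ℂ} (hv : Admissible v) : Integrable (oddExt v) :=
  hv.integrable_ext.sub hv.integrable_ext.comp_neg

theorem Admissible.integrable_weight_ext {v : ℝ → ℂ} (hv : Admissible v) :
    Integrable (fun x : ℝ => x ^ 2 * ‖ext v x‖ ^ 2) ∧ Integrable (fun x : ℝ => ‖ext v x‖ ^ 2) := by
  have h : Integrable (fun x : ℝ => (1 + x ^ 2) * ‖ext v x‖ ^ 2) := by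
    have := (integrable_indicator_iff measurableSet_Ioi).2 hv.integrable
    refine this.congr (Eventually.of_forall fun x => ?_)
    by_cases hx : x ∈ Ioi (0 : ℝ)
    · simp only [indicator_of_mem hx, ext_of_pos v hx]
    · simp [indicator_of_notMem hx, ext_of_nonpos v (not_lt.1 hx)]
  have hm := hv.integrable_ext.aestronglyMeasurable.norm.pow 2
  refine ⟨h.mono' (Continuous.aestronglyMeasurable (by fun_prop) |>.mul hm)
    (Eventually.of_forall fun x => ?_), h.mono' hm (Eventually.of_forall fun x => ?_)⟩
  · rw [Real.norm_of_nonneg (by positivity)]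
    nlinarith [sq_nonneg ‖ext v x‖]
  · rw [Real.norm_of_nonneg (by positivity)]
    nlinarith [sq_nonneg (x * ‖ext v x‖)]

theorem Admissible.integrable_weight_oddExt {v : ℝ → ℂ} (hv : Admissible v) :
    Integrable (fun x : ℝ => x ^ 2 * ‖oddExt v x‖ ^ 2) := by
  have h := hv.integrable_weight_ext.1
  have h2 := h.add h.comp_neg
  refine h2.congr (Eventually.of_forall fun x => ?_)
  simp only [Pi.add_apply, norm_oddExt_sq]
  ring

theorem W_eq_ft {v : ℝ → ℂ} (hv : Admissible v) (t : ℝ) : W v t = ft (oddExt v) t := by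
  have h1 := integrable_ft hv.integrable_ext t
  have h2 := integrable_ft hv.integrable_ext.comp_neg t
  have e : ft (oddExt v) t = ft (ext v) t - ft (fun x => ext v (-x)) t := by
    rw [ft, ft, ft, ← integral_sub h1 h2]
    congr 1; ext x
    rw [oddExt, mul_sub]
  rw [e, ft_comp_neg, W, fourier_eq_ext, fourier_eq_ext, ft, ft]
  push_cast
  rfl

theorem W_neg (v : ℝ → ℂ) (t : ℝ) : W v (-t) = -W v t := by
  simp [W]

theorem continuous_W {v : ℝ → ℂ} (hv : Admissible v) : Continuous (W v) := by
  have h := continuous_ft hv.integrable_oddExt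
  rwa [← show W v = ft (oddExt v) from funext (W_eq_ft hv)] at h

theorem norm_W_le {v : ℝ → ℂ} (hv : Admissible v) (t : ℝ) : ‖W v t‖ ≤ ∫ x, ‖oddExt v x‖ := by
  rw [W_eq_ft hv]; exact norm_ft_le _ _

/-- The constant is `2π` from Plancherel times `2`, because the two halves of the odd extension have
disjoint supports. -/
theorem W_plancherel {v : ℝ → ℂ} (hv : Admissible v) :
    Integrable (fun t => ‖W v t‖ ^ 2) ∧
      ∫ t, ‖W v t‖ ^ 2 = 4 * Real.pi * ∫ x in Ioi (0 : ℝ), ‖v x‖ ^ 2 := by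
  have h := hv.integrable_weight_ext.2
  have hL : Integrable (fun x => ‖oddExt v x‖ ^ 2) := by
    refine (h.add h.comp_neg).congr (Eventually.of_forall fun x => ?_)
    simp only [Pi.add_apply, norm_oddExt_sq]
  obtain ⟨h1, h2⟩ := plancherel_exp hv.integrable_oddExt
    ((memLp_two_iff_integrable_sq_norm hv.integrable_oddExt.aestronglyMeasurable).2 hL)
  simp_rw [W_eq_ft hv]
  refine ⟨h1, h2.trans ?_⟩
  simp_rw [norm_oddExt_sq]
  rw [integral_add h h.comp_neg, integral_neg_eq_self (fun x => ‖ext v x‖ ^ 2)]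
  have : ∫ x, ‖ext v x‖ ^ 2 = ∫ x in Ioi (0 : ℝ), ‖v x‖ ^ 2 := by
    rw [← integral_indicator measurableSet_Ioi]
    congr 1; ext x
    by_cases hx : x ∈ Ioi (0 : ℝ)
    · rw [indicator_of_mem hx, ext_of_pos v hx]
    · simp [indicator_of_notMem hx, ext_of_nonpos v (not_lt.1 hx)]
  rw [this]
  ring

end OddExtension

end RankOneScattering

end

noncomputable section

namespace RankOneScattering

/-! ### The transform `∫ ω(t)/(t² - z²) dt` in the upper half-plane. -/

section Stieltjes

/-- The Stieltjes-type transform `∫ ω(t) / (t² - z²) dt`. -/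
def stieltjes (ω : ℝ → ℝ) (z : ℂ) : ℂ := ∫ t : ℝ, (ω t : ℂ) * ((t : ℂ) ^ 2 - z ^ 2)⁻¹

theorem norm_inv_sq_sub_sq_le_const {z : ℂ} (hz : 0 < z.im) (t : ℝ) :
    ‖((t : ℂ) ^ 2 - z ^ 2)⁻¹‖ ≤ (z.im ^ 2)⁻¹ := by
  have h1 : z.im ≤ ‖(t : ℂ) - z‖ := by
    have := Complex.abs_im_le_norm ((t : ℂ) - z)
    simpa [abs_of_pos hz] using this
  have h2 : z.im ≤ ‖(t : ℂ) + z‖ := by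
    have := Complex.abs_im_le_norm ((t : ℂ) + z)
    simpa [abs_of_pos hz] using this
  rw [norm_inv]
  apply inv_anti₀ (by positivity)
  rw [show (t : ℂ) ^ 2 - z ^ 2 = (t - z) * (t + z) by ring, norm_mul, sq]
  exact mul_le_mul h1 h2 hz.le (norm_nonneg _)

theorem integrable_stieltjes {ω : ℝ → ℝ} (hω : Integrable ω) {z : ℂ} (hz : 0 < z.im) :
    Integrable fun t : ℝ => (ω t : ℂ) * ((t : ℂ) ^ 2 - z ^ 2)⁻¹ :=
  hω.ofReal.mul_bdd (c := (z.im ^ 2)⁻¹) (continuous_inv_sq_sub_sq hz).aestronglyMeasurable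
    (Eventually.of_forall fun t => norm_inv_sq_sub_sq_le_const hz t)

theorem differentiableOn_stieltjes {ω : ℝ → ℝ} (hω : Integrable ω) :
    DifferentiableOn ℂ (stieltjes ω) {z | 0 < z.im} := by
  intro z₀ hz₀
  have hz₀' : 0 < z₀.im := hz₀
  set b := z₀.im / 2 with hb
  have hb0 : 0 < b := by positivity
  set s : Set ℂ := Metric.ball z₀ b with hs
  have hsim : ∀ z ∈ s, b ≤ z.im ∧ ‖z‖ ≤ ‖z₀‖ + b := by
    intro z hz
    rw [hs, Metric.mem_ball, dist_eq_norm] at hz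
    constructor
    · have := (Complex.abs_im_le_norm (z - z₀)).trans hz.le
      rw [Complex.sub_im] at this
      have := (abs_le.1 this).1
      linarith
    · have := norm_sub_norm_le z z₀
      linarith
  have h := hasDerivAt_integral_of_dominated_loc_of_deriv_le (𝕜 := ℂ) (μ := volume)
    (F := fun (z : ℂ) (t : ℝ) => (ω t : ℂ) * ((t : ℂ) ^ 2 - z ^ 2)⁻¹)
    (F' := fun (z : ℂ) (t : ℝ) => (ω t : ℂ) * (2 * z * (((t : ℂ) ^ 2 - z ^ 2)⁻¹) ^ 2))
    (x₀ := z₀) (s := s) (bound := fun t : ℝ => ‖ω t‖ * (2 * (‖z₀‖ + b) * ((b ^ 2)⁻¹) ^ 2))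
    (Metric.ball_mem_nhds _ hb0)
    (by
      filter_upwards [Metric.ball_mem_nhds z₀ hb0] with z hz
      exact (integrable_stieltjes hω (hb0.trans_le (hsim z hz).1)).aestronglyMeasurable)
    (integrable_stieltjes hω hz₀')
    (hω.ofReal.aestronglyMeasurable.mul
      (continuous_const.mul ((continuous_inv_sq_sub_sq hz₀').pow 2)).aestronglyMeasurable)
    (Eventually.of_forall fun (t : ℝ) z hz => by
      obtain ⟨h1, h2⟩ := hsim z hz
      have hzim : 0 < z.im := hb0.trans_le h1
      rw [norm_mul, norm_mul, norm_mul, norm_pow, Complex.norm_real, Complex.norm_ofNat]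
      have h3 : ‖((t : ℂ) ^ 2 - z ^ 2)⁻¹‖ ≤ (b ^ 2)⁻¹ :=
        (norm_inv_sq_sub_sq_le_const hzim t).trans (by gcongr)
      gcongr)
    (hω.norm.mul_const _)
    (Eventually.of_forall fun (t : ℝ) z hz => by
      have hzim : 0 < z.im := hb0.trans_le (hsim z hz).1
      have hne := sq_sub_sq_ne_zero hzim t
      have h1 : HasDerivAt (fun z : ℂ => (t : ℂ) ^ 2 - z ^ 2) (-(2 * z)) z := by
        have := ((hasDerivAt_id z).pow 2).const_sub ((t : ℂ) ^ 2)
        exact this.congr_deriv (by simp)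
      refine ((h1.inv hne).const_mul (ω t : ℂ)).congr_deriv ?_
      field_simp)
  exact h.2.differentiableAt.differentiableWithinAt

/-- Reflection in the imaginary axis conjugates `z²`, and `ω` is real. This symmetry is the source
of the oddness of the phase. -/
theorem stieltjes_neg_conj (ω : ℝ → ℝ) (z : ℂ) :
    stieltjes ω (-starRingEnd ℂ z) = starRingEnd ℂ (stieltjes ω z) := by
  rw [stieltjes, stieltjes, ← integral_conj]
  congr 1; ext t
  simp

/-- Since `z²/(t² - z²) = t²/(t² - z²) - 1`, the sign of the imaginary part is that of `Im z²` for
every `t ≠ 0`, so it survives integration against a positive density. -/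
theorem im_sq_div (t : ℝ) (z : ℂ) :
    (z ^ 2 * ((t : ℂ) ^ 2 - z ^ 2)⁻¹).im =
      (z ^ 2).im * (t ^ 2 * (Complex.normSq ((t : ℂ) ^ 2 - z ^ 2))⁻¹) := by
  rw [Complex.mul_im, Complex.inv_re, Complex.inv_im, ← Complex.ofReal_pow]
  simp only [Complex.sub_re, Complex.sub_im, Complex.ofReal_re, Complex.ofReal_im]
  ring

theorem re_sq_div_of_re_eq_zero (t : ℝ) {z : ℂ} (hz : z.re = 0) :
    z ^ 2 * ((t : ℂ) ^ 2 - z ^ 2)⁻¹ = ((-(z.im ^ 2) * (t ^ 2 + z.im ^ 2)⁻¹ : ℝ) : ℂ) := by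
  have h : z = z.im * Complex.I := by
    apply Complex.ext <;> simp [hz]
  have h2 : z ^ 2 = ((-(z.im ^ 2) : ℝ) : ℂ) := by
    rw [h, mul_pow, Complex.I_sq]; simp
  rw [h2]
  push_cast
  ring

/-- The transform of a nonzero positive density, multiplied by `-z²`, avoids the negative axis. -/
theorem neg_sq_mul_stieltjes_mem_slitPlane {ω : ℝ → ℝ} (hω : Integrable ω) (h0 : ∀ t, 0 ≤ ω t)
    (hpos : 0 < ∫ t, ω t) {z : ℂ} (hz : 0 < z.im) :
    -(z ^ 2 * stieltjes ω z) ∈ Complex.slitPlane := by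
  have hsupp : 0 < volume (Function.support ω) :=
    (integral_pos_iff_support_of_nonneg h0 hω).1 hpos
  have hint := (integrable_stieltjes hω hz).const_mul (z ^ 2)
  have e : z ^ 2 * stieltjes ω z = ∫ t : ℝ, z ^ 2 * ((ω t : ℂ) * ((t : ℂ) ^ 2 - z ^ 2)⁻¹) := by
    rw [stieltjes, integral_const_mul]
  -- On the imaginary axis the value is real and positive; off it `Im z² ≠ 0`, and the imaginary
  -- part cannot vanish.
  rcases eq_or_ne z.re 0 with hre | hre
  · left
    have h1 : ∀ t : ℝ, z ^ 2 * ((ω t : ℂ) * ((t : ℂ) ^ 2 - z ^ 2)⁻¹) =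
        ((-(ω t * (z.im ^ 2 * (t ^ 2 + z.im ^ 2)⁻¹)) : ℝ) : ℂ) := by
      intro t
      rw [mul_left_comm, re_sq_div_of_re_eq_zero t hre]
      push_cast; ring
    simp_rw [h1] at e hint
    have hint' : Integrable fun t => ω t * (z.im ^ 2 * (t ^ 2 + z.im ^ 2)⁻¹) := by
      have := hint.re.neg
      refine this.congr (Eventually.of_forall fun t => ?_)
      simp only [Pi.neg_apply, RCLike.re_to_complex, Complex.ofReal_re, neg_neg]
    rw [e, integral_complex_ofReal, integral_neg, ← Complex.ofReal_neg, neg_neg, Complex.ofReal_re,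
      integral_pos_iff_support_of_nonneg (fun t => mul_nonneg (h0 t) (by positivity)) hint']
    refine hsupp.trans_le (measure_mono fun t ht => ?_)
    have : (z.im ^ 2 * (t ^ 2 + z.im ^ 2)⁻¹) ≠ 0 := by positivity
    exact mul_ne_zero ht this
  · right
    rw [Complex.neg_im, neg_ne_zero, e]
    have hzim2 : (z ^ 2).im ≠ 0 := by
      rw [sq, Complex.mul_im]
      have := mul_ne_zero hre hz.ne'
      intro h
      apply this
      linarith
    have h1 : ∀ t : ℝ, (z ^ 2 * ((ω t : ℂ) * ((t : ℂ) ^ 2 - z ^ 2)⁻¹)).im =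
        (z ^ 2).im * (ω t * (t ^ 2 * (Complex.normSq ((t : ℂ) ^ 2 - z ^ 2))⁻¹)) := by
      intro t
      rw [mul_left_comm, Complex.im_ofReal_mul, im_sq_div]
      ring
    have him : (∫ t : ℝ, z ^ 2 * ((ω t : ℂ) * ((t : ℂ) ^ 2 - z ^ 2)⁻¹)).im =
        (z ^ 2).im * ∫ t : ℝ, (ω t * (t ^ 2 * (Complex.normSq ((t : ℂ) ^ 2 - z ^ 2))⁻¹)) := by
      rw [← integral_const_mul, ← Complex.imCLM_apply, ← Complex.imCLM.integral_comp_comm hint]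
      congr 1; ext t
      rw [Complex.imCLM_apply, h1]
    rw [him]
    refine mul_ne_zero hzim2 (ne_of_gt ?_)
    have hint' : Integrable fun t : ℝ =>
        (ω t * (t ^ 2 * (Complex.normSq ((t : ℂ) ^ 2 - z ^ 2))⁻¹)) := by
      have := hint.im.const_mul ((z ^ 2).im)⁻¹
      refine this.congr (Eventually.of_forall fun t => ?_)
      simp only [RCLike.im_to_complex]
      rw [h1, inv_mul_cancel_left₀ hzim2]
    rw [integral_pos_iff_support_of_nonneg (fun t => mul_nonneg (h0 t)
      (mul_nonneg (sq_nonneg _) (inv_nonneg.2 (Complex.normSq_nonneg _)))) hint']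
    have hsub : Function.support ω \ {0} ⊆ Function.support fun t : ℝ =>
        (ω t * (t ^ 2 * (Complex.normSq ((t : ℂ) ^ 2 - z ^ 2))⁻¹)) := by
      rintro t ⟨ht, ht0⟩
      have h2 : t ^ 2 ≠ 0 := pow_ne_zero 2 ht0
      have h3 := Complex.normSq_pos.2 (sq_sub_sq_ne_zero hz t)
      exact mul_ne_zero ht (mul_ne_zero h2 (inv_pos.2 h3).ne')
    refine lt_of_lt_of_le ?_ (measure_mono hsub)
    rwa [measure_sdiff_null (measure_singleton 0)]

/-- The transform of a point mass, multiplied by `-z²`, avoids the negative axis. -/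
theorem sq_div_sq_sub_mem_slitPlane (c : ℝ) (hc : c ≠ 0) {z : ℂ} (hz : 0 < z.im) :
    z ^ 2 / (z ^ 2 - (c : ℂ) ^ 2) ∈ Complex.slitPlane := by
  have e : z ^ 2 / (z ^ 2 - (c : ℂ) ^ 2) = -(z ^ 2 * ((c : ℂ) ^ 2 - z ^ 2)⁻¹) := by
    rw [← neg_sub, div_neg, div_eq_mul_inv]
  rw [e]
  rcases eq_or_ne z.re 0 with hre | hre
  · left
    rw [re_sq_div_of_re_eq_zero c hre, ← Complex.ofReal_neg, Complex.ofReal_re]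
    have : 0 < z.im ^ 2 * (c ^ 2 + z.im ^ 2)⁻¹ := by positivity
    linarith
  · right
    rw [Complex.neg_im, neg_ne_zero, im_sq_div]
    have hzim2 : (z ^ 2).im ≠ 0 := by
      rw [sq, Complex.mul_im]
      have := mul_ne_zero hre hz.ne'
      intro h
      apply this
      linarith
    have h3 := Complex.normSq_pos.2 (sq_sub_sq_ne_zero hz c)
    exact mul_ne_zero hzim2 (mul_ne_zero (pow_ne_zero 2 hc) (inv_pos.2 h3).ne')

end Stieltjes

/-! ### A Cauchy integral near a double zero that has been divided out. -/

section LocalCauchy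

theorem integral_inv_sqrt {h : ℝ} (hh : 0 ≤ h) :
    IntervalIntegrable (fun u : ℝ => (√u)⁻¹) volume 0 h ∧ ∫ u in (0 : ℝ)..h, (√u)⁻¹ = 2 * √h := by
  have e : EqOn (fun u : ℝ => u ^ (-(1 / 2) : ℝ)) (fun u : ℝ => (√u)⁻¹) (uIcc 0 h) := by
    intro u hu
    rw [uIcc_of_le hh] at hu
    simp only
    rw [Real.rpow_neg hu.1, Real.sqrt_eq_rpow]
  have hi := intervalIntegral.intervalIntegrable_rpow' (a := 0) (b := h)
    (r := -(1 / 2)) (by norm_num)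
  refine ⟨hi.congr (e.mono uIoc_subset_uIcc), ?_⟩
  rw [← intervalIntegral.integral_congr e, integral_rpow (Or.inl (by norm_num)),
    Real.sqrt_eq_rpow]
  norm_num
  ring

theorem integral_poisson_le {h η : ℝ} (hη : 0 < η) :
    IntervalIntegrable (fun u : ℝ => η / (u ^ 2 + η ^ 2)) volume 0 h ∧
    ∫ u in (0 : ℝ)..h, η / (u ^ 2 + η ^ 2) ≤ 2 := by
  have hc : Continuous fun u : ℝ => η / (u ^ 2 + η ^ 2) :=
    continuous_const.div (by fun_prop) fun u => by positivity
  have hi := hc.intervalIntegrable (μ := volume) 0 h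
  refine ⟨hi, ?_⟩
  have hd : ∀ u ∈ uIcc 0 h, HasDerivAt (fun u => Real.arctan (u / η)) (η / (u ^ 2 + η ^ 2)) u := by
    intro u _
    have := ((hasDerivAt_id u).div_const η).arctan
    refine this.congr_deriv ?_
    simp only [id]
    field_simp
    ring
  rw [intervalIntegral.integral_eq_sub_of_hasDerivAt hd hi]
  simp only [zero_div, Real.arctan_zero, sub_zero]
  have := Real.arctan_lt_pi_div_two (h / η)
  have := Real.pi_lt_four
  linarith

/-- `P` and `M` are the density at the points `ξ ± u` measured from the zero, with `k = √|ξ|` and `m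
= √u`. As `u ≤ |ξ|/2`, both denominators are at least `ξ²/4`. The difference `P - M` splits into the
Hölder increment of the numerators and the change `4ξu` of the denominators. -/
theorem local_density_bounds {P M ξ u ε k m : ℝ} (hP0 : 0 ≤ P) (hM0 : 0 ≤ M) (hε : 0 < ε)
    (hk0 : 0 < k) (hm0 : 0 < m) (hk2 : k ^ 2 = |ξ|) (hm2 : m ^ 2 = u) (huξ : 2 * u ≤ |ξ|)
    (hmk : m ≤ k) (b1 : P * (ξ + u) ^ 2 ≤ 2 * ε * k ^ 2) (b2 : M * (ξ - u) ^ 2 ≤ 2 * ε * k ^ 2)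
    (b3 : |P * (ξ + u) ^ 2 - M * (ξ - u) ^ 2| ≤ 2 * ε * m * k) :
    P ≤ 8 * ε / k ^ 2 ∧ M ≤ 8 * ε / k ^ 2 ∧ |P - M| ≤ 136 * ε * m / k ^ 3 := by
  have hu0 : 0 < u := by rw [← hm2]; positivity
  have hξ2 : ξ ^ 2 = k ^ 4 := by rw [← sq_abs, ← hk2]; ring
  have d1 : k ^ 4 / 4 ≤ (ξ + u) ^ 2 := by
    have : |ξ| / 2 ≤ |ξ + u| := by
      have := abs_sub_abs_le_abs_sub ξ (-u)
      rw [abs_neg, abs_of_pos hu0, sub_neg_eq_add] at this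
      linarith
    rw [← sq_abs (ξ + u), ← hξ2, ← sq_abs ξ]
    nlinarith
  have d2 : k ^ 4 / 4 ≤ (ξ - u) ^ 2 := by
    have : |ξ| / 2 ≤ |ξ - u| := by
      have := abs_sub_abs_le_abs_sub ξ u
      rw [abs_of_pos hu0] at this
      linarith
    rw [← sq_abs (ξ - u), ← hξ2, ← sq_abs ξ]
    nlinarith
  have hk4 : 0 < k ^ 4 := by positivity
  have p1 : P ≤ 8 * ε / k ^ 2 := by
    rw [le_div_iff₀ (by positivity)]
    have : P * (k ^ 4 / 4) ≤ 2 * ε * k ^ 2 := (mul_le_mul_of_nonneg_left d1 hP0).trans b1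
    refine le_of_mul_le_mul_right ?_ (show 0 < k ^ 2 / 4 by positivity)
    linarith
  have p2 : M ≤ 8 * ε / k ^ 2 := by
    rw [le_div_iff₀ (by positivity)]
    have : M * (k ^ 4 / 4) ≤ 2 * ε * k ^ 2 := (mul_le_mul_of_nonneg_left d2 hM0).trans b2
    refine le_of_mul_le_mul_right ?_ (show 0 < k ^ 2 / 4 by positivity)
    linarith
  have p3 : |P - M| ≤ 136 * ε * m / k ^ 3 := by
    have e : (P - M) * (ξ + u) ^ 2 = (P * (ξ + u) ^ 2 - M * (ξ - u) ^ 2) - M * (4 * ξ * u) := by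
      ring
    have e' : |P - M| * (ξ + u) ^ 2 ≤ 2 * ε * m * k + 8 * ε / k ^ 2 * (4 * k ^ 2 * m ^ 2) := by
      rw [← abs_of_nonneg (sq_nonneg (ξ + u)), ← abs_mul, e]
      refine (abs_sub _ _).trans (add_le_add b3 ?_)
      rw [abs_mul, abs_of_nonneg hM0, abs_mul, abs_mul, abs_of_pos hu0, ← hk2, hm2]
      simp only [Nat.abs_ofNat]
      gcongr
    have e'' : 8 * ε / k ^ 2 * (4 * k ^ 2 * m ^ 2) = 32 * ε * m * m := by field_simp; ring
    rw [e''] at e'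
    have e3 : 32 * ε * m * m ≤ 32 * ε * m * k := by gcongr
    have e4 : |P - M| * (k ^ 4 / 4) ≤ 34 * ε * m * k := by
      have := mul_le_mul_of_nonneg_left d1 (abs_nonneg (P - M))
      linarith
    rw [le_div_iff₀ (by positivity)]
    refine le_of_mul_le_mul_right ?_ (show 0 < k / 4 by positivity)
    linarith
  exact ⟨p1, p2, p3⟩

/-- Pairing `u` with `-u`, the odd part of `1/(u - iη)` meets only `P - M`, which compensates its
singularity, and the even part is a Poisson kernel multiplying `P + M`. -/
theorem norm_pair_cauchy_le {P M u η : ℝ} (hP0 : 0 ≤ P) (hM0 : 0 ≤ M) (hu0 : 0 < u)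
    (hη : 0 < η) : ‖(M : ℂ) * (((-u : ℝ) : ℂ) - η * Complex.I)⁻¹ + P * ((u : ℂ) - η * Complex.I)⁻¹‖ ≤
      |P - M| * u / (u ^ 2 + η ^ 2) + (P + M) * η / (u ^ 2 + η ^ 2) := by
  have hne : ∀ u : ℝ, (u : ℂ) - η * Complex.I ≠ 0 := by
    intro u hu
    have := congrArg Complex.im hu
    simp at this
    linarith
  have hden : 0 < u ^ 2 + η ^ 2 := by positivity
  have hsum : (M : ℂ) * (((-u : ℝ) : ℂ) - η * Complex.I)⁻¹ + P * ((u : ℂ) - η * Complex.I)⁻¹ =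
      (((P - M) * u : ℝ) + ((P + M) * η : ℝ) * Complex.I) / ((u ^ 2 + η ^ 2 : ℝ) : ℂ) := by
    have n1 := hne u
    have n2 := hne (-u)
    push_cast at n2 ⊢
    have n3 : (u : ℂ) ^ 2 + (η : ℂ) ^ 2 ≠ 0 := by exact_mod_cast hden.ne'
    have e : (u : ℂ) ^ 2 + (η : ℂ) ^ 2 = -((u - η * Complex.I) * (-u - η * Complex.I)) := by
      ring_nf
      rw [Complex.I_sq]; ring
    rw [e, div_eq_mul_inv, inv_neg, mul_inv]
    field_simp
    ring
  rw [hsum, norm_div, Complex.norm_real, Real.norm_of_nonneg hden.le]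
  have n1 : ‖(((P - M) * u : ℝ) : ℂ) + ((P + M) * η : ℝ) * Complex.I‖ ≤
      |P - M| * u + (P + M) * η := by
    refine (norm_add_le _ _).trans ?_
    rw [norm_mul, Complex.norm_I, mul_one, Complex.norm_real, Complex.norm_real,
      Real.norm_eq_abs, Real.norm_eq_abs, abs_mul, abs_of_pos hu0,
      abs_of_nonneg (by positivity : 0 ≤ (P + M) * η)]
  refine (div_le_div_of_nonneg_right n1 hden.le).trans_eq (add_div _ _ _)

/-- Estimate of the Cauchy integral over a symmetric interval of half-length at most `|ξ|/2`
around `a + ξ`, for a density `q(t)/(t-a)²` with `q` Hölder of exponent `1/2`. -/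
theorem norm_local_cauchy_le {p : ℝ → ℝ} {a ξ η ε h : ℝ} (hp : Integrable p) (h0 : ∀ t, 0 ≤ p t)
    (hη : 0 < η) (hε : 0 < ε) (hh : 0 ≤ h) (hξ : 2 * h ≤ |ξ|) (hξ0 : ξ ≠ 0)
    (hq : ∀ s t, |s - a| ≤ 2 * |ξ| → |t - a| ≤ 2 * |ξ| →
      |p t * (t - a) ^ 2 - p s * (s - a) ^ 2| ≤ ε * √|t - s| * √|ξ|) :
    ‖∫ u in (-h)..h, (p (a + ξ + u) : ℂ) * ((u : ℂ) - η * Complex.I)⁻¹‖ ≤ 400 * ε / |ξ| := by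
  have hξp : 0 < |ξ| := abs_pos.2 hξ0
  set k := √|ξ| with hk
  have hk0 : 0 < k := Real.sqrt_pos.2 hξp
  have hk2 : k ^ 2 = |ξ| := Real.sq_sqrt hξp.le
  set φ : ℝ → ℂ := fun u => (p (a + ξ + u) : ℂ) * ((u : ℂ) - η * Complex.I)⁻¹ with hφ
  have hne : ∀ u : ℝ, (u : ℂ) - η * Complex.I ≠ 0 := by
    intro u hu
    have := congrArg Complex.im hu
    simp at this
    linarith
  have hφi : Integrable φ := by
    have h1 : Integrable fun u => p (a + ξ + u) := hp.comp_add_left (a + ξ)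
    refine h1.ofReal.mul_bdd (c := η⁻¹) (Continuous.aestronglyMeasurable
      (Continuous.inv₀ (by fun_prop) hne)) (Eventually.of_forall fun u => ?_)
    rw [norm_inv]
    apply inv_anti₀ hη
    have := Complex.abs_im_le_norm ((u : ℂ) - η * Complex.I)
    simpa [abs_of_pos hη] using this
  have hsplit : ∫ u in (-h)..h, φ u = ∫ u in (0 : ℝ)..h, (φ (-u) + φ u) := by
    rw [← intervalIntegral.integral_add_adjacent_intervals (b := 0)
      hφi.intervalIntegrable hφi.intervalIntegrable,
      intervalIntegral.integral_add hφi.comp_neg.intervalIntegrable hφi.intervalIntegrable,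
      intervalIntegral.integral_comp_neg, neg_zero]
  rw [hsplit]
  obtain ⟨i1, e1⟩ := integral_inv_sqrt hh
  obtain ⟨i2, e2⟩ := integral_poisson_le (h := h) hη
  have hbound : ∀ u ∈ Ioc 0 h, ‖φ (-u) + φ u‖ ≤
      136 * ε / k ^ 3 * (√u)⁻¹ + 16 * ε / |ξ| * (η / (u ^ 2 + η ^ 2)) := by
    intro u hu
    have hu0 : 0 < u := hu.1
    have huξ : 2 * u ≤ |ξ| := by linarith [hu.2]
    set m := √u with hm
    have hm0 : 0 < m := Real.sqrt_pos.2 hu0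
    have hm2 : m ^ 2 = u := Real.sq_sqrt hu0.le
    have hmk : m ≤ k := Real.sqrt_le_sqrt (by linarith)
    set P := p (a + ξ + u) with hP
    set M := p (a + ξ + -u) with hM
    have hP0 : 0 ≤ P := h0 _
    have hM0 : 0 ≤ M := h0 _
    have ha1 : |a + ξ + u - a| ≤ 2 * |ξ| := by
      rw [show a + ξ + u - a = ξ + u by ring]
      refine (abs_add_le _ _).trans ?_
      rw [abs_of_pos hu0]; linarith
    have ha2 : |a + ξ + -u - a| ≤ 2 * |ξ| := by
      rw [show a + ξ + -u - a = ξ + -u by ring]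
      refine (abs_add_le _ _).trans ?_
      rw [abs_neg, abs_of_pos hu0]; linarith
    have ha0 : |a - a| ≤ 2 * |ξ| := by simp
    have q1 := hq _ _ ha0 ha1
    have q2 := hq _ _ ha0 ha2
    have q3 := hq _ _ ha2 ha1
    have s1 : √|a + ξ + u - a| ≤ 2 * k := by
      refine (Real.sqrt_le_sqrt (ha1.trans (show 2 * |ξ| ≤ 2 ^ 2 * |ξ| by linarith))).trans_eq ?_
      rw [Real.sqrt_mul (by norm_num), Real.sqrt_sq (by norm_num)]
    have s2 : √|a + ξ + -u - a| ≤ 2 * k := by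
      refine (Real.sqrt_le_sqrt (ha2.trans (show 2 * |ξ| ≤ 2 ^ 2 * |ξ| by linarith))).trans_eq ?_
      rw [Real.sqrt_mul (by norm_num), Real.sqrt_sq (by norm_num)]
    have s3 : √|a + ξ + u - (a + ξ + -u)| ≤ 2 * m := by
      rw [show a + ξ + u - (a + ξ + -u) = 2 * u by ring, abs_of_pos (by positivity)]
      refine (Real.sqrt_le_sqrt (show 2 * u ≤ 2 ^ 2 * u by linarith)).trans_eq ?_
      rw [Real.sqrt_mul (by norm_num), Real.sqrt_sq (by norm_num)]
    have b1 : P * (ξ + u) ^ 2 ≤ 2 * ε * k ^ 2 := by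
      rw [show (a - a) ^ 2 = 0 by simp, mul_zero, sub_zero,
        show (a + ξ + u - a) = ξ + u by ring] at q1
      refine (le_abs_self _).trans (q1.trans ?_)
      rw [show a + ξ + u - a = ξ + u by ring] at s1
      calc ε * √|ξ + u| * k ≤ ε * (2 * k) * k := by gcongr
        _ = _ := by ring
    have b2 : M * (ξ - u) ^ 2 ≤ 2 * ε * k ^ 2 := by
      rw [show (a - a) ^ 2 = 0 by simp, mul_zero, sub_zero,
        show (a + ξ + -u - a) = ξ - u by ring] at q2
      refine (le_abs_self _).trans (q2.trans ?_)
      rw [show a + ξ + -u - a = ξ - u by ring] at s2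
      calc ε * √|ξ - u| * k ≤ ε * (2 * k) * k := by gcongr
        _ = _ := by ring
    have b3 : |P * (ξ + u) ^ 2 - M * (ξ - u) ^ 2| ≤ 2 * ε * m * k := by
      rw [show (a + ξ + u - a) = ξ + u by ring, show (a + ξ + -u - a) = ξ - u by ring] at q3
      refine q3.trans ?_
      calc ε * √|a + ξ + u - (a + ξ + -u)| * k ≤ ε * (2 * m) * k := by gcongr
        _ = _ := by ring
    obtain ⟨p1, p2, p3⟩ := local_density_bounds hP0 hM0 hε hk0 hm0 hk2 hm2 huξ hmk b1 b2 b3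
    have hden : 0 < u ^ 2 + η ^ 2 := by positivity
    refine (norm_pair_cauchy_le hP0 hM0 hu0 hη).trans ?_
    refine add_le_add ?_ ?_
    · rw [div_le_iff₀ hden]
      have h1 : |P - M| * u ≤ 136 * ε * m / k ^ 3 * u := by gcongr
      have h2 : 136 * ε / k ^ 3 * m⁻¹ * (u ^ 2) ≤ 136 * ε / k ^ 3 * m⁻¹ * (u ^ 2 + η ^ 2) := by
        gcongr
        nlinarith
      have h3 : 136 * ε * m / k ^ 3 * u = 136 * ε / k ^ 3 * m⁻¹ * (u ^ 2) := by
        rw [← hm2]; field_simp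
      linarith
    · rw [mul_div_assoc]
      have : P + M ≤ 16 * ε / |ξ| := by
        rw [← hk2]
        have : 16 * ε / k ^ 2 = 8 * ε / k ^ 2 + 8 * ε / k ^ 2 := by ring
        linarith
      gcongr
  refine (intervalIntegral.norm_integral_le_of_norm_le hh (Eventually.of_forall hbound)
    ((i1.const_mul _).add (i2.const_mul _))).trans ?_
  rw [intervalIntegral.integral_add (i1.const_mul _) (i2.const_mul _),
    intervalIntegral.integral_const_mul, intervalIntegral.integral_const_mul, e1]
  have hsh : √h ≤ k := Real.sqrt_le_sqrt (by linarith)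
  have f1 : 136 * ε / k ^ 3 * (2 * √h) ≤ 136 * ε / k ^ 3 * (2 * k) := by gcongr
  have f2 : 136 * ε / k ^ 3 * (2 * k) = 272 * ε / |ξ| := by rw [← hk2]; field_simp; norm_num
  have f3 : 16 * ε / |ξ| * ∫ u in (0 : ℝ)..h, η / (u ^ 2 + η ^ 2) ≤ 16 * ε / |ξ| * 2 := by gcongr
  have f4 : 272 * ε / |ξ| + 16 * ε / |ξ| * 2 ≤ 400 * ε / |ξ| := by
    rw [show 272 * ε / |ξ| + 16 * ε / |ξ| * 2 = 304 * ε / |ξ| by ring]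
    gcongr
    norm_num
  linarith

/-- If `p ≥ 0` is integrable and `p(t)(t-a)²` is little-Hölder of exponent `1/2` at `a`, then
`(z - a) ∫ p(t)/(t - z) dt → 0` as `z → a` in the upper half-plane. -/
theorem tendsto_mul_cauchy {p : ℝ → ℝ} (hp : Integrable p) (h0 : ∀ t, 0 ≤ p t) {a : ℝ}
    (hq : ∀ ε > 0, ∃ δ > 0, ∀ ρ, 0 < ρ → ρ < δ → ∀ s t, |s - a| ≤ 2 * ρ → |t - a| ≤ 2 * ρ →
      |p t * (t - a) ^ 2 - p s * (s - a) ^ 2| ≤ ε * √|t - s| * √ρ) :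
    Tendsto (fun z : ℂ => (z - a) * ∫ t : ℝ, (p t : ℂ) * ((t : ℂ) - z)⁻¹)
      (𝓝[{z | 0 < z.im}] (a : ℂ)) (𝓝 0) := by
  -- The radius is chosen so that `|z - a| ≤ 4|t - z|` outside `J z`, which permits dominated
  -- convergence there, while inside it stays at most `|Re z - a|/2`, as `norm_local_cauchy_le`
  -- requires. For `|Re z - a| ≤ Im z` the set is empty.
  set J : ℂ → Set ℝ := fun z => Ioo (z.re - (|z.re - a| - z.im) / 2)
    (z.re + (|z.re - a| - z.im) / 2) with hJ
  have hne : ∀ z : ℂ, 0 < z.im → ∀ t : ℝ, (t : ℂ) - z ≠ 0 := by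
    intro z hz t h
    have := congrArg Complex.im h
    simp at this
    linarith
  have hint : ∀ z : ℂ, 0 < z.im → Integrable fun t : ℝ => (p t : ℂ) * ((t : ℂ) - z)⁻¹ := by
    intro z hz
    refine hp.ofReal.mul_bdd (c := z.im⁻¹) (Continuous.aestronglyMeasurable
      (Continuous.inv₀ (by fun_prop) (hne z hz))) (Eventually.of_forall fun t => ?_)
    rw [norm_inv]
    apply inv_anti₀ hz
    have := Complex.abs_im_le_norm ((t : ℂ) - z)
    simpa [abs_of_pos hz] using this
  have hnorm_le : ∀ z : ℂ, 0 < z.im → ‖z - a‖ ≤ |z.re - a| + z.im := by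
    intro z hz
    have := Complex.norm_le_abs_re_add_abs_im (z - a)
    simpa [abs_of_pos hz] using this
  have hfar : Tendsto (fun z : ℂ => ∫ t : ℝ, (J z)ᶜ.indicator
      (fun t : ℝ => (z - a) * ((p t : ℂ) * ((t : ℂ) - z)⁻¹)) t)
      (𝓝[{z | 0 < z.im}] (a : ℂ)) (𝓝 0) := by
    have hzero : ∫ _ : ℝ, (0 : ℂ) = 0 := by simp
    rw [← hzero]
    refine tendsto_integral_filter_of_dominated_convergence (fun t => 4 * p t) ?_ ?_
      (hp.const_mul 4) ?_
    · filter_upwards [self_mem_nhdsWithin] with z hz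
      exact ((hint z hz).const_mul _).aestronglyMeasurable.indicator measurableSet_Ioo.compl
    · filter_upwards [self_mem_nhdsWithin] with z hz
      have hz' : 0 < z.im := hz
      refine Eventually.of_forall fun t => ?_
      by_cases ht : t ∈ J z
      · rw [indicator_of_notMem (by simpa using ht), norm_zero]
        linarith [h0 t]
      · rw [indicator_of_mem (by exact ht), norm_mul, norm_mul, Complex.norm_real,
          Real.norm_of_nonneg (h0 t), norm_inv]
        have h1 : z.im ≤ ‖(t : ℂ) - z‖ := by
          have := Complex.abs_im_le_norm ((t : ℂ) - z)
          simpa [abs_of_pos hz'] using this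
        have h2 : (|z.re - a| - z.im) / 2 ≤ ‖(t : ℂ) - z‖ := by
          have h3 := Complex.abs_re_le_norm ((t : ℂ) - z)
          simp only [Complex.sub_re, Complex.ofReal_re] at h3
          refine le_trans ?_ h3
          by_contra hcon
          rw [not_le, abs_lt] at hcon
          exact ht ⟨by linarith [hcon.1], by linarith [hcon.2]⟩
        have h4 : ‖z - a‖ ≤ 4 * ‖(t : ℂ) - z‖ := by linarith [hnorm_le z hz']
        have h5 : 0 < ‖(t : ℂ) - z‖ := norm_pos_iff.2 (hne z hz' t)
        rw [mul_left_comm, mul_comm 4]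
        apply mul_le_mul_of_nonneg_left _ (h0 t)
        rw [← div_eq_mul_inv, div_le_iff₀ h5]
        exact h4
    · have hna : ∀ᵐ t : ℝ, t ≠ a := by simp [ae_iff, measure_singleton]
      filter_upwards [hna] with t hta
      have hlim : Tendsto (fun z : ℂ => (z - a) * ((p t : ℂ) * ((t : ℂ) - z)⁻¹))
          (𝓝[{z | 0 < z.im}] (a : ℂ)) (𝓝 0) := by
        have hta' : (t : ℂ) - a ≠ 0 := by
          rw [← Complex.ofReal_sub]
          exact_mod_cast sub_ne_zero.2 hta
        have hc : ContinuousAt (fun z : ℂ => (z - a) * ((p t : ℂ) * ((t : ℂ) - z)⁻¹)) (a : ℂ) :=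
          ContinuousAt.mul (by fun_prop) (continuousAt_const.mul
            (ContinuousAt.inv₀ (by fun_prop) hta'))
        have := hc.tendsto
        rw [sub_self, zero_mul] at this
        exact this.mono_left nhdsWithin_le_nhds
      refine squeeze_zero_norm (fun z => norm_indicator_le_norm_self _ _) ?_
      simpa using hlim.norm
  have hnear : Tendsto (fun z : ℂ => ∫ t in J z, (z - a) * ((p t : ℂ) * ((t : ℂ) - z)⁻¹))
      (𝓝[{z | 0 < z.im}] (a : ℂ)) (𝓝 0) := by
    rw [Metric.tendsto_nhdsWithin_nhds]
    intro ε hε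
    -- The factor `|z - a| ≤ 2|ξ|` times `400 (ε/1600)/|ξ|` leaves `ε/2`.
    obtain ⟨δ, hδ, H⟩ := hq (ε / 1600) (by positivity)
    refine ⟨δ, hδ, fun z hz hzd => ?_⟩
    have hz' : 0 < z.im := hz
    rw [dist_zero_right]
    rw [dist_eq_norm] at hzd
    rcases le_or_gt (|z.re - a|) z.im with hcase | hcase
    · have : J z = ∅ := by
        rw [hJ]; simp only; rw [Ioo_eq_empty]; intro h; linarith
      simp [this, hε]
    · set ξ := z.re - a with hξ
      set h := (|ξ| - z.im) / 2 with hh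
      have hh0 : 0 < h := by rw [hh]; linarith
      have hξ0 : ξ ≠ 0 := by
        intro h; rw [h, abs_zero] at hcase; linarith
      have hξp : 0 < |ξ| := abs_pos.2 hξ0
      have hξδ : |ξ| < δ := by
        have := Complex.abs_re_le_norm (z - a)
        simp only [Complex.sub_re, Complex.ofReal_re] at this
        linarith
      have key := norm_local_cauchy_le (a := a) (ξ := ξ) (η := z.im) (ε := ε / 1600) (h := h) hp h0
        hz' (by positivity) hh0.le (by rw [hh]; linarith) hξ0
        (fun s t hs ht => H |ξ| hξp hξδ s t hs ht)
      have hz_eq : z = (z.re : ℂ) + z.im * Complex.I := (Complex.re_add_im z).symm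
      have e1 : ∫ t in J z, (z - a) * ((p t : ℂ) * ((t : ℂ) - z)⁻¹) =
          (z - a) * ∫ u in (-h)..h, (p (a + ξ + u) : ℂ) * ((u : ℂ) - z.im * Complex.I)⁻¹ := by
        rw [integral_const_mul, ← integral_Ioc_eq_integral_Ioo,
          ← intervalIntegral.integral_of_le (by linarith)]
        congr 1
        have := intervalIntegral.integral_comp_add_left
          (fun t : ℝ => (p t : ℂ) * ((t : ℂ) - z)⁻¹) (a := -h) (b := h) z.re
        rw [← sub_eq_add_neg] at this
        rw [← this]
        refine intervalIntegral.integral_congr fun u _ => ?_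
        have e2 : a + ξ + u = z.re + u := by rw [hξ]; ring
        have e3 : ((z.re + u : ℝ) : ℂ) - z = (u : ℂ) - z.im * Complex.I := by
          push_cast
          linear_combination -hz_eq
        rw [e2, e3]
      rw [e1, norm_mul]
      have h2 : ‖z - a‖ ≤ 2 * |ξ| := by linarith [hnorm_le z hz']
      calc ‖z - a‖ * _ ≤ 2 * |ξ| * (400 * (ε / 1600) / |ξ|) := by gcongr
        _ = ε / 2 := by field_simp; norm_num
        _ < ε := by linarith
  have hsum := hnear.add hfar
  rw [add_zero] at hsum
  refine hsum.congr' ?_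
  filter_upwards [self_mem_nhdsWithin] with z hz
  rw [integral_indicator measurableSet_Ioo.compl, integral_add_compl measurableSet_Ioo
    ((hint z hz).const_mul _), integral_const_mul]

end LocalCauchy

end RankOneScattering

end

noncomputable section

namespace RankOneScattering

/-! ### Resolvent identity and the density `|W|²/(t² - a²)²`. -/

section Resolvent

/-- The resolvent identity for the Stieltjes transform, with a real reference point `c`. -/
theorem stieltjes_eq_add_mul {ω : ℝ → ℝ} (hω : Integrable ω) {c : ℝ}
    (hc : Integrable fun t => ω t / (t ^ 2 - c)) (hne : ∀ᵐ t : ℝ, t ^ 2 - c ≠ 0)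
    {z : ℂ} (hz : 0 < z.im) :
    stieltjes ω z = ((∫ t, ω t / (t ^ 2 - c) : ℝ) : ℂ) +
      (z ^ 2 - c) * stieltjes (fun t => ω t / (t ^ 2 - c)) z := by
  have h1 := integrable_stieltjes hω hz
  have h2 : Integrable fun t : ℝ => ((ω t / (t ^ 2 - c) : ℝ) : ℂ) := hc.ofReal
  rw [← sub_eq_iff_eq_add', stieltjes, ← integral_complex_ofReal, ← integral_sub h1 h2, stieltjes,
    ← integral_const_mul]
  refine integral_congr_ae ?_
  filter_upwards [hne] with t ht
  have hz' := sq_sub_sq_ne_zero hz t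
  have ht' : (t : ℂ) ^ 2 - c ≠ 0 := by exact_mod_cast ht
  push_cast
  field_simp
  ring

theorem ae_sq_sub_ne_zero (c : ℝ) : ∀ᵐ t : ℝ, t ^ 2 - c ≠ 0 := by
  have hs : {t : ℝ | t ^ 2 - c = 0} ⊆ {√c, -√c} := by
    intro t ht
    have ht' : t ^ 2 = c := sub_eq_zero.1 ht
    have : |t| = √c := by rw [← ht', Real.sqrt_sq_eq_abs]
    rcases abs_choice t with h | h
    · left; rw [← this, h]
    · right; simp only [mem_singleton_iff]; rw [← this, h, neg_neg]
  rw [ae_iff]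
  simp only [ne_eq, not_not]
  exact measure_mono_null hs ((Set.toFinite _).measure_zero _)

/-- Partial fractions `2z/(t² - z²) = 1/(t - z) - 1/(t + z)`; for an even density both fractions
contribute equally. -/
theorem mul_stieltjes_of_even {p : ℝ → ℝ} (hp : Integrable p) (heven : ∀ t, p (-t) = p t)
    {z : ℂ} (hz : 0 < z.im) :
    z * stieltjes p z = ∫ t : ℝ, (p t : ℂ) * ((t : ℂ) - z)⁻¹ := by
  have hne : ∀ t : ℝ, (t : ℂ) - z ≠ 0 := by
    intro t h
    have := congrArg Complex.im h
    simp at this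
    linarith
  have hne' : ∀ t : ℝ, (t : ℂ) + z ≠ 0 := by
    intro t h
    have := congrArg Complex.im h
    simp at this
    linarith
  have hint : Integrable fun t : ℝ => (p t : ℂ) * ((t : ℂ) - z)⁻¹ := by
    refine hp.ofReal.mul_bdd (c := z.im⁻¹)
      (Continuous.inv₀ (by fun_prop) hne).aestronglyMeasurable (Eventually.of_forall fun t => ?_)
    rw [norm_inv]
    refine inv_anti₀ hz ?_
    have := Complex.abs_im_le_norm ((t : ℂ) - z)
    simpa [abs_of_pos hz] using this
  have e1 : ∫ t : ℝ, (p t : ℂ) * ((t : ℂ) - z)⁻¹ = -∫ t : ℝ, (p t : ℂ) * ((t : ℂ) + z)⁻¹ := by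
    rw [← integral_neg_eq_self, ← integral_neg]
    congr 1; ext t
    rw [heven, Complex.ofReal_neg, ← neg_add', inv_neg, mul_neg]
  have hint' : Integrable fun t : ℝ => (p t : ℂ) * ((t : ℂ) + z)⁻¹ := by
    refine (hint.comp_neg.neg).congr (Eventually.of_forall fun t => ?_)
    simp only [Pi.neg_apply]
    rw [heven, Complex.ofReal_neg, ← neg_add', inv_neg, mul_neg, neg_neg]
  have e2 : (∫ t : ℝ, (p t : ℂ) * ((t : ℂ) - z)⁻¹) - (∫ t : ℝ, (p t : ℂ) * ((t : ℂ) + z)⁻¹) =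
      2 * (z * stieltjes p z) := by
    rw [← integral_sub hint hint', stieltjes, ← integral_const_mul, ← integral_const_mul]
    congr 1; ext t
    have h1 := hne t
    have h2 := hne' t
    have h3 : (t : ℂ) ^ 2 - z ^ 2 = (t - z) * (t + z) := by ring
    rw [h3]
    field_simp
    ring
  linear_combination -(1 / 2 : ℂ) * e2 - (1 / 2 : ℂ) * e1

/-- Transfers the Hölder bound for `W` near its zero `a` to `|W|²/(x + a)²`. The quotients `A/(t +
a)` and `B/(s + a)` have size `O(√ρ)` and differ by `O(m)`; the difference of squares is the product
of sum and difference. The point `-a` stays away because `ρ ≤ |a|/4`. -/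
theorem abs_sq_div_sub_le {A B : ℂ} {s t a e m ρ : ℝ} (ha : a ≠ 0) (he : 0 ≤ e) (hρ : 0 < ρ)
    (hρa : ρ ≤ |a| / 4) (hs : |s - a| ≤ 2 * ρ) (ht : |t - a| ≤ 2 * ρ) (hm0 : 0 ≤ m)
    (hm : m ^ 2 = |t - s|) (hA : ‖A‖ ≤ e * √|t - a|) (hB : ‖B‖ ≤ e * √|s - a|)
    (hAB : ‖A - B‖ ≤ e * m) :
    |‖A‖ ^ 2 / (t + a) ^ 2 - ‖B‖ ^ 2 / (s + a) ^ 2| ≤ 8 * e ^ 2 / a ^ 2 * (m * √ρ) := by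
  have hap : 0 < |a| := abs_pos.2 ha
  set k := √ρ with hk
  have hk0 : 0 < k := Real.sqrt_pos.2 hρ
  have hk2 : k ^ 2 = ρ := Real.sq_sqrt hρ.le
  have hle : ∀ x : ℝ, |x - a| ≤ 2 * ρ → |a| ≤ |x + a| := by
    intro x hx
    have h1 : |2 * a| ≤ |x + a| + |x - a| := by
      have := abs_sub (x + a) (x - a)
      rwa [show x + a - (x - a) = 2 * a by ring] at this
    rw [abs_mul, abs_two] at h1
    linarith
  have hsq : ∀ x : ℝ, |x - a| ≤ 2 * ρ → √|x - a| ≤ 2 * k := by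
    intro x hx
    apply Real.sqrt_le_iff.2 ⟨by positivity, ?_⟩
    rw [mul_pow, hk2]; linarith
  have hT := hle t ht
  have hS := hle s hs
  have hT0 : 0 < |t + a| := by linarith
  have hS0 : 0 < |s + a| := by linarith
  have hTne : ((t + a : ℝ) : ℂ) ≠ 0 := by exact_mod_cast abs_pos.1 hT0
  have hSne : ((s + a : ℝ) : ℂ) ≠ 0 := by exact_mod_cast abs_pos.1 hS0
  have hm4 : m ≤ 2 * k := by
    refine abs_le_of_sq_le_sq' ?_ (by positivity) |>.2
    rw [hm, mul_pow, hk2]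
    have := abs_sub_le t a s
    rw [abs_sub_comm a s] at this
    linarith
  have hG : ∀ (C : ℂ) (x : ℝ), ‖C / ((x + a : ℝ) : ℂ)‖ ^ 2 = ‖C‖ ^ 2 / (x + a) ^ 2 := by
    intro C x
    rw [norm_div, div_pow, Complex.norm_real, Real.norm_eq_abs, sq_abs]
  have hGb : ∀ (C : ℂ) (x : ℝ), |x - a| ≤ 2 * ρ → ‖C‖ ≤ e * √|x - a| →
      ‖C / ((x + a : ℝ) : ℂ)‖ ≤ 2 * e * k / |a| := by
    intro C x hx hC
    rw [norm_div, Complex.norm_real, Real.norm_eq_abs]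
    have := hsq x hx
    apply div_le_div₀ (by positivity) _ hap (hle x hx)
    nlinarith
  have hd : A / ((t + a : ℝ) : ℂ) - B / ((s + a : ℝ) : ℂ) =
      (A - B) / ((t + a : ℝ) : ℂ) +
        B / ((s + a : ℝ) : ℂ) * (((s - t : ℝ) : ℂ) / ((t + a : ℝ) : ℂ)) := by
    field_simp
    push_cast
    ring
  have hdn : ‖A / ((t + a : ℝ) : ℂ) - B / ((s + a : ℝ) : ℂ)‖ ≤ 2 * e * m / |a| := by
    rw [hd]
    refine (norm_add_le _ _).trans ?_
    have b1 : ‖(A - B) / ((t + a : ℝ) : ℂ)‖ ≤ e * m / |a| := by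
      rw [norm_div, Complex.norm_real, Real.norm_eq_abs]
      exact div_le_div₀ (by positivity) hAB hap hT
    have b2 : ‖B / ((s + a : ℝ) : ℂ) * (((s - t : ℝ) : ℂ) / ((t + a : ℝ) : ℂ))‖ ≤ e * m / |a| := by
      rw [norm_mul]
      have c1 := hGb B s hs hB
      have c2 : ‖((s - t : ℝ) : ℂ) / ((t + a : ℝ) : ℂ)‖ ≤ m * (2 * k) / |a| := by
        rw [norm_div, Complex.norm_real, Complex.norm_real, Real.norm_eq_abs, Real.norm_eq_abs,
          abs_sub_comm, ← hm]
        refine div_le_div₀ (by positivity) ?_ hap hT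
        rw [sq]; gcongr
      calc _ ≤ (2 * e * k / |a|) * (m * (2 * k) / |a|) := by gcongr
        _ = e * m / |a| * (4 * ρ / |a|) := by rw [← hk2]; field_simp; ring
        _ ≤ e * m / |a| * 1 := by
            gcongr
            rw [div_le_one hap]; linarith
        _ = _ := mul_one _
    calc _ ≤ e * m / |a| + e * m / |a| := add_le_add b1 b2
      _ = _ := by ring
  rw [← hG, ← hG, sq_sub_sq, abs_mul]
  have n1 := hGb A t ht hA
  have n2 := hGb B s hs hB
  have n3 := abs_norm_sub_norm_le (A / ((t + a : ℝ) : ℂ)) (B / ((s + a : ℝ) : ℂ))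
  calc _ ≤ (2 * e * k / |a| + 2 * e * k / |a|) * (2 * e * m / |a|) := by
        gcongr
        · rw [abs_of_nonneg (by positivity)]; linarith
        · linarith
    _ = 8 * e ^ 2 / |a| ^ 2 * (m * k) := by field_simp; ring
    _ = _ := by rw [sq_abs]

/-- The density of `‖W‖²` with the double zeros at `±a` divided out. -/
def reducedDensity (v : ℝ → ℂ) (a t : ℝ) : ℝ := ‖W v t‖ ^ 2 / (t ^ 2 - a ^ 2) / (t ^ 2 - a ^ 2)

theorem reducedDensity_nonneg (v : ℝ → ℂ) (a t : ℝ) : 0 ≤ reducedDensity v a t := by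
  rw [reducedDensity, div_div]
  exact div_nonneg (by positivity) (mul_self_nonneg _)

theorem reducedDensity_neg (v : ℝ → ℂ) (a t : ℝ) :
    reducedDensity v a (-t) = reducedDensity v a t := by
  simp [reducedDensity, W_neg]

theorem aestronglyMeasurable_normSq_W_div {v : ℝ → ℂ} (hv : Admissible v) (c : ℝ) :
    AEStronglyMeasurable (fun t => ‖W v t‖ ^ 2 / (t ^ 2 - c)) :=
  (((continuous_W hv).norm.pow 2).measurable.div
    (by fun_prop : Measurable fun t : ℝ => t ^ 2 - c)).aestronglyMeasurable

/-- Hardy's inequality applies at both zeros `±a`, and `(t - a)² + (t + a)² ≥ 2a²` bounds the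
product of the two weights by their sum. -/
theorem integrable_reducedDensity {v : ℝ → ℂ} (hv : Admissible v) {a : ℝ} (ha : a ≠ 0)
    (hW : W v a = 0) : Integrable (reducedDensity v a) := by
  have h1 : Integrable (fun t => ‖W v t‖ ^ 2 / (t - a) ^ 2) := by
    have := hardy hv.integrable_oddExt hv.integrable_weight_oddExt (a := a)
      (by rw [← W_eq_ft hv]; exact hW)
    simpa only [W_eq_ft hv] using this
  have h2 : Integrable (fun t => ‖W v t‖ ^ 2 / (t - -a) ^ 2) := by
    have := hardy hv.integrable_oddExt hv.integrable_weight_oddExt (a := -a)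
      (by rw [← W_eq_ft hv, W_neg, hW, neg_zero])
    simpa only [W_eq_ft hv] using this
  refine ((h1.add h2).const_mul (1 / (2 * a ^ 2))).mono' ?_ ?_
  · exact ((((continuous_W hv).norm.pow 2).measurable.div
      (by fun_prop : Measurable fun t : ℝ => t ^ 2 - a ^ 2)).div
      (by fun_prop : Measurable fun t : ℝ => t ^ 2 - a ^ 2)).aestronglyMeasurable
  · filter_upwards [ae_sq_sub_ne_zero (a ^ 2)] with t ht
    rw [Real.norm_of_nonneg (reducedDensity_nonneg v a t), reducedDensity]
    have e : t ^ 2 - a ^ 2 = (t - a) * (t + a) := by ring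
    rw [e] at ht ⊢
    have t1 := left_ne_zero_of_mul ht
    have t2 := right_ne_zero_of_mul ht
    have p1 : 0 < (t - a) ^ 2 := sq_pos_iff.2 t1
    have p2 : 0 < (t + a) ^ 2 := sq_pos_iff.2 t2
    simp only [Pi.add_apply, sub_neg_eq_add]
    rw [div_div, show (t - a) * (t + a) * ((t - a) * (t + a)) = (t - a) ^ 2 * (t + a) ^ 2 by ring,
      div_add_div _ _ p1.ne' p2.ne', ← mul_div_assoc, div_le_div_iff_of_pos_right (mul_pos p1 p2)]
    have key : ‖W v t‖ ^ 2 * (2 * a ^ 2) ≤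
        ‖W v t‖ ^ 2 * (t + a) ^ 2 + (t - a) ^ 2 * ‖W v t‖ ^ 2 := by
      nlinarith [mul_nonneg (sq_nonneg ‖W v t‖) (sq_nonneg t)]
    have : 1 / (2 * a ^ 2) * (‖W v t‖ ^ 2 * (t + a) ^ 2 + (t - a) ^ 2 * ‖W v t‖ ^ 2) ≥
        ‖W v t‖ ^ 2 := by
      rw [ge_iff_le, div_mul_eq_mul_div, one_mul, le_div_iff₀ (by positivity)]
      exact key
    exact this

theorem integrable_normSq_W_div {v : ℝ → ℂ} (hv : Admissible v) {a : ℝ} (ha : a ≠ 0)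
    (hW : W v a = 0) : Integrable fun t => ‖W v t‖ ^ 2 / (t ^ 2 - a ^ 2) := by
  refine ((W_plancherel hv).1.add (integrable_reducedDensity hv ha hW)).mono'
    (aestronglyMeasurable_normSq_W_div hv _) ?_
  filter_upwards [ae_sq_sub_ne_zero (a ^ 2)] with t ht
  simp only [Pi.add_apply, reducedDensity]
  rw [Real.norm_eq_abs, abs_div, abs_of_nonneg (by positivity : 0 ≤ ‖W v t‖ ^ 2), div_div,
    ← abs_mul_abs_self (t ^ 2 - a ^ 2)]
  have hd : 0 < |t ^ 2 - a ^ 2| := abs_pos.2 ht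
  set d := |t ^ 2 - a ^ 2|
  have hN := sq_nonneg ‖W v t‖
  rw [← sub_nonneg]
  have e : ‖W v t‖ ^ 2 + ‖W v t‖ ^ 2 / (d * d) - ‖W v t‖ ^ 2 / d =
      ‖W v t‖ ^ 2 * ((1 / d - 1 / 2) ^ 2 + 3 / 4) := by
    field_simp
    ring
  rw [e]
  positivity

/-- By evenness the expression is `(z + a)/z` times `(z - a)` times a Cauchy integral, to which
`tendsto_mul_cauchy` applies. -/
theorem tendsto_mul_stieltjes_reducedDensity {v : ℝ → ℂ} (hv : Admissible v) {a : ℝ} (ha : a ≠ 0)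
    (hW : W v a = 0) :
    Tendsto (fun z : ℂ => (z ^ 2 - ((a ^ 2 : ℝ) : ℂ)) * stieltjes (reducedDensity v a) z)
      (𝓝[{z | 0 < z.im}] (a : ℂ)) (𝓝 0) := by
  have hp := integrable_reducedDensity hv ha hW
  have hap : 0 < |a| := abs_pos.2 ha
  have h := tendsto_mul_cauchy (a := a) hp (reducedDensity_nonneg v a) (by
    intro ε hε
    -- The constant is chosen so that `8e²/a²` in `abs_sq_div_sub_le` becomes exactly `ε`.
    obtain ⟨δ, hδ, H⟩ := ft_little_holder hv.integrable_oddExt hv.integrable_weight_oddExt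
      (ε := |a| * √(ε / 8)) (by positivity)
    simp only [← W_eq_ft hv] at H
    refine ⟨min (δ / 4) (|a| / 4), by positivity, fun ρ hρ hρδ s t hs ht => ?_⟩
    have hρ1 := hρδ.trans_le (min_le_left _ _)
    have hρ2 := hρδ.trans_le (min_le_right _ _)
    have hts : |t - s| < δ := by
      have := abs_sub_le t a s
      rw [abs_sub_comm a s] at this
      linarith
    have hred : ∀ x : ℝ, |x - a| ≤ 2 * ρ →
        reducedDensity v a x * (x - a) ^ 2 = ‖W v x‖ ^ 2 / (x + a) ^ 2 := by
      intro x hx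
      rcases eq_or_ne x a with rfl | hxa
      · simp [hW]
      · have hxa' : x + a ≠ 0 := by
          intro h
          have : x = -a := by linarith
          rw [this, show -a - a = -(2 * a) by ring, abs_neg, abs_mul, abs_two] at hx
          linarith
        have := sub_ne_zero.2 hxa
        rw [reducedDensity, show x ^ 2 - a ^ 2 = (x - a) * (x + a) by ring]
        field_simp
    rw [hred t ht, hred s hs]
    have hb : ∀ x : ℝ, |x - a| ≤ 2 * ρ → ‖W v x‖ ≤ |a| * √(ε / 8) * √|x - a| := by
      intro x hx
      have := H a x (by linarith)
      rwa [hW, sub_zero] at this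
    refine (abs_sq_div_sub_le ha (by positivity) hρ hρ2.le hs ht (Real.sqrt_nonneg _)
      (Real.sq_sqrt (abs_nonneg _)) (hb t ht) (hb s hs) (H s t hts)).trans_eq ?_
    rw [mul_pow, Real.sq_sqrt (by positivity), sq_abs]
    field_simp)
  have h2 : Tendsto (fun z : ℂ => (z + a) / z) (𝓝[{z | 0 < z.im}] (a : ℂ)) (𝓝 ((a + a) / a)) := by
    refine Tendsto.mono_left ?_ nhdsWithin_le_nhds
    exact ContinuousAt.div (by fun_prop) continuousAt_id (by exact_mod_cast ha)
  have h3 := h2.mul h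
  rw [mul_zero] at h3
  refine h3.congr' ?_
  filter_upwards [self_mem_nhdsWithin] with z hz
  have hz0 : z ≠ 0 := by rintro rfl; simp at hz
  rw [← mul_stieltjes_of_even hp (reducedDensity_neg v a) hz]
  push_cast
  field_simp
  ring

end Resolvent

end RankOneScattering

end

noncomputable section

namespace RankOneScattering

/-! ### The determinant with its zero at `iκ` divided out. -/

section DenominatorFunction

variable {v : ℝ → ℂ} {α κ : ℝ}

theorem r_eq_mul_stieltjes (hv : Admissible v) (hα : α ≠ 0) {z : ℂ} (hz : 0 < z.im) :
    r v α z = -(2 * Complex.I * z / α) *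
      (1 + α / (4 * Real.pi) * stieltjes (fun t => ‖W v t‖ ^ 2) z) := by
  have hα' : (α : ℂ) ≠ 0 := by exact_mod_cast hα
  have hpi : (Real.pi : ℂ) ≠ 0 := by exact_mod_cast Real.pi_ne_zero
  rw [r_eq_greenForm hv α hz.le, greenForm_eq_integral hv hz, stieltjes]
  field_simp
  ring

/-- The density `|W(t)|² / (t² + κ²)`. -/
def poissonDensity (v : ℝ → ℂ) (κ t : ℝ) : ℝ := ‖W v t‖ ^ 2 / (t ^ 2 - -κ ^ 2)

theorem poissonDensity_nonneg (v : ℝ → ℂ) (κ t : ℝ) : 0 ≤ poissonDensity v κ t := by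
  rw [poissonDensity, sub_neg_eq_add]; positivity

theorem integrable_poissonDensity (hv : Admissible v) (hκ : 0 < κ) :
    Integrable (poissonDensity v κ) := by
  refine ((W_plancherel hv).1.mul_const (κ ^ 2)⁻¹).mono'
    (aestronglyMeasurable_normSq_W_div hv _) (Eventually.of_forall fun t => ?_)
  rw [Real.norm_of_nonneg (poissonDensity_nonneg v κ t), poissonDensity, sub_neg_eq_add, div_eq_mul_inv]
  have : (t ^ 2 + κ ^ 2)⁻¹ ≤ (κ ^ 2)⁻¹ := inv_anti₀ (by positivity) (by nlinarith [sq_nonneg t])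
  gcongr

theorem one_add_integral_poissonDensity (hv : Admissible v) (hα : α ≠ 0) (hκ : 0 < κ)
    (hrκ : r v α (Complex.I * κ) = 0) :
    1 + α / (4 * Real.pi) * ∫ t, poissonDensity v κ t = 0 := by
  have hz : 0 < (Complex.I * κ).im := by simpa using hκ
  have hα' : (α : ℂ) ≠ 0 := by exact_mod_cast hα
  have hκ' : (κ : ℂ) ≠ 0 := by exact_mod_cast hκ.ne'
  rw [r_eq_mul_stieltjes hv hα hz, mul_eq_zero] at hrκ
  have h := hrκ.resolve_left (by
    rw [neg_eq_zero]
    exact div_ne_zero (mul_ne_zero (mul_ne_zero two_ne_zero Complex.I_ne_zero)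
      (mul_ne_zero Complex.I_ne_zero hκ')) hα')
  have e : stieltjes (fun t => ‖W v t‖ ^ 2) (Complex.I * κ) =
      ((∫ t, poissonDensity v κ t : ℝ) : ℂ) := by
    rw [stieltjes, ← integral_complex_ofReal]
    congr 1; ext t
    rw [poissonDensity, mul_pow, Complex.I_sq]
    push_cast
    rw [div_eq_mul_inv, neg_one_mul]
  rw [e] at h
  exact_mod_cast h

/-- The vanishing of the determinant at `iκ` forces the integral to equal `-4π/α`. In particular `W`
is not zero almost everywhere. -/
theorem integral_poissonDensity_pos (hv : Admissible v) (hα : α < 0) (hκ : 0 < κ)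
    (hrκ : r v α (Complex.I * κ) = 0) : 0 < ∫ t, poissonDensity v κ t := by
  have h := one_add_integral_poissonDensity hv hα.ne hκ hrκ
  by_contra hcon
  have h1 : 0 ≤ α / (4 * Real.pi) * ∫ t, poissonDensity v κ t :=
    mul_nonneg_of_nonpos_of_nonpos (div_nonpos_of_nonpos_of_nonneg hα.le (by positivity))
      (not_lt.1 hcon)
  linarith

/-- The function `z² (1 + α/(4π) ∫ |W|²/(t² - z²)) / (z² + κ²)`, with the zero of the numerator
at `iκ` divided out. -/
def reducedDet (v : ℝ → ℂ) (α κ : ℝ) (z : ℂ) : ℂ :=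
  ((-(α / (4 * Real.pi)) : ℝ) : ℂ) * -(z ^ 2 * stieltjes (poissonDensity v κ) z)

/-- In the resolvent identity with reference point `-κ²`, the constant term cancels the `1` exactly
because `iκ` is a zero. -/
theorem one_add_stieltjes_eq (hv : Admissible v) (hα : α ≠ 0) (hκ : 0 < κ)
    (hrκ : r v α (Complex.I * κ) = 0) {z : ℂ} (hz : 0 < z.im) :
    1 + α / (4 * Real.pi) * stieltjes (fun t => ‖W v t‖ ^ 2) z =
      α / (4 * Real.pi) * ((z ^ 2 + κ ^ 2) * stieltjes (poissonDensity v κ) z) := by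
  have h : (1 : ℂ) + α / (4 * Real.pi) * ((∫ t, poissonDensity v κ t : ℝ) : ℂ) = 0 := by
    exact_mod_cast one_add_integral_poissonDensity hv hα hκ hrκ
  have h2 := stieltjes_eq_add_mul (W_plancherel hv).1 (c := -κ ^ 2)
    (integrable_poissonDensity hv hκ) (ae_sq_sub_ne_zero _) hz
  have e : (fun t => ‖W v t‖ ^ 2 / (t ^ 2 - -κ ^ 2)) = poissonDensity v κ := rfl
  rw [h2]
  simp only [e]
  push_cast
  linear_combination h

theorem sq_add_mul_reducedDet (hv : Admissible v) (hα : α ≠ 0) (hκ : 0 < κ)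
    (hrκ : r v α (Complex.I * κ) = 0) {z : ℂ} (hz : 0 < z.im) :
    (z ^ 2 + κ ^ 2) * reducedDet v α κ z =
      z ^ 2 * (1 + α / (4 * Real.pi) * stieltjes (fun t => ‖W v t‖ ^ 2) z) := by
  rw [one_add_stieltjes_eq hv hα hκ hrκ hz, reducedDet]
  push_cast
  ring

theorem two_mul_sq_add_mul_reducedDet (hv : Admissible v) (hα : α ≠ 0) (hκ : 0 < κ)
    (hrκ : r v α (Complex.I * κ) = 0) {z : ℂ} (hz : 0 < z.im) :
    2 * (z ^ 2 + κ ^ 2) * reducedDet v α κ z = Complex.I * α * z * r v α z := by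
  have hα' : (α : ℂ) ≠ 0 := by exact_mod_cast hα
  rw [mul_assoc, sq_add_mul_reducedDet hv hα hκ hrκ hz, r_eq_mul_stieltjes hv hα hz]
  field_simp
  rw [Complex.I_sq]
  ring

theorem reducedDet_mem_slitPlane (hv : Admissible v) (hα : α < 0) (hκ : 0 < κ)
    (hrκ : r v α (Complex.I * κ) = 0) {z : ℂ} (hz : 0 < z.im) :
    reducedDet v α κ z ∈ Complex.slitPlane := by
  have h := neg_sq_mul_stieltjes_mem_slitPlane (integrable_poissonDensity hv hκ)
    (poissonDensity_nonneg v κ) (integral_poissonDensity_pos hv hα hκ hrκ) hz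
  have hc : 0 < -(α / (4 * Real.pi)) := neg_pos.2 (div_neg_of_neg_of_pos hα (by positivity))
  rw [reducedDet]
  rw [Complex.mem_slitPlane_iff] at h ⊢
  rw [Complex.re_ofReal_mul, Complex.im_ofReal_mul]
  exact h.imp (fun h => mul_pos hc h) (fun h => mul_ne_zero hc.ne' h)

theorem differentiableOn_reducedDet (hv : Admissible v) (hκ : 0 < κ) :
    DifferentiableOn ℂ (reducedDet v α κ) {z | 0 < z.im} :=
  ((((differentiable_id.pow 2).differentiableOn).mul
    (differentiableOn_stieltjes (integrable_poissonDensity hv hκ))).neg).const_mul _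

theorem reducedDet_neg_conj (z : ℂ) :
    reducedDet v α κ (-starRingEnd ℂ z) = starRingEnd ℂ (reducedDet v α κ z) := by
  rw [reducedDet, reducedDet, stieltjes_neg_conj, map_mul, map_neg, map_mul, map_pow,
    Complex.conj_ofReal, neg_sq]

theorem continuousOn_r (hv : Admissible v) : ContinuousOn (r v α) {z | 0 ≤ z.im} := by
  have h : ContinuousOn (fun z => greenForm v z - 2 * Complex.I * z / α) {z | 0 ≤ z.im} :=
    (continuousOn_greenForm hv).sub (by fun_prop)
  exact h.congr fun z hz => r_eq_greenForm hv α hz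

theorem tendsto_r (hv : Admissible v) (x : ℝ) :
    Tendsto (r v α) (𝓝[{z | 0 < z.im}] (x : ℂ)) (𝓝 (r v α x)) :=
  ((continuousOn_r hv) x (by simp)).mono_left
    (nhdsWithin_mono _ fun z (hz : 0 < z.im) => hz.le)

theorem tendsto_reducedDet (hv : Admissible v) (hα : α ≠ 0) (hκ : 0 < κ)
    (hrκ : r v α (Complex.I * κ) = 0) (x : ℝ) :
    Tendsto (reducedDet v α κ) (𝓝[{z | 0 < z.im}] (x : ℂ))
      (𝓝 (Complex.I * α * x * r v α x / (2 * ((x : ℂ) ^ 2 + κ ^ 2)))) := by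
  have hx : (2 : ℂ) * ((x : ℂ) ^ 2 + κ ^ 2) ≠ 0 := by
    have : (2 : ℝ) * (x ^ 2 + κ ^ 2) ≠ 0 := by positivity
    exact_mod_cast this
  have hden : Tendsto (fun z : ℂ => 2 * (z ^ 2 + κ ^ 2)) (𝓝[{z | 0 < z.im}] (x : ℂ))
      (𝓝 (2 * ((x : ℂ) ^ 2 + κ ^ 2))) :=
    (Continuous.tendsto (by fun_prop : Continuous fun z : ℂ => 2 * (z ^ 2 + (κ : ℂ) ^ 2))
      _).mono_left nhdsWithin_le_nhds
  have hnum : Tendsto (fun z : ℂ => Complex.I * α * z * r v α z) (𝓝[{z | 0 < z.im}] (x : ℂ))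
      (𝓝 (Complex.I * α * x * r v α x)) :=
    ((Continuous.tendsto (by fun_prop : Continuous fun z : ℂ => Complex.I * α * z)
      _).mono_left nhdsWithin_le_nhds).mul (tendsto_r hv x)
  refine (hnum.div hden hx).congr' ?_
  filter_upwards [self_mem_nhdsWithin, hden.eventually_ne hx] with z hz hne
  simp only [Pi.div_apply]
  rw [← two_mul_sq_add_mul_reducedDet hv hα hκ hrκ hz, mul_div_cancel_left₀ _ hne]

theorem W_eq_zero_of_r_eq_zero (hv : Admissible v) {x : ℝ} (hr : r v α x = 0) : W v x = 0 := by
  have h := two_re_r hv α x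
  rw [hr] at h
  simpa using h.symm

theorem eventually_sq_sub_ne_zero (a : ℝ) (l : Filter ℂ) (hl : l ≤ 𝓟 {z : ℂ | 0 < z.im}) :
    ∀ᶠ z in l, z ^ 2 - (a : ℂ) ^ 2 ≠ 0 := by
  filter_upwards [hl (mem_principal_self _)] with z hz
  have := sq_sub_sq_ne_zero hz a
  rw [← neg_sub]
  exact neg_ne_zero.2 this

/-- Two applications of the resolvent identity at `a²` give `m1 + (z² - a²)(m2 + (z² -
a²)·(transform of the reduced density))`. The zero of `r` at `a` cancels `1` against `m1`, the
remainder vanishes in the limit, and `m2 > 0` makes the zero simple. -/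
theorem tendsto_reducedDet_mul (hv : Admissible v) (hα : α < 0) (hκ : 0 < κ)
    (hrκ : r v α (Complex.I * κ) = 0) {a : ℝ} (ha : a ≠ 0) (hra : r v α a = 0) :
    ∃ c : ℂ, c ≠ 0 ∧ Tendsto (fun z => reducedDet v α κ z * (z ^ 2 / (z ^ 2 - (a : ℂ) ^ 2)))
      (𝓝[{z | 0 < z.im}] (a : ℂ)) (𝓝 c) := by
  have hW := W_eq_zero_of_r_eq_zero hv hra
  have hi1 := integrable_normSq_W_div hv ha hW
  have hi2 := integrable_reducedDensity hv ha hW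
  have haC : (a : ℂ) ≠ 0 := by exact_mod_cast ha
  have hαC : (α : ℂ) ≠ 0 := by exact_mod_cast hα.ne
  have hpi : (Real.pi : ℂ) ≠ 0 := by exact_mod_cast Real.pi_ne_zero
  set m1 := ∫ t, ‖W v t‖ ^ 2 / (t ^ 2 - a ^ 2) with hm1
  set m2 := ∫ t, reducedDensity v a t with hm2
  -- Off the null set `t² = a²` the reduced density vanishes only where `W` does, so positivity is
  -- inherited from `poissonDensity`.
  have hm2pos : 0 < m2 := by
    rw [hm2, integral_pos_iff_support_of_nonneg (reducedDensity_nonneg v a) hi2]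
    have h1 := (integral_pos_iff_support_of_nonneg (poissonDensity_nonneg v κ)
      (integrable_poissonDensity hv hκ)).1 (integral_poissonDensity_pos hv hα hκ hrκ)
    refine h1.trans_le (measure_mono_ae ?_)
    filter_upwards [ae_sq_sub_ne_zero (a ^ 2)] with t ht h2
    have hWt : ‖W v t‖ ^ 2 ≠ 0 := by
      intro h
      apply h2
      rw [poissonDensity, h, zero_div]
    exact div_ne_zero (div_ne_zero hWt ht) ht
  have hT := tendsto_mul_stieltjes_reducedDensity hv ha hW
  have hsub : Tendsto (fun z : ℂ => z ^ 2 - ((a ^ 2 : ℝ) : ℂ)) (𝓝[{z | 0 < z.im}] (a : ℂ))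
      (𝓝 0) := by
    have h := (Continuous.tendsto (by fun_prop : Continuous fun z : ℂ => z ^ 2 - ((a ^ 2 : ℝ) : ℂ))
      (a : ℂ))
    rw [show (a : ℂ) ^ 2 - ((a ^ 2 : ℝ) : ℂ) = 0 by push_cast; ring] at h
    exact h.mono_left nhdsWithin_le_nhds
  have hexp : ∀ z : ℂ, 0 < z.im → stieltjes (fun t => ‖W v t‖ ^ 2) z =
      m1 + (z ^ 2 - ((a ^ 2 : ℝ) : ℂ)) *
        (m2 + (z ^ 2 - ((a ^ 2 : ℝ) : ℂ)) * stieltjes (reducedDensity v a) z) := by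
    intro z hz
    rw [stieltjes_eq_add_mul (W_plancherel hv).1 hi1 (ae_sq_sub_ne_zero _) hz,
      stieltjes_eq_add_mul hi1 hi2 (ae_sq_sub_ne_zero _) hz]
    rfl
  have hH : Tendsto (fun z : ℂ => (m2 : ℂ) + (z ^ 2 - ((a ^ 2 : ℝ) : ℂ)) *
      stieltjes (reducedDensity v a) z) (𝓝[{z | 0 < z.im}] (a : ℂ)) (𝓝 m2) := by
    simpa using hT.const_add (m2 : ℂ)
  have : (𝓝[{z : ℂ | 0 < z.im}] (a : ℂ)).NeBot := by
    rw [← mem_closure_iff_nhdsWithin_neBot, Complex.closure_setOfPred_lt_im]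
    simp
  have hD0 : (1 : ℂ) + α / (4 * Real.pi) * m1 = 0 := by
    have t1 : Tendsto (fun z => 1 + α / (4 * Real.pi) * stieltjes (fun t => ‖W v t‖ ^ 2) z)
        (𝓝[{z | 0 < z.im}] (a : ℂ)) (𝓝 (1 + α / (4 * Real.pi) * m1)) := by
      have := (((hsub.mul hH).const_add (m1 : ℂ)).const_mul
        ((α : ℂ) / (4 * Real.pi))).const_add (1 : ℂ)
      rw [zero_mul, add_zero] at this
      refine this.congr' ?_
      filter_upwards [self_mem_nhdsWithin] with z hz
      rw [hexp z hz]
    have t2 : Tendsto (fun z => 1 + α / (4 * Real.pi) * stieltjes (fun t => ‖W v t‖ ^ 2) z)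
        (𝓝[{z | 0 < z.im}] (a : ℂ)) (𝓝 0) := by
      have t3 : Tendsto (fun z : ℂ => -(2 * Complex.I * z / α)) (𝓝[{z | 0 < z.im}] (a : ℂ))
          (𝓝 (-(2 * Complex.I * a / α))) :=
        (Continuous.tendsto (by fun_prop) _).mono_left nhdsWithin_le_nhds
      have hne : -(2 * Complex.I * a / α) ≠ 0 :=
        neg_ne_zero.2 (div_ne_zero (mul_ne_zero (mul_ne_zero two_ne_zero Complex.I_ne_zero) haC)
          hαC)
      have t4 := (tendsto_r hv (α := α) a).div t3 hne
      rw [hra, zero_div] at t4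
      refine t4.congr' ?_
      filter_upwards [self_mem_nhdsWithin, t3.eventually_ne hne] with z hz hz'
      simp only [Pi.div_apply]
      rw [r_eq_mul_stieltjes hv hα.ne hz, mul_div_cancel_left₀ _ hz']
    exact tendsto_nhds_unique t1 t2
  have hκa : (a : ℂ) ^ 2 + κ ^ 2 ≠ 0 := by
    have : a ^ 2 + κ ^ 2 ≠ 0 := by positivity
    exact_mod_cast this
  refine ⟨(a : ℂ) ^ 4 / (a ^ 2 + κ ^ 2) * (α / (4 * Real.pi) * m2), ?_, ?_⟩
  · have : (m2 : ℂ) ≠ 0 := by exact_mod_cast hm2pos.ne'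
    exact mul_ne_zero (div_ne_zero (pow_ne_zero _ haC) hκa)
      (mul_ne_zero (div_ne_zero hαC (mul_ne_zero (by norm_num) hpi)) this)
  · have t5 : Tendsto (fun z : ℂ => z ^ 4 / (z ^ 2 + κ ^ 2)) (𝓝[{z | 0 < z.im}] (a : ℂ))
        (𝓝 ((a : ℂ) ^ 4 / (a ^ 2 + κ ^ 2))) :=
      (ContinuousAt.tendsto (f := fun z : ℂ => z ^ 4 / (z ^ 2 + (κ : ℂ) ^ 2))
        (ContinuousAt.div (by fun_prop) (by fun_prop) hκa)).mono_left nhdsWithin_le_nhds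
    have hne : Tendsto (fun z : ℂ => z ^ 2 + (κ : ℂ) ^ 2) (𝓝[{z | 0 < z.im}] (a : ℂ))
        (𝓝 ((a : ℂ) ^ 2 + κ ^ 2)) :=
      (Continuous.tendsto (by fun_prop : Continuous fun z : ℂ => z ^ 2 + (κ : ℂ) ^ 2)
        _).mono_left nhdsWithin_le_nhds
    refine (t5.mul (hH.const_mul ((α : ℂ) / (4 * Real.pi)))).congr' ?_
    filter_upwards [self_mem_nhdsWithin, hne.eventually_ne hκa,
      eventually_sq_sub_ne_zero a _ inf_le_right] with z hz hz1 hz2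
    have e := sq_add_mul_reducedDet hv hα.ne hκ hrκ hz
    rw [hexp z hz] at e
    have e2 : reducedDet v α κ z = z ^ 2 * (α / (4 * Real.pi) * ((z ^ 2 - (a : ℂ) ^ 2) *
        (m2 + (z ^ 2 - ((a ^ 2 : ℝ) : ℂ)) * stieltjes (reducedDensity v a) z))) /
          (z ^ 2 + κ ^ 2) := by
      rw [eq_div_iff hz1, mul_comm, e]
      push_cast
      linear_combination z ^ 2 * hD0
    rw [e2]
    field_simp

theorem tendsto_sq_div_sq_sub_cobounded (c : ℂ) :
    Tendsto (fun z : ℂ => z ^ 2 / (z ^ 2 - c)) (Bornology.cobounded ℂ) (𝓝 1) := by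
  have h : Tendsto (fun z : ℂ => c * (z ^ 2)⁻¹) (Bornology.cobounded ℂ) (𝓝 0) := by
    have h1 : Tendsto (fun z : ℂ => z⁻¹) (Bornology.cobounded ℂ) (𝓝 0) :=
      tendsto_inv₀_cobounded
    have := (h1.pow 2).const_mul c
    simpa using this
  have h2 := (h.const_sub 1).inv₀ (by simp)
  rw [sub_zero, inv_one] at h2
  refine h2.congr' ?_
  have h0 : ∀ᶠ z : ℂ in Bornology.cobounded ℂ, z ≠ 0 :=
    Bornology.eventually_ne_cobounded 0
  filter_upwards [h0] with z hz
  have hz2 : z ^ 2 ≠ 0 := pow_ne_zero 2 hz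
  rw [show (1 : ℂ) - c * (z ^ 2)⁻¹ = (z ^ 2 - c) / z ^ 2 by field_simp, inv_div]

/-- The function equals `(1 + iα G(z)/(2z)) z²/(z² + κ²)`, where `G = greenForm v` is bounded. -/
theorem tendsto_reducedDet_cobounded (hv : Admissible v) (hα : α ≠ 0) (hκ : 0 < κ)
    (hrκ : r v α (Complex.I * κ) = 0) :
    Tendsto (reducedDet v α κ) (Bornology.cobounded ℂ ⊓ 𝓟 {z | 0 < z.im}) (𝓝 1) := by
  have hα' : (α : ℂ) ≠ 0 := by exact_mod_cast hα
  have h1 : Tendsto (fun z : ℂ => (z : ℂ)⁻¹) (Bornology.cobounded ℂ ⊓ 𝓟 {z | 0 < z.im}) (𝓝 0) :=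
    tendsto_inv₀_cobounded.mono_left inf_le_left
  have h2 : Tendsto (fun z : ℂ => z⁻¹ * greenForm v z)
      (Bornology.cobounded ℂ ⊓ 𝓟 {z | 0 < z.im}) (𝓝 0) := by
    have hb : IsBoundedUnder (· ≤ ·) (Bornology.cobounded ℂ ⊓ 𝓟 {z : ℂ | 0 < z.im})
        (norm ∘ greenForm v) := by
      refine ⟨2 * ∫ p, ‖tensor v p‖, ?_⟩
      rw [eventually_map]
      filter_upwards [mem_inf_of_right (mem_principal_self _)] with z hz
      exact norm_greenForm_le hv (le_of_lt hz)
    exact h1.zero_mul_isBoundedUnder_le hb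
  have h3 := ((h2.const_mul (Complex.I * α / 2)).const_add 1).mul
    ((tendsto_sq_div_sq_sub_cobounded (-(κ : ℂ) ^ 2)).mono_left
      (inf_le_left : Bornology.cobounded ℂ ⊓ 𝓟 {z : ℂ | 0 < z.im} ≤ _))
  rw [mul_zero, add_zero, mul_one] at h3
  refine h3.congr' ?_
  have hn : ∀ᶠ z : ℂ in Bornology.cobounded ℂ, κ < ‖z‖ := by
    have := tendsto_norm_cobounded_atTop (E := ℂ)
    exact this.eventually (eventually_gt_atTop κ)
  filter_upwards [mem_inf_of_right (mem_principal_self _), mem_inf_of_left hn] with z hz hzn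
  have hz' : 0 < z.im := hz
  have hz0 : z ≠ 0 := by rintro rfl; simp at hz'
  have hne : z ^ 2 + (κ : ℂ) ^ 2 ≠ 0 := by
    intro h
    have h4 : ‖z‖ ^ 2 = κ ^ 2 := by
      rw [← norm_pow, eq_neg_of_add_eq_zero_left h, norm_neg, norm_pow, Complex.norm_real,
        Real.norm_eq_abs, sq_abs]
    have h5 : κ < ‖z‖ := hzn
    nlinarith
  have e := two_mul_sq_add_mul_reducedDet hv hα hκ hrκ hz'
  rw [r_eq_greenForm hv α hz'.le] at e
  rw [sub_neg_eq_add]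
  have e2 : reducedDet v α κ z = Complex.I * α * z * (greenForm v z - 2 * Complex.I * z / α) /
      (2 * (z ^ 2 + κ ^ 2)) := by
    rw [eq_div_iff (mul_ne_zero two_ne_zero hne), ← e]; ring
  rw [e2]
  field_simp
  linear_combination 2 * z * Complex.I_sq

end DenominatorFunction

end RankOneScattering

end

noncomputable section

namespace RankOneScattering

/-! ### Continuity of branches of the logarithm up to the boundary. -/

section Branch

/-- The values lie in the discrete set `πℤ`, and the domain is preconnected. -/
theorem eq_of_sin_eq_zero {X : Type*} [TopologicalSpace X] {s : Set X} (hs : IsPreconnected s)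
    {h : X → ℝ} (hc : ContinuousOn h s) (h0 : ∀ x ∈ s, Real.sin (h x) = 0) {x y : X}
    (hx : x ∈ s) (hy : y ∈ s) : h x = h y := by
  refine hs.constant_of_mapsTo (T := (AddSubgroup.zmultiples Real.pi : Set ℝ))
    ⟨inferInstanceAs (DiscreteTopology (AddSubgroup.zmultiples Real.pi))⟩ hc ?_ hx hy
  intro z hz
  obtain ⟨n, hn⟩ := Real.sin_eq_zero_iff.1 (h0 z hz)
  exact ⟨n, by simpa using hn⟩

/-- A continuous logarithm in the upper half-plane of a function with a nonzero limit at a real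
point has a limit there. -/
theorem exists_tendsto_of_exp_eq {f F : ℂ → ℂ} (hf : ContinuousOn f {z | 0 < z.im})
    (hF : ∀ z : ℂ, 0 < z.im → Complex.exp (f z) = F z) {x c : ℂ} (hc : c ≠ 0)
    (hlim : Tendsto F (𝓝[{z | 0 < z.im}] x) (𝓝 c)) :
    ∃ y, Tendsto f (𝓝[{z | 0 < z.im}] x) (𝓝 y) := by
  have h1 : Tendsto (fun z => F z / c) (𝓝[{z | 0 < z.im}] x) (𝓝 1) := by
    have := hlim.div_const c
    rwa [div_self hc] at this
  have h2 : ∀ᶠ z in 𝓝[{z | 0 < z.im}] x, F z / c ∈ Complex.slitPlane :=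
    h1.eventually (Complex.isOpen_slitPlane.mem_nhds Complex.one_mem_slitPlane)
  obtain ⟨δ, hδ, hsub⟩ := Metric.mem_nhdsWithin_iff.1 h2
  rcases (Metric.ball x δ ∩ {z : ℂ | 0 < z.im}).eq_empty_or_nonempty with he | ⟨w, hw⟩
  · have hbot : 𝓝[{z : ℂ | 0 < z.im}] x = ⊥ := by
      rw [← empty_mem_iff_bot, ← he]
      exact inter_mem (mem_nhdsWithin_of_mem_nhds (Metric.ball_mem_nhds x hδ)) self_mem_nhdsWithin
    exact ⟨0, by rw [hbot]; exact tendsto_bot⟩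
  have hFc : ContinuousOn F {z | 0 < z.im} :=
    (Complex.continuous_exp.comp_continuousOn hf).congr fun z hz => (hF z hz).symm
  have hpre : IsPreconnected (Metric.ball x δ ∩ {z : ℂ | 0 < z.im}) :=
    ((convex_ball x δ).inter (convex_halfSpace_im_gt 0)).isPreconnected
  -- Near `x` the quotient `F/c` is in the slit plane, so `f` and this local logarithm of `F` differ
  -- by a continuous function with values in `2πiℤ`; on the convex half-ball it is constant.
  set g : ℂ → ℂ := fun z => f z - Complex.log (F z / c) - Complex.log c with hg
  have hgc : ContinuousOn g (Metric.ball x δ ∩ {z : ℂ | 0 < z.im}) := by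
    refine ((hf.mono inter_subset_right).sub ?_).sub continuousOn_const
    exact ((hFc.mono inter_subset_right).div_const c).clog fun z hz => hsub hz
  have hexp : ∀ z ∈ Metric.ball x δ ∩ {z : ℂ | 0 < z.im}, Complex.exp (g z) = 1 := by
    intro z hz
    have hz' : 0 < z.im := hz.2
    have hFz : F z ≠ 0 := by rw [← hF z hz']; exact Complex.exp_ne_zero _
    rw [hg]
    simp only
    rw [Complex.exp_sub, Complex.exp_sub, Complex.exp_log (div_ne_zero hFz hc),
      Complex.exp_log hc, hF z hz', div_div, div_mul_cancel₀ _ hc, div_self hFz]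
  have hre : ∀ z ∈ Metric.ball x δ ∩ {z : ℂ | 0 < z.im}, (g z).re = 0 ∧
      Real.sin ((g z).im / 2) = 0 := by
    intro z hz
    obtain ⟨n, hn⟩ := Complex.exp_eq_one_iff.1 (hexp z hz)
    rw [hn]
    constructor
    · simp
    · have : ((n : ℂ) * (2 * Real.pi * Complex.I)).im / 2 = n * Real.pi := by
        simp
        ring
      rw [this, Real.sin_int_mul_pi]
  have hconst : ∀ z ∈ Metric.ball x δ ∩ {z : ℂ | 0 < z.im}, g z = g w := by
    intro z hz
    apply Complex.ext
    · rw [(hre z hz).1, (hre w hw).1]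
    · have := eq_of_sin_eq_zero hpre
        ((Complex.continuous_im.comp_continuousOn hgc).div_const 2)
        (fun z hz => (hre z hz).2) hz hw
      simp only [Function.comp_apply] at this
      linarith
  refine ⟨Complex.log 1 + (Complex.log c + g w), ?_⟩
  have h3 : Tendsto (fun z => Complex.log (F z / c)) (𝓝[{z | 0 < z.im}] x) (𝓝 (Complex.log 1)) :=
    h1.clog Complex.one_mem_slitPlane
  refine (h3.add_const (Complex.log c + g w)).congr' ?_
  filter_upwards [self_mem_nhdsWithin, mem_nhdsWithin_of_mem_nhds (Metric.ball_mem_nhds x hδ)]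
    with z hz hzb
  rw [← hconst z ⟨hzb, hz⟩, hg]
  ring

end Branch

/-- The spectral hypotheses: `α < 0`, `iκ` is a zero of `r`, and the real zeros of `r` are
exactly `0` and the points `±λₖ`. -/
structure SpectralData (v : ℝ → ℂ) (α κ : ℝ) {q : ℕ} (lam : Fin q → ℝ) : Prop where
  admissible : Admissible v
  neg : α < 0
  pos : 0 < κ
  root : r v α (Complex.I * κ) = 0
  lam_pos : ∀ k, 0 < lam k
  lam_inj : Function.Injective lam
  real_root : ∀ x : ℝ, r v α x = 0 ↔ x = 0 ∨ ∃ k, x = lam k ∨ x = -lam k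

/-- The logarithm, in the upper half-plane, of the reduced determinant with its real zeros
divided out. -/
def logDet (v : ℝ → ℂ) (α κ : ℝ) {q : ℕ} (lam : Fin q → ℝ) (z : ℂ) : ℂ :=
  Complex.log (reducedDet v α κ z) +
    ∑ k, Complex.log (z ^ 2 / (z ^ 2 - (lam k : ℂ) ^ 2))

/-! ### The logarithm of the determinant and its boundary values. -/

namespace SpectralData

variable {v : ℝ → ℂ} {α κ : ℝ} {q : ℕ} {lam : Fin q → ℝ}

theorem exp_logDet (h : SpectralData v α κ lam) {z : ℂ} (hz : 0 < z.im) :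
    Complex.exp (logDet v α κ lam z) =
      reducedDet v α κ z * ∏ k, z ^ 2 / (z ^ 2 - (lam k : ℂ) ^ 2) := by
  rw [logDet, Complex.exp_add, Complex.exp_sum, Complex.exp_log
    (Complex.slitPlane_ne_zero (reducedDet_mem_slitPlane h.admissible h.neg h.pos h.root hz))]
  congr 1
  refine Finset.prod_congr rfl fun k _ => Complex.exp_log (Complex.slitPlane_ne_zero
    (sq_div_sq_sub_mem_slitPlane _ (h.lam_pos k).ne' hz))

theorem differentiableOn_logDet (h : SpectralData v α κ lam) :
    DifferentiableOn ℂ (logDet v α κ lam) {z | 0 < z.im} := by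
  refine DifferentiableOn.add ((differentiableOn_reducedDet h.admissible h.pos).clog fun z hz =>
    reducedDet_mem_slitPlane h.admissible h.neg h.pos h.root hz) ?_
  refine DifferentiableOn.fun_sum fun k _ => ?_
  refine DifferentiableOn.clog ?_ fun z hz =>
    sq_div_sq_sub_mem_slitPlane _ (h.lam_pos k).ne' hz
  refine DifferentiableOn.div (by fun_prop) (by fun_prop) fun z hz => ?_
  rw [← neg_sub]
  exact neg_ne_zero.2 (sq_sub_sq_ne_zero hz _)

theorem abs_im_logDet_le (v : ℝ → ℂ) (α κ : ℝ) {q : ℕ} (lam : Fin q → ℝ) (z : ℂ) :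
    |(logDet v α κ lam z).im| ≤ Real.pi * (q + 1) := by
  rw [logDet, Complex.add_im, Complex.im_sum]
  refine (abs_add_le _ _).trans ?_
  have h1 := Complex.abs_arg_le_pi (reducedDet v α κ z)
  have h2 : |∑ k, (Complex.log (z ^ 2 / (z ^ 2 - (lam k : ℂ) ^ 2))).im| ≤ ∑ _k : Fin q, Real.pi :=
    (Finset.abs_sum_le_sum_abs _ _).trans (Finset.sum_le_sum fun k _ => by
      rw [Complex.log_im]; exact Complex.abs_arg_le_pi _)
  rw [Finset.sum_const, Finset.card_univ, Fintype.card_fin, nsmul_eq_mul] at h2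
  rw [Complex.log_im]
  linarith

/-- Conjugation commutes with the principal logarithm off the negative axis, and each logarithm here
has its argument in the slit plane. -/
theorem logDet_neg_conj (h : SpectralData v α κ lam) {z : ℂ} (hz : 0 < z.im) :
    logDet v α κ lam (-starRingEnd ℂ z) = starRingEnd ℂ (logDet v α κ lam z) := by
  rw [logDet, logDet, map_add, map_sum, reducedDet_neg_conj, Complex.log_conj _
    (Complex.mem_slitPlane_iff_arg.1
      (reducedDet_mem_slitPlane h.admissible h.neg h.pos h.root hz)).1]
  congr 1
  refine Finset.sum_congr rfl fun k _ => ?_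
  rw [← Complex.log_conj _ (Complex.mem_slitPlane_iff_arg.1
    (sq_div_sq_sub_mem_slitPlane _ (h.lam_pos k).ne' hz)).1]
  simp

theorem tendsto_logDet_cobounded (h : SpectralData v α κ lam) :
    Tendsto (logDet v α κ lam) (Bornology.cobounded ℂ ⊓ 𝓟 {z | 0 < z.im}) (𝓝 0) := by
  have h1 := (tendsto_reducedDet_cobounded h.admissible h.neg.ne h.pos h.root).clog
    Complex.one_mem_slitPlane
  have h2 : Tendsto (fun z : ℂ => ∑ k, Complex.log (z ^ 2 / (z ^ 2 - (lam k : ℂ) ^ 2)))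
      (Bornology.cobounded ℂ ⊓ 𝓟 {z | 0 < z.im}) (𝓝 (∑ _k : Fin q, Complex.log 1)) :=
    tendsto_finsetSum _ fun k _ => ((tendsto_sq_div_sq_sub_cobounded _).mono_left
      inf_le_left).clog Complex.one_mem_slitPlane
  have h3 := h1.add h2
  simp only [Complex.log_one, Finset.sum_const_zero, add_zero] at h3
  exact h3

theorem sq_sub_ne_zero (h : SpectralData v α κ lam) {x : ℝ} (hx : r v α x ≠ 0) (k : Fin q) :
    (x : ℂ) ^ 2 - (lam k : ℂ) ^ 2 ≠ 0 := by
  intro h0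
  apply hx
  rw [h.real_root]
  right
  refine ⟨k, ?_⟩
  have : x ^ 2 = lam k ^ 2 := by exact_mod_cast sub_eq_zero.1 h0
  exact sq_eq_sq_iff_eq_or_eq_neg.1 this

theorem tendsto_sq_div (a : ℂ) {b : ℂ} (hb : a ^ 2 - b ≠ 0) (s : Set ℂ) :
    Tendsto (fun z : ℂ => z ^ 2 / (z ^ 2 - b)) (𝓝[s] a) (𝓝 (a ^ 2 / (a ^ 2 - b))) :=
  (ContinuousAt.tendsto (f := fun z : ℂ => z ^ 2 / (z ^ 2 - b))
    (ContinuousAt.div (by fun_prop) (by fun_prop) hb)).mono_left nhdsWithin_le_nhds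

/-- The boundary value of `exp ∘ logDet` away from the real zeros of `r`. -/
def boundaryDet (v : ℝ → ℂ) (α κ : ℝ) {q : ℕ} (lam : Fin q → ℝ) (x : ℝ) : ℂ :=
  Complex.I * α * x * r v α x / (2 * ((x : ℂ) ^ 2 + κ ^ 2)) *
    ∏ k, (x : ℂ) ^ 2 / ((x : ℂ) ^ 2 - (lam k : ℂ) ^ 2)

theorem tendsto_det (h : SpectralData v α κ lam) {x : ℝ} (hx : r v α x ≠ 0) :
    Tendsto (fun z => reducedDet v α κ z * ∏ k, z ^ 2 / (z ^ 2 - (lam k : ℂ) ^ 2))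
      (𝓝[{z | 0 < z.im}] (x : ℂ)) (𝓝 (boundaryDet v α κ lam x)) :=
  (tendsto_reducedDet h.admissible h.neg.ne h.pos h.root x).mul
    (tendsto_finsetProd _ fun k _ => tendsto_sq_div _ (h.sq_sub_ne_zero hx k) _)

theorem ne_zero_of_r_ne_zero (h : SpectralData v α κ lam) {x : ℝ} (hx : r v α x ≠ 0) : x ≠ 0 :=
  fun h0 => hx ((h.real_root x).2 (Or.inl h0))

theorem boundaryDet_ne_zero (h : SpectralData v α κ lam) {x : ℝ} (hx : r v α x ≠ 0) :
    boundaryDet v α κ lam x ≠ 0 := by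
  have hx0 : (x : ℂ) ≠ 0 := by exact_mod_cast h.ne_zero_of_r_ne_zero hx
  have hα : (α : ℂ) ≠ 0 := by exact_mod_cast h.neg.ne
  have hκ : (x : ℂ) ^ 2 + κ ^ 2 ≠ 0 := by
    have := h.pos
    have : x ^ 2 + κ ^ 2 ≠ 0 := by positivity
    exact_mod_cast this
  refine mul_ne_zero (div_ne_zero (mul_ne_zero (mul_ne_zero (mul_ne_zero Complex.I_ne_zero hα)
    hx0) hx) (mul_ne_zero two_ne_zero hκ)) (Finset.prod_ne_zero_iff.2 fun k _ =>
      div_ne_zero (pow_ne_zero 2 hx0) (h.sq_sub_ne_zero hx k))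

/-- At `±λⱼ` the `j`-th factor absorbs the simple zero; the other factors are regular there because
the `λₖ` are positive and distinct. -/
theorem exists_tendsto_det (h : SpectralData v α κ lam) {x : ℝ} (hx0 : x ≠ 0) :
    ∃ c : ℂ, c ≠ 0 ∧ Tendsto (fun z => reducedDet v α κ z *
      ∏ k, z ^ 2 / (z ^ 2 - (lam k : ℂ) ^ 2)) (𝓝[{z | 0 < z.im}] (x : ℂ)) (𝓝 c) := by
  by_cases hx : r v α x = 0
  · obtain ⟨j, hj⟩ := ((h.real_root x).1 hx).resolve_left hx0
    have hxj : x ^ 2 = lam j ^ 2 := sq_eq_sq_iff_eq_or_eq_neg.2 hj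
    have hxjC : (lam j : ℂ) ^ 2 = (x : ℂ) ^ 2 := by exact_mod_cast hxj.symm
    obtain ⟨c, hc, hlim⟩ := tendsto_reducedDet_mul h.admissible h.neg h.pos h.root hx0 hx
    have hx0' : (x : ℂ) ≠ 0 := by exact_mod_cast hx0
    have hne : ∀ k ∈ Finset.univ.erase j, (x : ℂ) ^ 2 - (lam k : ℂ) ^ 2 ≠ 0 := by
      intro k hk h0
      have h1 : lam k ^ 2 = lam j ^ 2 := by
        rw [← hxj]; exact_mod_cast (sub_eq_zero.1 h0).symm
      have h2 : lam k = lam j :=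
        (sq_eq_sq₀ (h.lam_pos k).le (h.lam_pos j).le).1 h1
      exact (Finset.mem_erase.1 hk).1 (h.lam_inj h2)
    refine ⟨c * ∏ k ∈ Finset.univ.erase j, (x : ℂ) ^ 2 / ((x : ℂ) ^ 2 - (lam k : ℂ) ^ 2),
      mul_ne_zero hc (Finset.prod_ne_zero_iff.2 fun k hk =>
        div_ne_zero (pow_ne_zero 2 hx0') (hne k hk)), ?_⟩
    refine (hlim.mul (tendsto_finsetProd _ fun k hk => tendsto_sq_div _ (hne k hk) _)).congr
      fun z => ?_
    rw [← Finset.mul_prod_erase Finset.univ _ (Finset.mem_univ j), hxjC, mul_assoc]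
  · exact ⟨_, h.boundaryDet_ne_zero hx, h.tendsto_det hx⟩

theorem exists_tendsto_logDet (h : SpectralData v α κ lam) {z : ℂ} (hz : 0 ≤ z.im)
    (hz0 : z ≠ 0) : ∃ y, Tendsto (logDet v α κ lam) (𝓝[{z | 0 < z.im}] z) (𝓝 y) := by
  rcases hz.eq_or_lt with hz' | hz'
  · obtain ⟨x, rfl⟩ : ∃ x : ℝ, z = x := ⟨z.re, Complex.ext rfl (by simp [← hz'])⟩
    obtain ⟨c, hc, hlim⟩ := h.exists_tendsto_det (x := x) (by exact_mod_cast hz0)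
    exact exists_tendsto_of_exp_eq h.differentiableOn_logDet.continuousOn
      (fun z hz => h.exp_logDet hz) hc hlim
  · exact ⟨_, h.differentiableOn_logDet.continuousOn z hz'⟩

/-- The continuous extension of `logDet` to the closed upper half-plane without the origin. -/
def logDetExt (v : ℝ → ℂ) (α κ : ℝ) {q : ℕ} (lam : Fin q → ℝ) : ℂ → ℂ :=
  extendFrom {z : ℂ | 0 < z.im} (logDet v α κ lam)

theorem mem_closure_upper {z : ℂ} (hz : 0 ≤ z.im) : z ∈ closure {z : ℂ | 0 < z.im} := by
  rw [Complex.closure_setOfPred_lt_im]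
  exact hz

theorem tendsto_logDetExt (h : SpectralData v α κ lam) {z : ℂ} (hz : 0 ≤ z.im) (hz0 : z ≠ 0) :
    Tendsto (logDet v α κ lam) (𝓝[{z | 0 < z.im}] z) (𝓝 (logDetExt v α κ lam z)) := by
  obtain ⟨y, hy⟩ := h.exists_tendsto_logDet hz hz0
  rwa [logDetExt, extendFrom_eq (mem_closure_upper hz) hy]

theorem neBot_upper {z : ℂ} (hz : 0 ≤ z.im) : (𝓝[{z : ℂ | 0 < z.im}] z).NeBot :=
  mem_closure_iff_nhdsWithin_neBot.1 (mem_closure_upper hz)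

theorem logDetExt_eq (h : SpectralData v α κ lam) {z : ℂ} (hz : 0 < z.im) :
    logDetExt v α κ lam z = logDet v α κ lam z :=
  extendFrom_eq (mem_closure_upper hz.le) (h.differentiableOn_logDet.continuousOn z hz)

theorem continuousOn_logDetExt (h : SpectralData v α κ lam) :
    ContinuousOn (logDetExt v α κ lam) ({z | 0 ≤ z.im} \ {0}) :=
  continuousOn_extendFrom (fun _ hz => mem_closure_upper hz.1)
    fun _ hz => h.exists_tendsto_logDet hz.1 hz.2

theorem exp_logDetExt (h : SpectralData v α κ lam) {x : ℝ} (hx : r v α x ≠ 0) :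
    Complex.exp (logDetExt v α κ lam x) = boundaryDet v α κ lam x := by
  have := neBot_upper (z := (x : ℂ)) (by simp)
  refine tendsto_nhds_unique ((h.tendsto_logDetExt (z := (x : ℂ)) (by simp)
    (by exact_mod_cast h.ne_zero_of_r_ne_zero hx)).cexp) ?_
  refine (h.tendsto_det hx).congr' ?_
  filter_upwards [self_mem_nhdsWithin] with z hz
  exact (h.exp_logDet hz).symm

theorem tendsto_logDetExt_cobounded (h : SpectralData v α κ lam) :
    Tendsto (logDetExt v α κ lam) (Bornology.cobounded ℂ ⊓ 𝓟 {z | 0 ≤ z.im}) (𝓝 0) := by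
  rw [Metric.nhds_basis_closedBall.tendsto_right_iff]
  intro ε hε
  have h1 := h.tendsto_logDet_cobounded.eventually (Metric.closedBall_mem_nhds 0 hε)
  rw [eventually_inf_principal, (Metric.hasBasis_cobounded_compl_closedBall (0 : ℂ)).eventually_iff]
    at h1
  obtain ⟨R, -, hR⟩ := h1
  rw [eventually_inf_principal]
  have h2 : ∀ᶠ z : ℂ in Bornology.cobounded ℂ, z ∈ (Metric.closedBall (0 : ℂ) R)ᶜ :=
    (Metric.hasBasis_cobounded_compl_closedBall (0 : ℂ)).mem_of_mem trivial
  filter_upwards [h2, Bornology.eventually_ne_cobounded 0] with z hz hz0 hzi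
  have := neBot_upper hzi
  refine Metric.isClosed_closedBall.mem_of_tendsto (h.tendsto_logDetExt hzi hz0) ?_
  filter_upwards [self_mem_nhdsWithin, mem_nhdsWithin_of_mem_nhds
    (Metric.isClosed_closedBall.isOpen_compl.mem_nhds hz)] with w hw hwR
  exact hR hwR hw

theorem logDetExt_neg (h : SpectralData v α κ lam) {x : ℝ} (hx : x ≠ 0) :
    logDetExt v α κ lam ((-x : ℝ) : ℂ) = starRingEnd ℂ (logDetExt v α κ lam x) := by
  have := neBot_upper (z := (x : ℂ)) (by simp)
  have h1 := h.tendsto_logDetExt (z := ((-x : ℝ) : ℂ)) (by simp) (by exact_mod_cast neg_ne_zero.2 hx)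
  have h2 := h.tendsto_logDetExt (z := (x : ℂ)) (by simp) (by exact_mod_cast hx)
  have h3 : Tendsto (fun z : ℂ => -starRingEnd ℂ z) (𝓝[{z | 0 < z.im}] (x : ℂ))
      (𝓝[{z | 0 < z.im}] ((-x : ℝ) : ℂ)) := by
    refine tendsto_nhdsWithin_iff.2 ⟨?_, ?_⟩
    · have : Continuous fun z : ℂ => -starRingEnd ℂ z := by fun_prop
      have := (this.tendsto (x : ℂ)).mono_left (nhdsWithin_le_nhds (s := {z : ℂ | 0 < z.im}))
      simpa using this
    · filter_upwards [self_mem_nhdsWithin] with z hz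
      simpa using hz
  refine tendsto_nhds_unique (h1.comp h3) ?_
  refine ((Complex.continuous_conj.tendsto _).comp h2).congr' ?_
  filter_upwards [self_mem_nhdsWithin] with z hz
  exact (h.logDet_neg_conj hz).symm

end SpectralData

end RankOneScattering

end

noncomputable section

namespace RankOneScattering

/-! ### The phase, the formula for `|W|²` and the formula for `α`. -/

namespace SpectralData

variable {v : ℝ → ℂ} {α κ : ℝ} {q : ℕ} {lam : Fin q → ℝ}

/-- The phase of the boundary values of `exp ∘ logDet`. -/
def boundaryPhase (v : ℝ → ℂ) (α κ : ℝ) {q : ℕ} (lam : Fin q → ℝ) (x : ℝ) : ℝ :=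
  if x = 0 then 0 else (logDetExt v α κ lam x).im

theorem boundaryPhase_of_ne_zero {x : ℝ} (hx : x ≠ 0) :
    boundaryPhase v α κ lam x = (logDetExt v α κ lam x).im := if_neg hx

theorem eventually_r_ne_zero (h : SpectralData v α κ lam) (x : ℝ) :
    ∀ᶠ t : ℝ in 𝓝[≠] x, r v α (t : ℂ) ≠ 0 := by
  have hfin : {t : ℝ | r v α (t : ℂ) = 0}.Finite := by
    refine (((finite_singleton (0 : ℝ)).union (finite_range lam)).union
      (finite_range fun k => -lam k)).subset ?_
    intro t ht
    rcases (h.real_root t).1 ht with h0 | ⟨k, hk | hk⟩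
    · exact Or.inl (Or.inl h0)
    · exact Or.inl (Or.inr ⟨k, hk.symm⟩)
    · exact Or.inr ⟨k, hk.symm⟩
  have := (hfin.subset sdiff_subset (t := {t : ℝ | r v α (t : ℂ) = 0} \ {x})).isClosed.isOpen_compl
  have hx : x ∈ ({t : ℝ | r v α (t : ℂ) = 0} \ {x})ᶜ := fun h => h.2 rfl
  filter_upwards [mem_nhdsWithin_of_mem_nhds (this.mem_nhds hx), self_mem_nhdsWithin] with t ht htx
  intro h0
  exact ht ⟨h0, htx⟩

/-- Apart from `i r(x)` the boundary value of the determinant is real, and `Im (i r) = Re r =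
|W|²/2`. -/
theorem exp_re_mul_sin (h : SpectralData v α κ lam) {x : ℝ} (hx : r v α x ≠ 0) :
    Real.exp (logDetExt v α κ lam x).re * Real.sin (logDetExt v α κ lam x).im =
      α * x * ‖W v x‖ ^ 2 / (4 * (x ^ 2 + κ ^ 2)) * ∏ k, x ^ 2 / (x ^ 2 - lam k ^ 2) := by
  rw [← Complex.exp_im, h.exp_logDetExt hx, boundaryDet]
  have e : Complex.I * α * x * r v α x / (2 * ((x : ℂ) ^ 2 + κ ^ 2)) *
      ∏ k, (x : ℂ) ^ 2 / ((x : ℂ) ^ 2 - (lam k : ℂ) ^ 2) =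
      ((α * x / (2 * (x ^ 2 + κ ^ 2)) * ∏ k, x ^ 2 / (x ^ 2 - lam k ^ 2) : ℝ) : ℂ) *
        (Complex.I * r v α x) := by
    push_cast
    ring
  rw [e, Complex.im_ofReal_mul, Complex.I_mul_im, ← two_re_r h.admissible α x]
  have hden : x ^ 2 + κ ^ 2 ≠ 0 := by
    have := h.pos
    positivity
  field_simp
  ring

/-- The right side is the conjugate of the boundary value divided by the value itself. The real
factor cancels, and `conj (i r)/(i r) = -conj r / r`. -/
theorem S_eq (h : SpectralData v α κ lam) {x : ℝ} (hx : r v α x ≠ 0) :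
    S v α x = Complex.exp (-2 * Complex.I * ((logDetExt v α κ lam x).im : ℂ)) := by
  have e1 : -2 * Complex.I * ((logDetExt v α κ lam x).im : ℂ) =
      starRingEnd ℂ (logDetExt v α κ lam x) - logDetExt v α κ lam x := by
    apply Complex.ext <;> simp
    ring
  have hb := h.boundaryDet_ne_zero hx
  have e : boundaryDet v α κ lam x =
      ((α * x / (2 * (x ^ 2 + κ ^ 2)) * ∏ k, x ^ 2 / (x ^ 2 - lam k ^ 2) : ℝ) : ℂ) *
        (Complex.I * r v α x) := by
    rw [boundaryDet]
    push_cast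
    ring
  rw [e1, Complex.exp_sub, Complex.exp_conj, h.exp_logDetExt hx]
  rw [e] at hb ⊢
  have hb1 := left_ne_zero_of_mul hb
  rw [map_mul, Complex.conj_ofReal, mul_div_mul_left _ _ hb1, map_mul, Complex.conj_I, S,
    r_neg_ofReal, neg_mul, ← mul_neg, mul_div_mul_left _ _ Complex.I_ne_zero]

theorem continuousOn_boundaryValue (h : SpectralData v α κ lam) :
    ContinuousOn (fun x : ℝ => logDetExt v α κ lam x) {0}ᶜ := by
  refine h.continuousOn_logDetExt.comp (by fun_prop) fun x hx => ⟨by simp, ?_⟩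
  simpa using hx

theorem continuousOn_boundaryPhase (h : SpectralData v α κ lam) :
    ContinuousOn (boundaryPhase v α κ lam) {0}ᶜ :=
  (Complex.continuous_im.comp_continuousOn h.continuousOn_boundaryValue).congr
    fun _ hx => boundaryPhase_of_ne_zero hx

theorem tendsto_ofReal_cobounded :
    Tendsto (fun t : ℝ => (t : ℂ)) (Bornology.cobounded ℝ) (Bornology.cobounded ℂ) := by
  rw [← tendsto_norm_atTop_iff_cobounded]
  simp only [Complex.norm_real]
  exact tendsto_norm_cobounded_atTop

theorem tendsto_boundaryValue (h : SpectralData v α κ lam) :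
    Tendsto (fun x : ℝ => logDetExt v α κ lam x) (Bornology.cobounded ℝ) (𝓝 0) := by
  refine h.tendsto_logDetExt_cobounded.comp (tendsto_inf.2
    ⟨tendsto_ofReal_cobounded, tendsto_principal.2 (Eventually.of_forall fun x => by simp)⟩)

theorem isPhase_boundaryPhase (h : SpectralData v α κ lam) :
    IsPhase v α (boundaryPhase v α κ lam) where
  odd x := by
    rcases eq_or_ne x 0 with rfl | hx
    · simp [boundaryPhase]
    · rw [boundaryPhase_of_ne_zero hx, boundaryPhase_of_ne_zero (neg_ne_zero.2 hx),
        h.logDetExt_neg hx, Complex.conj_im]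
  continuousOn := h.continuousOn_boundaryPhase
  tendsto := by
    have h1 : Tendsto (fun x : ℝ => (logDetExt v α κ lam x).im) atTop (𝓝 0) := by
      have := (Complex.continuous_im.tendsto _).comp
        (h.tendsto_boundaryValue.mono_left (IsOrderBornology.atTop_le_cobounded))
      rwa [Complex.zero_im] at this
    refine h1.congr' ?_
    filter_upwards [eventually_ne_atTop 0] with x hx
    exact (boundaryPhase_of_ne_zero hx).symm
  exp_eq x hx := by
    rw [boundaryPhase_of_ne_zero (h.ne_zero_of_r_ne_zero hx), h.S_eq hx]

theorem abs_boundaryPhase_le (h : SpectralData v α κ lam) (x : ℝ) :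
    |boundaryPhase v α κ lam x| ≤ Real.pi * (q + 1) := by
  rcases eq_or_ne x 0 with rfl | hx
  · simp only [boundaryPhase, if_true, abs_zero]; positivity
  · rw [boundaryPhase_of_ne_zero hx]
    have := neBot_upper (z := (x : ℂ)) (by simp)
    have h1 := h.tendsto_logDetExt (z := (x : ℂ)) (by simp) (by exact_mod_cast hx)
    exact le_of_tendsto (((Complex.continuous_im.tendsto _).comp h1).abs)
      (Eventually.of_forall fun z => abs_im_logDet_le v α κ lam z)

/-- Provides the `O(1/|t|)` decay needed by `pv_im_eq`. `W` is bounded, so `exp_re_mul_sin` makes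
`e^{Re L} sin ζ` of order `1/|t|`; far out `L` is small, so the exponential is at least `1/2` and
`|ζ| ≤ 2 |sin ζ|`. -/
theorem exists_abs_boundaryPhase_mul_le (h : SpectralData v α κ lam) :
    ∃ C, ∀ t, |boundaryPhase v α κ lam t| * |t| ≤ C := by
  set M := ∫ x, ‖oddExt v x‖ with hM
  have h1 : ∀ᶠ t : ℝ in Bornology.cobounded ℝ, ‖logDetExt v α κ lam t‖ < 1 / 2 := by
    have := h.tendsto_boundaryValue.norm
    rw [norm_zero] at this
    exact this.eventually (gt_mem_nhds (by norm_num))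
  have h2 : ∀ᶠ t : ℝ in Bornology.cobounded ℝ, |∏ k, t ^ 2 / (t ^ 2 - lam k ^ 2)| < 2 := by
    have h3 : Tendsto (fun t : ℝ => ∏ k, (t : ℂ) ^ 2 / ((t : ℂ) ^ 2 - (lam k : ℂ) ^ 2))
        (Bornology.cobounded ℝ) (𝓝 (∏ _k : Fin q, 1)) :=
      tendsto_finsetProd _ fun k _ => (tendsto_sq_div_sq_sub_cobounded _).comp tendsto_ofReal_cobounded
    have h4 := h3.norm
    simp only [Finset.prod_const_one, norm_one] at h4
    filter_upwards [h4.eventually (gt_mem_nhds (by norm_num : (1 : ℝ) < 2))] with t ht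
    rw [← Real.norm_eq_abs, ← Complex.norm_real]
    push_cast
    exact ht
  have h5 : ∀ᶠ t : ℝ in Bornology.cobounded ℝ, r v α (t : ℂ) ≠ 0 := by
    have h6 : ∀ᶠ t : ℝ in Bornology.cobounded ℝ, ∀ k, t ≠ lam k ∧ t ≠ -lam k :=
      eventually_all.2 fun k => (Bornology.eventually_ne_cobounded _).and
        (Bornology.eventually_ne_cobounded _)
    filter_upwards [h6, Bornology.eventually_ne_cobounded 0] with t ht ht0 hr
    rcases (h.real_root t).1 hr with h0 | ⟨k, hk | hk⟩
    · exact ht0 h0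
    · exact (ht k).1 hk
    · exact (ht k).2 hk
  have h7 : ∀ᶠ t : ℝ in Bornology.cobounded ℝ,
      |boundaryPhase v α κ lam t| * |t| ≤ 2 * |α| * M ^ 2 := by
    filter_upwards [h1, h2, h5] with t ht1 ht2 ht3
    have ht0 := h.ne_zero_of_r_ne_zero ht3
    rw [boundaryPhase_of_ne_zero ht0]
    set w := logDetExt v α κ lam t with hw
    have b1 : |w.im| ≤ 1 / 2 := (Complex.abs_im_le_norm w).trans ht1.le
    have b2 : -(1 / 2) ≤ w.re := by
      have := (Complex.abs_re_le_norm w).trans ht1.le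
      exact (abs_le.1 this).1
    have b3 : 1 / 2 ≤ Real.exp w.re := by
      have := Real.add_one_le_exp w.re
      linarith
    have b4 : |w.im| ≤ 2 * |Real.sin w.im| := by
      have := Real.mul_abs_le_abs_sin (x := w.im) (by linarith [Real.pi_gt_three])
      have hpi : 1 / 2 ≤ 2 / Real.pi := by
        rw [div_le_div_iff₀ (by norm_num) Real.pi_pos]
        linarith [Real.pi_lt_four]
      nlinarith [abs_nonneg w.im]
    have b5 := congrArg abs (h.exp_re_mul_sin ht3)
    rw [← hw, abs_mul, Real.abs_exp, abs_mul] at b5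
    have b6 : |t| * |α * t * ‖W v t‖ ^ 2 / (4 * (t ^ 2 + κ ^ 2))| ≤ |α| * M ^ 2 / 4 := by
      have hκ := h.pos
      have hden : (0 : ℝ) < 4 * (t ^ 2 + κ ^ 2) := by positivity
      rw [abs_div, abs_mul, abs_mul, abs_of_pos hden, abs_of_nonneg (sq_nonneg ‖W v t‖),
        ← mul_div_assoc, div_le_div_iff₀ hden (by norm_num)]
      have hW : ‖W v t‖ ^ 2 ≤ M ^ 2 := by
        have := norm_W_le h.admissible t
        gcongr
      have hts : |t| * |t| ≤ t ^ 2 + κ ^ 2 := by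
        rw [abs_mul_abs_self]; nlinarith
      calc |t| * (|α| * |t| * ‖W v t‖ ^ 2) * 4 = |α| * ‖W v t‖ ^ 2 * (4 * (|t| * |t|)) := by ring
        _ ≤ |α| * M ^ 2 * (4 * (t ^ 2 + κ ^ 2)) := by gcongr
    calc |w.im| * |t| ≤ 2 * |Real.sin w.im| * |t| := by gcongr
      _ ≤ 2 * (2 * (Real.exp w.re * |Real.sin w.im|)) * |t| := by
          gcongr
          nlinarith [abs_nonneg (Real.sin w.im)]
      _ = 4 * ((|t| * |α * t * ‖W v t‖ ^ 2 / (4 * (t ^ 2 + κ ^ 2))|) *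
          |∏ k, t ^ 2 / (t ^ 2 - lam k ^ 2)|) := by rw [b5]; ring
      _ ≤ 4 * ((|α| * M ^ 2 / 4) * 2) := by gcongr
      _ = _ := by ring
  rw [(Metric.hasBasis_cobounded_compl_closedBall (0 : ℝ)).eventually_iff] at h7
  obtain ⟨R, -, hR⟩ := h7
  refine ⟨max (2 * |α| * M ^ 2) (Real.pi * (q + 1) * R), fun t => ?_⟩
  by_cases ht : t ∈ (Metric.closedBall (0 : ℝ) R)ᶜ
  · exact (hR ht).trans (le_max_left _ _)
  · have ht' : |t| ≤ R := by simpa using ht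
    refine le_trans ?_ (le_max_right _ _)
    exact mul_le_mul (h.abs_boundaryPhase_le t) ht' (abs_nonneg _) (by positivity)

theorem pv_boundaryPhase (h : SpectralData v α κ lam) {x : ℝ} (hx : x ≠ 0) :
    PVExists (fun t => boundaryPhase v α κ lam t / (t - x)) x ∧
      pv (fun t => boundaryPhase v α κ lam t / (t - x)) x =
        Real.pi * (logDetExt v α κ lam x).re := by
  obtain ⟨C, hC⟩ := h.exists_abs_boundaryPhase_mul_le
  exact pv_im_eq (C := Real.pi * (q + 1))
    (h.differentiableOn_logDet.congr fun z hz => h.logDetExt_eq hz) h.continuousOn_logDetExt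
    (fun z hz => by rw [h.logDetExt_eq hz]; exact abs_im_logDet_le v α κ lam z)
    h.tendsto_logDetExt_cobounded (fun t ht => boundaryPhase_of_ne_zero ht)
    h.abs_boundaryPhase_le hC hx

theorem norm_W_sq_eq (h : SpectralData v α κ lam) {x : ℝ} (hx : x ≠ 0) :
    ‖W v x‖ ^ 2 = 4 * x / α * scatteringExpr κ lam (boundaryPhase v α κ lam) x := by
  have hα := h.neg.ne
  have hκ := h.pos
  rw [scatteringExpr, (pv_arccot hx).2, (h.pv_boundaryPhase hx).2, boundaryPhase_of_ne_zero hx,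
    one_div, inv_mul_cancel_left₀ Real.pi_ne_zero]
  -- At `±λⱼ` both sides vanish. Elsewhere the power `x^{-2(q+1)}` coming from `ψ` cancels the
  -- numerators `x²` of the `q` factors and turns `1/x` into `x`.
  by_cases hr : r v α x = 0
  · obtain ⟨j, hj⟩ := ((h.real_root x).1 hr).resolve_left hx
    have hxj : x ^ 2 - lam j ^ 2 = 0 := sub_eq_zero.2 (sq_eq_sq_iff_eq_or_eq_neg.2 hj)
    rw [W_eq_zero_of_r_eq_zero h.admissible hr, Finset.prod_eq_zero (Finset.mem_univ j) hxj]
    simp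
  · have e := h.exp_re_mul_sin hr
    have hne : ∀ k, x ^ 2 - lam k ^ 2 ≠ 0 := fun k => by
      exact_mod_cast h.sq_sub_ne_zero hr k
    have hP : (∏ k, (x ^ 2 - lam k ^ 2)) ≠ 0 := Finset.prod_ne_zero_iff.2 fun k _ => hne k
    rw [Finset.prod_div_distrib, Finset.prod_const, Finset.card_univ, Fintype.card_fin] at e
    have hxk : x ^ 2 + κ ^ 2 ≠ 0 := by positivity
    set P := ∏ k, (x ^ 2 - lam k ^ 2)
    calc ‖W v x‖ ^ 2 = 4 * x / α * ((x ^ 2)⁻¹ ^ (q + 1) * (x ^ 2 + κ ^ 2) * P *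
          (α * x * ‖W v x‖ ^ 2 / (4 * (x ^ 2 + κ ^ 2)) * ((x ^ 2) ^ q / P))) := by
          rw [inv_pow]
          field_simp
          ring
      _ = _ := by rw [← e]; ring

/-- Equality of the exponentials puts the difference in `πℤ` off the finitely many zeros of `r`,
hence on all of `(0, ∞)` by continuity. It is constant there and tends to `0`; oddness settles the
negative axis and the origin. -/
theorem isPhase_unique (h : SpectralData v α κ lam) {ζ₁ ζ₂ : ℝ → ℝ} (h1 : IsPhase v α ζ₁)
    (h2 : IsPhase v α ζ₂) : ζ₁ = ζ₂ := by
  have hsub : Ioi (0 : ℝ) ⊆ {0}ᶜ := fun x hx => (ne_of_gt hx : x ≠ 0)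
  have hc : ContinuousOn (fun x => ζ₁ x - ζ₂ x) (Ioi 0) :=
    (h1.continuousOn.sub h2.continuousOn).mono hsub
  have hgen : ∀ x : ℝ, r v α x ≠ 0 → Real.sin (ζ₁ x - ζ₂ x) = 0 := by
    intro x hx
    have e := (h1.exp_eq x hx).symm.trans (h2.exp_eq x hx)
    obtain ⟨n, hn⟩ := Complex.exp_eq_exp_iff_exists_int.1 e
    have hn' : (ζ₁ x - ζ₂ x : ℝ) = -n * Real.pi := by
      have := congrArg Complex.im hn
      simp at this
      linarith
    rw [hn', neg_mul, Real.sin_neg, Real.sin_int_mul_pi, neg_zero]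
  have hsin : ∀ x ∈ Ioi (0 : ℝ), Real.sin (ζ₁ x - ζ₂ x) = 0 := by
    intro x hx
    have hcx : ContinuousAt (fun x => ζ₁ x - ζ₂ x) x := hc.continuousAt (Ioi_mem_nhds hx)
    have ht : Tendsto (fun x => Real.sin (ζ₁ x - ζ₂ x)) (𝓝[≠] x)
        (𝓝 (Real.sin (ζ₁ x - ζ₂ x))) :=
      ((Real.continuous_sin.tendsto _).comp hcx.tendsto).mono_left nhdsWithin_le_nhds
    refine tendsto_nhds_unique ht (tendsto_const_nhds.congr' ?_)
    filter_upwards [h.eventually_r_ne_zero x] with t ht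
    exact (hgen t ht).symm
  have hconst : ∀ x ∈ Ioi (0 : ℝ), ζ₁ x - ζ₂ x = 0 := by
    intro x hx
    have hl : Tendsto (fun x => ζ₁ x - ζ₂ x) atTop (𝓝 0) := by
      simpa using h1.tendsto.sub h2.tendsto
    refine tendsto_nhds_unique (tendsto_const_nhds.congr' ?_) hl
    filter_upwards [eventually_gt_atTop 0] with y hy
    exact eq_of_sin_eq_zero isPreconnected_Ioi hc hsin hx hy
  funext x
  rcases lt_trichotomy x 0 with hx | rfl | hx
  · have := hconst (-x) (neg_pos.2 hx)
    rw [h1.odd, h2.odd] at this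
    linarith
  · have e1 := h1.odd 0
    have e2 := h2.odd 0
    rw [neg_zero] at e1 e2
    linarith
  · exact sub_eq_zero.1 (hconst x hx)

/-- The integrand is `(α/4)|W|²`. For normalised `v` the integral of `|W|²` over the line is `4π`,
of which the half-line carries `2π` by evenness. -/
theorem integral_scatteringExpr (h : SpectralData v α κ lam)
    (hnorm : ∫ x in Ioi (0 : ℝ), ‖v x‖ ^ 2 = 1) :
    IntegrableOn (fun x : ℝ => x * scatteringExpr κ lam (boundaryPhase v α κ lam) x) (Ioi 0) ∧
      α = 2 / Real.pi *
        ∫ x in Ioi (0 : ℝ), x * scatteringExpr κ lam (boundaryPhase v α κ lam) x := by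
  have hα := h.neg.ne
  obtain ⟨hi, he⟩ := W_plancherel h.admissible
  have e : EqOn (fun x : ℝ => α / 4 * ‖W v x‖ ^ 2)
      (fun x : ℝ => x * scatteringExpr κ lam (boundaryPhase v α κ lam) x) (Ioi 0) := by
    intro x hx
    have hx0 : x ≠ 0 := ne_of_gt hx
    simp only
    rw [h.norm_W_sq_eq hx0]
    field_simp
  refine ⟨IntegrableOn.congr_fun (hi.const_mul (α / 4)).integrableOn e measurableSet_Ioi, ?_⟩
  have heven : ∫ t, ‖W v t‖ ^ 2 = 2 * ∫ t in Ioi (0 : ℝ), ‖W v t‖ ^ 2 := by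
    rw [← integral_comp_abs (f := fun t => ‖W v t‖ ^ 2)]
    congr 1; ext t
    rcases abs_choice t with ht | ht
    · rw [ht]
    · rw [ht, W_neg, norm_neg]
  rw [← setIntegral_congr_fun measurableSet_Ioi e, integral_const_mul]
  have : ∫ t in Ioi (0 : ℝ), ‖W v t‖ ^ 2 = 2 * Real.pi := by
    rw [hnorm, heven] at he
    linarith
  rw [this]
  have := Real.pi_ne_zero
  field_simp
  norm_num

end SpectralData

end RankOneScattering

end

theorem theorem4p5 (v : ℝ → ℂ) (hv : RankOneScattering.Admissible v)
    (α : ℝ) (hα : α < 0)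
    (κ : ℝ) (hκ : 0 < κ) (hrκ : RankOneScattering.r v α (Complex.I * (κ : ℂ)) = 0)
    (q : ℕ) (lam : Fin q → ℝ) (hlam_pos : ∀ k, 0 < lam k) (hlam_inj : Function.Injective lam)
    (hlam : ∀ x : ℝ, RankOneScattering.r v α (x : ℂ) = 0 ↔
      x = 0 ∨ ∃ k, x = lam k ∨ x = -lam k) :
    (∃! ζ : ℝ → ℝ, RankOneScattering.IsPhase v α ζ) ∧
    ∀ ζ : ℝ → ℝ, RankOneScattering.IsPhase v α ζ →
      (∀ x : ℝ, x ≠ 0 →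
        RankOneScattering.PVExists (fun t => RankOneScattering.arccot t / (t - x)) x ∧
        RankOneScattering.PVExists (fun t => ζ t / (t - x)) x ∧
        ‖RankOneScattering.W v x‖ ^ 2 =
          4 * x / α * RankOneScattering.scatteringExpr κ lam ζ x) ∧
      (RankOneScattering.W v 0 = 0 ∧
        Tendsto (fun x : ℝ => 4 * x / α * RankOneScattering.scatteringExpr κ lam ζ x)
          (𝓝[≠] 0) (𝓝 0)) ∧
      ((∫ x in Ioi (0 : ℝ), ‖v x‖ ^ 2) = 1 →
        IntegrableOn (fun x : ℝ => x * RankOneScattering.scatteringExpr κ lam ζ x) (Ioi 0) ∧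
        α = 2 / Real.pi *
          ∫ x in Ioi (0 : ℝ), x * RankOneScattering.scatteringExpr κ lam ζ x) := by
  have h : RankOneScattering.SpectralData v α κ lam :=
    ⟨hv, hα, hκ, hrκ, hlam_pos, hlam_inj, hlam⟩
  have hphase := h.isPhase_boundaryPhase
  refine ⟨⟨_, hphase, fun ζ hζ => h.isPhase_unique hζ hphase⟩, fun ζ hζ => ?_⟩
  obtain rfl := h.isPhase_unique hζ hphase
  have hW0 : RankOneScattering.W v 0 = 0 := by simp [RankOneScattering.W]
  refine ⟨fun x hx => ⟨(RankOneScattering.pv_arccot hx).1, (h.pv_boundaryPhase hx).1,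
    h.norm_W_sq_eq hx⟩, ⟨hW0, ?_⟩, h.integral_scatteringExpr⟩
  -- The limit at the origin is read off from the continuity of `W`; no boundary behaviour of the
  -- phase at `0` is required.
  have hlim : Tendsto (fun x => ‖RankOneScattering.W v x‖ ^ 2) (𝓝[≠] 0) (𝓝 0) := by
    have := ((RankOneScattering.continuous_W hv).norm.pow 2).tendsto 0
    simp only [Pi.pow_apply, hW0, norm_zero, zero_pow two_ne_zero] at this
    exact this.mono_left nhdsWithin_le_nhds
  refine hlim.congr' ?_
  filter_upwards [self_mem_nhdsWithin] with x hx
  exact h.norm_W_sq_eq hx
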